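/- All spaces are compactly generated and weak Hausdorff. Let $B$ be a space, and let $\mathcal R_B$ be the category of retractive spaces over $B$ (spaces $X$ with maps $B\to X\to B$ composing to the identity, and maps under and over $B$). Let $\mathcal R_{B,\mathrm{fin}}$ be its full subcategory on those $X$ for which $(X,B)$ is a finite relative CW complex. Let $\mathcal{S}p$ be the category of prespectra; an equivalence of prespectra is a map inducing isomorphisms on all stable homotopy groups $\pi_q$, $q\in\mathbb Z$. Homotopy fibers, homotopy cofibers, products and wedges of prespectra are formed levelwise (with $\mathrm{fib}(X\to Y)=X\times_Y\mathrm{Map}_*(I,Y)$ and $\mathrm{cofib}(X\to Y)=(X\wedge I)\cup_X Y$). The total homotopy fiber (cofiber) of an $n$-cube, regarded as a map of $(n-1)$-cubes, is the homotopy fiber (cofiber) of the induced map of total homotopy fibers (cofibers); for $n=0$ it is the single vertex. Write $\underline n=\{1,\dots,n\}$. For $X_1,\dots,X_n$ in $\mathcal R_B$ and $S\subseteq\underline n$ let $\bigcup_{i\in S}X_i$ be the pushout of the $X_i$, $i\in S$, along $B$. For $S\subseteq T$ there is an inclusion $\bigcup_{S}X_i\to\bigcup_{T}X_i$ and a map $\bigcup_{T}X_i\to\bigcup_{S}X_i$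 collapsing the $X_i$ with $i\notin S$ to $B$. For a functor $F:\mathcal R_B^{op}\to\mathcal{S}p$ let the cross effect $\mathrm{cross}_nF(X_1,\dots,X_n)$ be the total homotopy fiber of the cube $S\mapsto F(\bigcup_{i\in S}X_i)$ whose maps are induced by the inclusions (initial vertex $S=\underline n$), and let the co-cross effect $\mathrm{cocross}_nF(X_1,\dots,X_n)$ be the total homotopy cofiber of the cube with the same vertices whose maps are induced by the collapse maps (final vertex $S=\underline n$). **Proposition.** Let $F:\mathcal R_B^{op}\to\mathcal{S}p$ be any functor (not assumed to preserve equivalences), $n\ge 0$, and $X_1,\dots,X_n\in\mathcal R_B$. Then the composite of the natural maps $$\mathrm{cross}_nF(X_1,\dots,X_n)\xrightarrow{\ i_n\ }F\Big(\bigcup_{i\in\underline n}X_i\Big)\xrightarrow{\ p_n\ }\mathrm{cocross}_nF(X_1,\dots,X_n)$$ is an equivalence. Moreover $F(\bigcup X_i)$ splits into a sum of cross effects: $$F\Big(\bigcup_{i\in\underline n}X_i\Big)\simeq\prod_{S\subseteq\underline n}\mathrm{cocross}_{|S|}F(X_s:s\in S)\simeq\prod_{S\subseteq\underline n}\mathrm{cross}_{|S|}F(X_s:s\in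 S)\simeq\bigvee_{S\subseteq\underline n}\mathrm{cross}_{|S|}F(X_s:s\in S).$$ More precisely, the following natural maps are equivalences: the map from $F(\bigcup X_i)$ to the product of the co-cross effects with components $F(\bigcup_{\underline n}X_i)\to F(\bigcup_{S}X_i)\xrightarrow{p}\mathrm{cocross}_{|S|}F(X_s:s\in S)$, the first map being induced by the inclusion; the product over $S$ of the composites $\mathrm{cross}_{|S|}F(X_s:s\in S)\to\mathrm{cocross}_{|S|}F(X_s:s\in S)$; the canonical map from the wedge to the product of the cross effects; and the map from the wedge of the cross effects to $F(\bigcup X_i)$ with components $\mathrm{cross}_{|S|}F(X_s:s\in S)\xrightarrow{i}F(\bigcup_{S}X_i)\to F(\bigcup_{\underline n}X_i)$, the second map being induced by the collapse. The same holds for functors $\mathcal R_{B,\mathrm{fin}}^{op}\to\mathcal{S}p$ and $X_i\in\mathcal R_{B,\mathrm{fin}}$, and for covariant functors on $\mathcal R_B$ or $\mathcal R_{B,\mathrm{fin}}$; in the covariant case the cross effect is formed from the cube with the collapse maps and the co-cross effect from the cube with the inclusions, and the maps above are modified accordingly. -/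

import Mathlib

open CategoryTheory CategoryTheory.Limits Topology Opposite
universe u v

namespace CrossEffects

/-! ### Compactly generated weak Hausdorff spaces -/

/-- A space is weak Hausdorff if every continuous map into it from a compact Hausdorff space
has closed image. -/
class WeaklyHausdorffSpace (X : Type u) [TopologicalSpace X] : Prop where
  isClosed_range : ∀ (K : CompHaus.{u}) (f : C(K, X)), IsClosed (Set.range f)

section Spaces

theorem isClosed_pt {X : Type u} [TopologicalSpace X] [WeaklyHausdorffSpace X] (x : X) :
    IsClosed ({x} : Set X) := by
  have h := WeaklyHausdorffSpace.isClosed_range (CompHaus.of PUnit.{u + 1})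
    (ContinuousMap.const _ x)
  convert! h
  ext y
  simp [eq_comm]

theorem isClosed_eq_of_wh {X : Type u} [TopologicalSpace X] [WeaklyHausdorffSpace X]
    (K : Type u) [TopologicalSpace K] [CompactSpace K] [T2Space K] (f g : C(K, X)) :
    IsClosed {k | f k = g k} := by
  rw [← isOpen_compl_iff, isOpen_iff_mem_nhds]
  intro k hk
  have hU : (g ⁻¹' {f k})ᶜ ∈ 𝓝 k :=
    ((isClosed_pt (f k)).preimage g.continuous).isOpen_compl.mem_nhds (fun h => hk (Eq.symm h))
  obtain ⟨V, hV, hVU, hVc⟩ := local_compact_nhds hU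
  have hcl : IsClosed (g '' V) := by
    have : CompactSpace V := isCompact_iff_compactSpace.1 hVc
    have h := WeaklyHausdorffSpace.isClosed_range (CompHaus.of V)
      (g.comp ⟨Subtype.val, continuous_subtype_val⟩)
    convert! h
    ext y
    simp
  have hN : f ⁻¹' (g '' V)ᶜ ∈ 𝓝 k := by
    refine (hcl.isOpen_compl.preimage f.continuous).mem_nhds ?_
    rintro ⟨l, hl, hl'⟩
    exact hVU hl hl'
  filter_upwards [hV, hN] with l hl hl' h
  exact hl' ⟨l, hl, (Eq.symm h)⟩

theorem wh_of_isClosed_eq {X : Type u} [TopologicalSpace X] [CompactlyGeneratedSpace X]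
    (h : ∀ (K : CompHaus.{u}) (f g : C(K, X)), IsClosed {k | f k = g k}) :
    WeaklyHausdorffSpace X where
  isClosed_range K f := by
    refine UCompactlyGeneratedSpace.isClosed fun S g => ?_
    have h1 := h (CompHaus.of (S × K)) (g.comp ⟨Prod.fst, continuous_fst⟩)
      (f.comp ⟨Prod.snd, continuous_snd⟩)
    have h2 := isClosedMap_fst_of_compactSpace (X := S) (Y := K) _ h1
    convert! h2
    ext s
    simp only [Set.mem_preimage, Set.mem_range, Set.mem_image, Prod.exists]
    constructor
    · rintro ⟨k, hk⟩
      exact ⟨s, k, hk.symm, rfl⟩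
    · rintro ⟨s', k, hk, rfl⟩
      exact ⟨k, Eq.symm hk⟩

/-- A compactly generated space with a point-separating family of maps to weak Hausdorff
spaces is weak Hausdorff. -/
theorem wh_of_separating {X : Type u} [TopologicalSpace X] [CompactlyGeneratedSpace X]
    {ι : Type v} (Y : ι → Type u) [∀ i, TopologicalSpace (Y i)] [∀ i, WeaklyHausdorffSpace (Y i)]
    (c : ∀ i, C(X, Y i)) (hc : ∀ x y, (∀ i, c i x = c i y) → x = y) :
    WeaklyHausdorffSpace X := by
  refine wh_of_isClosed_eq fun K f g => ?_
  have : {k | f k = g k} = ⋂ i, {k | ((c i).comp f) k = ((c i).comp g) k} := by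
    ext k
    simp only [Set.mem_ofPred_eq, Set.mem_iInter, ContinuousMap.comp_apply]
    exact ⟨fun h i => by rw [h], fun h => hc _ _ h⟩
  rw [this]
  exact isClosed_iInter fun i => isClosed_eq_of_wh K _ _

instance wh_of_t2 (X : Type u) [TopologicalSpace X] [T2Space X] : WeaklyHausdorffSpace X where
  isClosed_range _ f := (isCompact_range f.continuous).isClosed

theorem continuous_prod_of_tests {Z : Type u} {K W : Type*} [TopologicalSpace Z]
    [CompactlyGeneratedSpace Z] [TopologicalSpace K] [LocallyCompactSpace K] [TopologicalSpace W]
    (g : Z × K → W)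
    (h : ∀ (S : CompHaus.{u}) (φ : C(S, Z)), Continuous fun p : S × K => g (φ p.1, p.2)) :
    Continuous g := by
  have hq : IsQuotientMap
      (fun p : (Σ i : (S : CompHaus.{u}) × C(S, Z), i.fst) => p.1.2 p.2) := by
    refine ⟨⟨?_⟩, ?_⟩
    · exact eq_compactlyGenerated (X := Z)
    · intro z
      exact ⟨⟨⟨CompHaus.of PUnit.{u + 1}, ContinuousMap.const _ z⟩, PUnit.unit⟩, rfl⟩
  refine hq.continuous_lift_prod_left ?_
  have : Continuous (fun p : (Σ i : (S : CompHaus.{u}) × C(S, Z), i.fst × K) =>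
      g (p.1.2 p.2.1, p.2.2)) := continuous_sigma fun i => h i.1 i.2
  exact this.comp (Homeomorph.sigmaProdDistrib (X := fun i :
    (S : CompHaus.{u}) × C(S, Z) => i.fst) (Y := K)).continuous

instance cg_prod {Z K : Type u} [TopologicalSpace Z] [CompactlyGeneratedSpace Z]
    [TopologicalSpace K] [CompactSpace K] [T2Space K] : CompactlyGeneratedSpace (Z × K) := by
  refine compactlyGeneratedSpace_of_continuous_maps fun f hf => ?_
  refine continuous_prod_of_tests f fun S φ => ?_
  exact hf (S × K) (fun p => (φ p.1, p.2)) (by fun_prop)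

/-- The product of a compactly generated space with the unit interval. -/
instance cg_prod_I {Z : Type u} [TopologicalSpace Z] [CompactlyGeneratedSpace Z] :
    CompactlyGeneratedSpace (Z × unitInterval) := by
  have h : CompactlyGeneratedSpace (Z × ULift.{u} unitInterval) := inferInstance
  refine compactlyGeneratedSpace_of_continuous_maps fun f hf => ?_
  refine continuous_prod_of_tests f fun S φ => ?_
  have := hf (S × ULift.{u} unitInterval) (fun p => (φ p.1, p.2.down)) (by fun_prop)
  exact this.comp (f := fun p : S × unitInterval => ((p.1, ULift.up p.2) : S × ULift.{u} unitInterval)) (by fun_prop)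

theorem isClosed_prod_quotient {Z Q : Type u} [TopologicalSpace Z] [TopologicalSpace Q] {q : Z → Q}
    (hq : IsQuotientMap q) (K : Type u) [TopologicalSpace K] [CompactSpace K] [T2Space K]
    (A : Set (Q × K)) (hA : IsClosed {p : Z × K | (q p.1, p.2) ∈ A}) : IsClosed A := by
  rw [← isOpen_compl_iff] at hA ⊢
  have : Continuous (fun p : Q × K => p ∈ Aᶜ) := by
    refine hq.continuous_lift_prod_left ?_
    exact continuous_Prop.2 hA
  exact continuous_Prop.1 this

/-- The quotient of a compactly generated space by a `k`-closed equivalence relation is weak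
Hausdorff. -/
theorem wh_of_isQuotientMap {Z Q : Type u} [TopologicalSpace Z] [TopologicalSpace Q]
    [CompactlyGeneratedSpace Z] [CompactlyGeneratedSpace Q] {q : Z → Q} (hq : IsQuotientMap q)
    (h : ∀ (K : CompHaus.{u}) (f g : C(K, Z)), IsClosed {k | q (f k) = q (g k)}) :
    WeaklyHausdorffSpace Q := by
  have h1 : ∀ (L : CompHaus.{u}) (w : C(L, Z)), IsClosed {p : Q × L | p.1 = q (w p.2)} := by
    intro L w
    refine isClosed_prod_quotient hq L _ ?_
    refine CompactlyGeneratedSpace.isClosed' fun M _ _ _ φ hφ => ?_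
    exact h (CompHaus.of M) ⟨fun m => (φ m).1, by fun_prop⟩ (w.comp ⟨fun m => (φ m).2, by fun_prop⟩)
  have h2 : ∀ (K : CompHaus.{u}) (f : C(K, Q)), IsClosed {p : Q × K | p.1 = f p.2} := by
    intro K f
    refine isClosed_prod_quotient hq K _ ?_
    refine CompactlyGeneratedSpace.isClosed' fun M _ _ _ φ hφ => ?_
    have h3 := (h1 (CompHaus.of M) ⟨fun m => (φ m).1, by fun_prop⟩).preimage
      (f := fun m : M => ((f (φ m).2, m) : Q × M)) (by fun_prop)
    convert! h3 using 1
    ext m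
    exact eq_comm
  refine wh_of_isClosed_eq fun K f g => ?_
  exact (h2 K g).preimage (f := fun k : K => ((f k, k) : Q × K)) (by fun_prop)

end Spaces

/-- The set `X` with the compactly generated topology associated to its given topology: the finest
topology for which all continuous maps from compact Hausdorff spaces to `X` stay continuous. -/
structure Kify (X : Type u) : Type u where
  /-- The underlying point. -/
  out : X

namespace Kify

variable {X : Type u} [TopologicalSpace X]

instance : TopologicalSpace (Kify X) :=
  TopologicalSpace.coinduced (Kify.mk : X → Kify X) (TopologicalSpace.compactlyGenerated.{u} X)

theorem continuous_from {Y : Type*} [TopologicalSpace Y] (f : Kify X → Y)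
    (h : ∀ (S : CompHaus.{u}) (g : C(S, X)), Continuous fun s => f ⟨g s⟩) : Continuous f := by
  rw [continuous_coinduced_dom]
  exact continuous_from_compactlyGenerated.{u} (X := X) _ h

theorem continuous_out : Continuous (out : Kify X → X) :=
  continuous_from _ fun _ g => g.continuous

theorem continuous_mk_comp {K : Type u} [TopologicalSpace K] [CompactSpace K] [T2Space K]
    {f : K → X} (hf : Continuous f) : Continuous (fun k => (⟨f k⟩ : Kify X)) := by
  have h1 : Continuous[TopologicalSpace.compactlyGenerated.{u} X, _] (Kify.mk : X → Kify X) :=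
    continuous_coinduced_rng
  refine @Continuous.comp _ _ _ _ (TopologicalSpace.compactlyGenerated.{u} X) _ _ _ h1 ?_
  rw [continuous_iff_coinduced_le]
  let F : (i : (S : CompHaus.{u}) × C(S, X)) → i.fst → X := fun i s => i.2 s
  have h2 : @Continuous _ _ _ (TopologicalSpace.compactlyGenerated.{u} X)
      (fun p : (Σ i : (S : CompHaus.{u}) × C(S, X), i.fst) => F p.1 p.2) :=
    continuous_coinduced_rng
  have h3 := @Continuous.comp _ _ _ _ _ (TopologicalSpace.compactlyGenerated.{u} X) _ _ h2
    (continuous_sigmaMk (σ := fun i : (S : CompHaus.{u}) × C(S, X) => i.fst)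
      (i := ⟨CompHaus.of K, ⟨f, hf⟩⟩))
  exact continuous_iff_coinduced_le.1 h3

instance : CompactlyGeneratedSpace (Kify X) :=
  compactlyGeneratedSpace_of_continuous_maps fun f hf =>
    continuous_from f fun S g => hf S _ (continuous_mk_comp g.continuous)

/-- A continuous map from a compactly generated space is continuous into the compactly generated
topology. -/
theorem continuous_mk_of_cg {Z : Type u} [TopologicalSpace Z] [CompactlyGeneratedSpace Z]
    {f : Z → X} (hf : Continuous f) : Continuous (fun z => (⟨f z⟩ : Kify X)) :=
  continuous_from_compactlyGeneratedSpace _ fun _ _ _ _ _ hg =>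
    continuous_mk_comp (hf.comp hg)

end Kify

/-! ### Retractive spaces -/

/-- A retractive space over `B`: a compactly generated weak Hausdorff space `X` with maps
`B → X → B` composing to the identity. -/
structure Retractive (B : Type u) [TopologicalSpace B] : Type (u + 1) where
  carrier : Type u
  [top : TopologicalSpace carrier]
  [cg : CompactlyGeneratedSpace carrier]
  [wh : WeaklyHausdorffSpace carrier]
  ret : C(carrier, B)
  sec : C(B, carrier)
  ret_sec : ∀ b, ret (sec b) = b

namespace Retractive

attribute [instance] top cg wh

variable {B : Type u} [TopologicalSpace B]

/-- A map of retractive spaces is a map under and over `B`. -/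
@[ext]
structure Hom (X Y : Retractive B) : Type u where
  map : C(X.carrier, Y.carrier)
  ret_map : ∀ x, Y.ret (map x) = X.ret x
  map_sec : ∀ b, map (X.sec b) = Y.sec b

instance : Category.{u} (Retractive B) where
  Hom := Hom
  id X := ⟨ContinuousMap.id _, fun _ => rfl, fun _ => rfl⟩
  comp f g := ⟨g.map.comp f.map, fun x => (g.ret_map _).trans (f.ret_map x),
    fun b => (congrArg g.map (f.map_sec b)).trans (g.map_sec b)⟩

@[ext]
theorem hom_ext {X Y : Retractive B} {f g : X ⟶ Y} (h : ∀ x, f.map x = g.map x) : f = g :=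
  Hom.ext (ContinuousMap.ext h)

@[simp]
theorem id_map_apply (X : Retractive B) (x : X.carrier) : Hom.map (𝟙 X) x = x := rfl

@[simp]
theorem comp_map_apply {X Y Z : Retractive B} (f : X ⟶ Y) (g : Y ⟶ Z) (x : X.carrier) :
    (f ≫ g).map x = g.map (f.map x) := rfl

/-- The map `X → B → Y`. -/
def zeroHom (X Y : Retractive B) : X ⟶ Y :=
  ⟨Y.sec.comp X.ret, fun _ => Y.ret_sec _, fun b => congrArg Y.sec (X.ret_sec b)⟩

@[simp]
theorem zeroHom_map_apply (X Y : Retractive B) (x : X.carrier) :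
    (zeroHom X Y).map x = Y.sec (X.ret x) := rfl

instance : HasZeroMorphisms (Retractive B) where
  zero X Y := ⟨zeroHom X Y⟩
  comp_zero f Z := hom_ext fun x => congrArg Z.sec (f.ret_map x)
  zero_comp X _ _ f := hom_ext fun x => f.map_sec (X.ret x)

section Union

variable {ι : Type} (X : ι → Retractive B)

/-- The generating relation of the pushout of the `X i` along `B`. -/
inductive UnionRel : B ⊕ (Σ i, (X i).carrier) → B ⊕ (Σ i, (X i).carrier) → Prop
  | glue (i : ι) (b : B) : UnionRel (Sum.inr ⟨i, (X i).sec b⟩) (Sum.inl b)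

/-- The underlying space of the pushout of the `X i` along `B`. -/
def UnionSpace : Type u := Quot (UnionRel X)

instance : TopologicalSpace (UnionSpace X) := inferInstanceAs (TopologicalSpace (Quot _))

theorem isQuotientMap_unionMk : IsQuotientMap (Quot.mk (UnionRel X) : _ → UnionSpace X) :=
  isQuotientMap_quot_mk

instance [CompactlyGeneratedSpace B] : CompactlyGeneratedSpace (UnionSpace X) :=
  have : UCompactlyGeneratedSpace.{u} (Σ i, (X i).carrier) := inferInstance
  have : UCompactlyGeneratedSpace.{u} (B ⊕ (Σ i, (X i).carrier)) := inferInstance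
  uCompactlyGeneratedSpace_of_coinduced (isQuotientMap_unionMk X).continuous
    (isQuotientMap_unionMk X).eq_coinduced

/-- The map out of the pushout induced by compatible maps. -/
def unionDesc {W : Type*} [TopologicalSpace W] (f : C(B, W)) (g : ∀ i, C((X i).carrier, W))
    (h : ∀ i b, g i ((X i).sec b) = f b) : C(UnionSpace X, W) where
  toFun := Quot.lift (Sum.elim f fun p => g p.1 p.2) (by rintro _ _ ⟨i, b⟩; exact h i b)
  continuous_toFun := continuous_quot_lift _
    (continuous_sumElim.2 ⟨f.continuous, continuous_sigma fun i => (g i).continuous⟩)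

/-- The inclusion of `X i` into the pushout. -/
def unionIncl (i : ι) : C((X i).carrier, UnionSpace X) where
  toFun x := Quot.mk _ (Sum.inr ⟨i, x⟩)
  continuous_toFun := continuous_quot_mk.comp (continuous_inr.comp continuous_sigmaMk)

/-- The inclusion of `B` into the pushout. -/
def unionBase : C(B, UnionSpace X) where
  toFun b := Quot.mk _ (Sum.inl b)
  continuous_toFun := continuous_quot_mk.comp continuous_inl

theorem unionIncl_sec (i : ι) (b : B) : unionIncl X i ((X i).sec b) = unionBase X b :=
  Quot.sound (UnionRel.glue i b)

theorem union_cases (p : UnionSpace X) :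
    (∃ b, p = unionBase X b) ∨ ∃ i x, p = unionIncl X i x := by
  obtain ⟨p | ⟨i, x⟩⟩ := p
  · exact Or.inl ⟨p, rfl⟩
  · exact Or.inr ⟨i, x, rfl⟩

/-- The retraction of the pushout onto `B`. -/
def unionRet : C(UnionSpace X, B) :=
  unionDesc X (ContinuousMap.id _) (fun i => (X i).ret) fun i b => (X i).ret_sec b

open Classical in
/-- The map `X j → X i` which is the identity if `i = j` and factors through `B` otherwise. -/
noncomputable def comparison (i j : ι) : X j ⟶ X i :=
  if h : j = i then eqToHom (congrArg X h) else zeroHom (X j) (X i)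

theorem comparison_self (i : ι) : comparison X i i = 𝟙 (X i) := by simp [comparison]

theorem comparison_ne {i j : ι} (h : j ≠ i) : comparison X i j = zeroHom (X j) (X i) := by
  simp [comparison, h]

/-- The collapse of the pushout onto `X i`. -/
noncomputable def unionCollapse (i : ι) : C(UnionSpace X, (X i).carrier) :=
  unionDesc X (X i).sec (fun j => (comparison X i j).map) fun j b => (comparison X i j).map_sec b

theorem unionCollapse_incl (i j : ι) (x : (X j).carrier) :
    unionCollapse X i (unionIncl X j x) = (comparison X i j).map x := rfl

theorem unionCollapse_incl_self (i : ι) (x : (X i).carrier) :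
    unionCollapse X i (unionIncl X i x) = x := by
  rw [unionCollapse_incl, comparison_self]; rfl

theorem unionCollapse_incl_ne {i j : ι} (h : j ≠ i) (x : (X j).carrier) :
    unionCollapse X i (unionIncl X j x) = (X i).sec ((X j).ret x) := by
  rw [unionCollapse_incl, comparison_ne X h]; rfl

theorem unionCollapse_base (i : ι) (b : B) :
    unionCollapse X i (unionBase X b) = (X i).sec b := rfl

theorem unionRet_incl (i : ι) (x : (X i).carrier) :
    unionRet X (unionIncl X i x) = (X i).ret x := rfl

theorem unionRet_base (b : B) : unionRet X (unionBase X b) = b := rfl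

theorem union_ext (p q : UnionSpace X) (h : ∀ i, unionCollapse X i p = unionCollapse X i q)
    (hr : unionRet X p = unionRet X q) : p = q := by
  have key : ∀ (b : B) (j : ι) (y : (X j).carrier),
      unionCollapse X j (unionBase X b) = unionCollapse X j (unionIncl X j y) →
      unionBase X b = unionIncl X j y := by
    intro b j y hj
    rw [unionCollapse_base, unionCollapse_incl_self] at hj
    rw [← hj, unionIncl_sec]
  obtain ⟨b, rfl⟩ | ⟨i, x, rfl⟩ := union_cases X p <;>
    obtain ⟨b', rfl⟩ | ⟨j, y, rfl⟩ := union_cases X q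
  · rw [unionRet_base, unionRet_base] at hr
    rw [hr]
  · exact key b j y (h j)
  · exact (key b' i x (h i).symm).symm
  · by_cases hij : i = j
    · subst hij
      have := h i
      rw [unionCollapse_incl_self, unionCollapse_incl_self] at this
      rw [this]
    · have h1 := h i
      have h2 := h j
      rw [unionCollapse_incl_self, unionCollapse_incl_ne X (Ne.symm hij)] at h1
      rw [unionCollapse_incl_self, unionCollapse_incl_ne X hij] at h2
      rw [unionRet_incl, unionRet_incl] at hr
      rw [h1, ← h2, unionIncl_sec, unionIncl_sec, (X j).ret_sec, hr]

instance [CompactlyGeneratedSpace B] [WeaklyHausdorffSpace B] :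
    WeaklyHausdorffSpace (UnionSpace X) := by
  refine wh_of_isClosed_eq fun K f g => ?_
  have : {k | f k = g k} = {k | ((unionRet X).comp f) k = ((unionRet X).comp g) k} ∩
      ⋂ i, {k | ((unionCollapse X i).comp f) k = ((unionCollapse X i).comp g) k} := by
    ext k
    simp only [Set.mem_ofPred_eq, Set.mem_inter_iff, Set.mem_iInter, ContinuousMap.comp_apply]
    exact ⟨fun h => by simp [h], fun h => union_ext X _ _ h.2 h.1⟩
  rw [this]
  exact (isClosed_eq_of_wh K _ _).inter (isClosed_iInter fun i => isClosed_eq_of_wh K _ _)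

variable [CompactlyGeneratedSpace B] [WeaklyHausdorffSpace B]

/-- The pushout of the `X i` along `B` (the fiberwise wedge sum) as a retractive space. -/
def unionObj : Retractive B where
  carrier := UnionSpace X
  ret := unionRet X
  sec := unionBase X
  ret_sec _ := rfl

/-- The pushout of the `X i` along `B`, with the inclusions of the `X i`. -/
def unionCofan : Cofan X :=
  Cofan.mk (unionObj X) fun i => ⟨unionIncl X i, fun _ => rfl, unionIncl_sec X i⟩

/-- The pushout along `B` is the coproduct of retractive spaces. -/
def unionCofanIsColimit : IsColimit (unionCofan X) :=
  Cofan.IsColimit.mk _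
    (fun s => ⟨unionDesc X s.pt.sec (fun i => (s.inj i).map) fun i => (s.inj i).map_sec, by
        intro p
        obtain ⟨b, rfl⟩ | ⟨i, x, rfl⟩ := union_cases X p
        · exact s.pt.ret_sec b
        · exact (s.inj i).ret_map x, fun _ => rfl⟩)
    (fun _ _ => rfl)
    (by
      intro s m hm
      refine hom_ext fun p => ?_
      obtain ⟨b, rfl⟩ | ⟨i, x, rfl⟩ := union_cases X p
      · exact m.map_sec b
      · exact congrArg (fun f => Hom.map f x) (hm i))

end Union

instance [CompactlyGeneratedSpace B] [WeaklyHausdorffSpace B] :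
    HasFiniteCoproducts (Retractive B) :=
  have : HasCoproducts.{0} (Retractive B) :=
    hasCoproducts_of_colimit_cofans (fun X => unionCofan X) fun X => unionCofanIsColimit X
  hasFiniteCoproducts_of_hasCoproducts _

/-- The property that `(X, B)` is a finite relative CW complex. -/
def isFiniteCW (B : Type u) [TopologicalSpace B] : ObjectProperty (Retractive B) := fun X =>
  ∃ h : RelCWComplex (Set.univ : Set X.carrier) (Set.range X.sec),
    @RelCWComplex.Finite X.carrier _ Set.univ (Set.range X.sec) h

theorem isClosed_range_sec (X : Retractive B) : IsClosed (Set.range X.sec) := by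
  refine CompactlyGeneratedSpace.isClosed' fun K _ _ _ f hf => ?_
  have h := isClosed_eq_of_wh K (⟨f, hf⟩ : C(K, X.carrier)) ((X.sec.comp X.ret).comp ⟨f, hf⟩)
  convert! h using 1
  ext k
  constructor
  · rintro ⟨b, hb⟩
    simp [← hb, X.ret_sec]
  · intro hk
    exact ⟨X.ret (f k), Eq.symm hk⟩

section FiniteCW

variable [CompactlyGeneratedSpace B] [WeaklyHausdorffSpace B]

open Metric in
theorem isFiniteCW_union {ι : Type} [Finite ι] (X : ι → Retractive B)
    (hX : ∀ i, isFiniteCW B (X i)) : isFiniteCW B (unionObj X) := by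
  choose h hfin using hX
  have hinj : ∀ i, Function.Injective (unionIncl X i) := fun i x y hxy => by
    rw [← unionCollapse_incl_self X i x, hxy, unionCollapse_incl_self]
  let cell : ℕ → Type u := fun n => Σ i, (h i).cell n
  let map : ∀ n, cell n → PartialEquiv (Fin n → ℝ) (UnionSpace X) := fun n c =>
    { toFun := fun t => unionIncl X c.1 ((h c.1).map n c.2 t)
      invFun := fun p => ((h c.1).map n c.2).symm (unionCollapse X c.1 p)
      source := ball 0 1
      target := unionIncl X c.1 '' ((h c.1).map n c.2).target
      map_source' := fun t ht => ⟨_, ((h c.1).map n c.2).map_source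
        (by rw [(h c.1).source_eq]; exact ht), rfl⟩
      map_target' := by
        rintro _ ⟨x, hx, rfl⟩
        rw [unionCollapse_incl_self, ← (h c.1).source_eq n c.2]
        exact ((h c.1).map n c.2).map_target hx
      left_inv' := fun t ht => by
        rw [unionCollapse_incl_self]
        exact ((h c.1).map n c.2).left_inv (by rw [(h c.1).source_eq]; exact ht)
      right_inv' := by
        rintro _ ⟨x, hx, rfl⟩
        rw [unionCollapse_incl_self, ((h c.1).map n c.2).right_inv hx] }
  have hmap : ∀ n (c : cell n) (s : Set (Fin n → ℝ)),
      map n c '' s = unionIncl X c.1 '' ((h c.1).map n c.2 '' s) := fun n c s =>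
    (Set.image_image (unionIncl X c.1) ((h c.1).map n c.2) s).symm
  have hsec : ∀ i x, unionIncl X i x ∈ Set.range (unionBase X) ↔ x ∈ Set.range (X i).sec := by
    intro i x
    constructor
    · rintro ⟨b, hb⟩
      refine ⟨b, hinj i ?_⟩
      rw [unionIncl_sec, hb]
    · rintro ⟨b, rfl⟩
      exact ⟨b, (unionIncl_sec X i b).symm⟩
  have hdisj : ∀ n (c : cell n), Disjoint (map n c '' ball 0 1) (Set.range (unionBase X)) := by
    intro n c
    rw [Set.disjoint_left, hmap]
    rintro _ ⟨x, hx, rfl⟩ hb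
    exact Set.disjoint_left.1 ((h c.1).disjointBase' n c.2) hx ((hsec _ _).1 hb)
  have hfc : ∀ n, Finite (cell n) := fun n => by
    have : ∀ i, Finite ((h i).cell n) := fun i => (hfin i).finite_cell n
    infer_instance
  have hunion : Set.range (unionBase X) ∪ ⋃ (n : ℕ) (c : cell n), map n c '' closedBall 0 1 =
      Set.univ := by
    refine Set.eq_univ_of_forall fun p => ?_
    obtain ⟨b, rfl⟩ | ⟨i, x, rfl⟩ := union_cases X p
    · exact Or.inl ⟨b, rfl⟩
    · have hx : x ∈ Set.range (X i).sec ∪ ⋃ (n : ℕ) (j : (h i).cell n),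
          (h i).map n j '' closedBall 0 1 := by
        rw [(h i).union']; trivial
      rcases hx with hx | hx
      · exact Or.inl ((hsec i x).2 hx)
      · simp only [Set.mem_iUnion] at hx
        obtain ⟨n, j, hx⟩ := hx
        refine Or.inr (Set.mem_iUnion.2 ⟨n, Set.mem_iUnion.2 ⟨⟨i, j⟩, ?_⟩⟩)
        rw [hmap]
        exact ⟨x, hx, rfl⟩
  have hbound : ∃ N, ∀ n ≥ N, IsEmpty (cell n) := by
    have h1 : ∀ i, ∀ᶠ n in Filter.atTop, IsEmpty ((h i).cell n) := fun i =>
      (hfin i).eventually_isEmpty_cell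
    have h2 := (Filter.eventually_all (l := Filter.atTop)).2 h1
    obtain ⟨N, hN⟩ := Filter.eventually_atTop.1 h2
    exact ⟨N, fun n hn => ⟨fun c => (hN n hn c.1).false c.2⟩⟩
  let inst : RelCWComplex (Set.univ : Set (UnionSpace X)) (Set.range (unionBase X)) :=
    RelCWComplex.mkFiniteType Set.univ (Set.range (unionBase X)) cell map hfc
      (fun _ _ => rfl)
      (fun n c => (unionIncl X c.1).continuous.comp_continuousOn ((h c.1).continuousOn n c.2))
      (fun n c => by
        refine ((h c.1).continuousOn_symm n c.2).comp
          (unionCollapse X c.1).continuous.continuousOn ?_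
        rintro _ ⟨x, hx, rfl⟩
        rw [unionCollapse_incl_self]
        exact hx)
      (by
        rintro ⟨n, i, c⟩ - ⟨m, j, d⟩ - hne
        rw [Function.onFun, Set.disjoint_left]
        simp only [hmap]
        rintro _ ⟨x, hx, rfl⟩ ⟨y, hy, hxy⟩
        by_cases hij : i = j
        · subst hij
          rw [hinj i hxy] at hy
          have hne' : (⟨n, c⟩ : Σ n, (h i).cell n) ≠ ⟨m, d⟩ := by
            intro hcd
            apply hne
            cases hcd
            rfl
          exact Set.disjoint_left.1
            ((h i).pairwiseDisjoint' (Set.mem_univ _) (Set.mem_univ _) hne') hx hy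
        · have h1 := congrArg (unionCollapse X i) hxy
          rw [unionCollapse_incl_self, unionCollapse_incl_ne X (Ne.symm hij)] at h1
          exact Set.disjoint_left.1 ((h i).disjointBase' n c) hx ⟨_, h1⟩)
      hdisj
      (by
        rintro n ⟨i, c⟩ t ht
        obtain ⟨J, hJ⟩ := (h i).mapsTo n c
        rcases hJ ht with hb | hb
        · exact Or.inl ((hsec _ _).2 hb)
        · simp only [Set.mem_iUnion] at hb
          obtain ⟨m, hm, j, -, hb⟩ := hb
          refine Or.inr ?_
          simp only [Set.mem_iUnion]
          refine ⟨m, hm, ⟨i, j⟩, ?_⟩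
          rw [hmap]
          exact ⟨_, hb, rfl⟩)
      (by
        rintro A - ⟨hA, hAD⟩
        obtain ⟨N, hN⟩ := hbound
        have : A = (A ∩ Set.range (unionBase X)) ∪
            ⋃ n : Fin N, ⋃ c : cell n, A ∩ map n c '' closedBall 0 1 := by
          ext p
          constructor
          · intro hp
            have hp' : p ∈ Set.range (unionBase X) ∪
                ⋃ (n : ℕ) (c : cell n), map n c '' closedBall 0 1 := by
              rw [hunion]; trivial
            rcases hp' with hp' | hp'
            · exact Or.inl ⟨hp, hp'⟩
            · simp only [Set.mem_iUnion] at hp'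
              obtain ⟨n, c, hp'⟩ := hp'
              have hn : n < N := by
                by_contra hn
                exact (hN n (not_lt.1 hn)).false c
              exact Or.inr (Set.mem_iUnion.2 ⟨⟨n, hn⟩, Set.mem_iUnion.2 ⟨c, hp, hp'⟩⟩)
          · rintro (hp | hp)
            · exact hp.1
            · simp only [Set.mem_iUnion] at hp
              obtain ⟨n, c, hp, -⟩ := hp
              exact hp
        rw [this]
        exact hAD.union (isClosed_iUnion_of_finite fun n => isClosed_iUnion_of_finite fun c =>
          hA n c))
      (isClosed_range_sec (unionObj X))
      hunion
  obtain ⟨N, hN⟩ := hbound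
  exact ⟨inst, @RelCWComplex.Finite.mk (UnionSpace X) _ Set.univ (Set.range (unionBase X)) inst
    (@RelCWComplex.FiniteDimensional.mk _ _ _ _ inst (Filter.eventually_atTop.2 ⟨N, hN⟩))
    (@RelCWComplex.FiniteType.mk _ _ _ _ inst hfc)⟩

/-- The full subcategory of finite relative CW complexes `(X, B)`. -/
abbrev FiniteCW (B : Type u) [TopologicalSpace B] : Type (u + 1) :=
  (isFiniteCW B).FullSubcategory

instance (B : Type u) [TopologicalSpace B] : HasZeroMorphisms (FiniteCW B) where
  zero _ _ := ⟨ObjectProperty.homMk 0⟩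
  comp_zero f _ := ObjectProperty.hom_ext _ (comp_zero (f := f.hom))
  zero_comp _ _ _ f := ObjectProperty.hom_ext _ (zero_comp (f := f.hom))

/-- The pushout along `B` of a finite family of finite relative CW complexes. -/
def finiteUnionCofan {ι : Type} [Finite ι] (X : ι → FiniteCW B) : Cofan X :=
  Cofan.mk ⟨unionObj fun i => (X i).obj, isFiniteCW_union _ fun i => (X i).property⟩ fun i =>
    ObjectProperty.homMk ((unionCofan fun i => (X i).obj).inj i)

/-- The pushout along `B` is the coproduct of finite relative CW complexes. -/
def finiteUnionCofanIsColimit {ι : Type} [Finite ι] (X : ι → FiniteCW B) :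
    IsColimit (finiteUnionCofan X) :=
  Cofan.IsColimit.mk _
    (fun s => ObjectProperty.homMk (Cofan.IsColimit.desc
      (unionCofanIsColimit fun i => (X i).obj) fun i => (s.inj i).hom))
    (fun _ _ => rfl)
    (fun _ _ hm => ObjectProperty.hom_ext _ (Cofan.IsColimit.hom_ext
      (unionCofanIsColimit fun i => (X i).obj) _ _ fun i =>
        congrArg InducedCategory.Hom.hom (hm i)))

instance : HasFiniteCoproducts (FiniteCW B) where
  out _ :=
    { has_colimit := fun F => HasColimit.mk
        ⟨(Cocone.precompose Discrete.natIsoFunctor.hom).obj (finiteUnionCofan fun j => F.obj ⟨j⟩),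
          (IsColimit.precomposeHomEquiv _ _).symm (finiteUnionCofanIsColimit _)⟩ }

end FiniteCW

end Retractive

/-! ### Based spaces -/

/-- A based compactly generated weak Hausdorff space. -/
structure BasedSpace : Type (u + 1) where
  carrier : Type u
  [top : TopologicalSpace carrier]
  [cg : CompactlyGeneratedSpace carrier]
  [wh : WeaklyHausdorffSpace carrier]
  pt : carrier

attribute [instance] BasedSpace.top BasedSpace.cg BasedSpace.wh

/-- A based map. -/
@[ext]
structure BasedMap (X Y : BasedSpace.{u}) : Type u where
  map : C(X.carrier, Y.carrier)
  map_pt : map X.pt = Y.pt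

namespace BasedMap

variable {X Y Z : BasedSpace.{u}}

/-- The identity. -/
def id (X : BasedSpace.{u}) : BasedMap X X := ⟨ContinuousMap.id _, rfl⟩

/-- Composition, in diagrammatic order. -/
def comp (f : BasedMap X Y) (g : BasedMap Y Z) : BasedMap X Z :=
  ⟨g.map.comp f.map, (congrArg g.map f.map_pt).trans g.map_pt⟩

end BasedMap

section Fiber

variable {X Y : BasedSpace.{u}} (f : BasedMap X Y)

/-- The points of the homotopy fiber of `f : X → Y`: pairs of a point `x` of `X` and a path in `Y`
from the base point to `f x`. -/
def FibPre : Type u :=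
  {p : X.carrier × C(unitInterval, Y.carrier) // p.2 0 = Y.pt ∧ p.2 1 = f.map p.1}

instance : TopologicalSpace (FibPre f) :=
  inferInstanceAs (TopologicalSpace {p : X.carrier × C(unitInterval, Y.carrier) //
    p.2 0 = Y.pt ∧ p.2 1 = f.map p.1})

theorem continuous_fibPre_val : Continuous (fun p : FibPre f => p.1) := continuous_subtype_val

instance : WeaklyHausdorffSpace (Kify (FibPre f)) := by
  refine wh_of_isClosed_eq fun K a b => ?_
  have ha : Continuous fun k => (a k).out.1 :=
    (continuous_fibPre_val f).comp (Kify.continuous_out.comp a.continuous)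
  have hb : Continuous fun k => (b k).out.1 :=
    (continuous_fibPre_val f).comp (Kify.continuous_out.comp b.continuous)
  have : {k | a k = b k} = {k | (a k).out.1.1 = (b k).out.1.1} ∩
      ⋂ t : unitInterval, {k | (a k).out.1.2 t = (b k).out.1.2 t} := by
    ext k
    simp only [Set.mem_ofPred_eq, Set.mem_inter_iff, Set.mem_iInter]
    constructor
    · intro h
      simp [h]
    · rintro ⟨h1, h2⟩
      have h3 : (a k).out = (b k).out :=
        Subtype.ext (Prod.ext h1 (ContinuousMap.ext h2))
      exact congrArg Kify.mk h3
  rw [this]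
  refine (isClosed_eq_of_wh K (⟨_, continuous_fst.comp ha⟩ : C(K, X.carrier))
    ⟨_, continuous_fst.comp hb⟩).inter (isClosed_iInter fun t => ?_)
  exact isClosed_eq_of_wh K
    (⟨_, (continuous_eval_const t).comp (continuous_snd.comp ha)⟩ : C(K, Y.carrier))
    ⟨_, (continuous_eval_const t).comp (continuous_snd.comp hb)⟩

/-- The homotopy fiber `X ×_Y Map_*([0,1], Y)` of a based map `f : X → Y`, where `[0,1]` is based
at `0`. -/
def hfib : BasedSpace.{u} where
  carrier := Kify (FibPre f)
  pt := ⟨⟨(X.pt, ContinuousMap.const _ Y.pt), rfl, f.map_pt.symm⟩⟩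

end Fiber

section Cofiber

variable {X Y : BasedSpace.{u}} (f : BasedMap X Y)

/-- The generating relation of the homotopy cofiber: `X ∧ [0,1]`, where `[0,1]` is based at `0`, is
glued to `Y` by `(x, 1) ∼ f x`. -/
inductive CofibRel : (X.carrier × unitInterval) ⊕ Y.carrier →
    (X.carrier × unitInterval) ⊕ Y.carrier → Prop
  | zero (x : X.carrier) : CofibRel (Sum.inl (x, 0)) (Sum.inr Y.pt)
  | pt (t : unitInterval) : CofibRel (Sum.inl (X.pt, t)) (Sum.inr Y.pt)
  | one (x : X.carrier) : CofibRel (Sum.inl (x, 1)) (Sum.inr (f.map x))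

/-- The underlying space of the homotopy cofiber. -/
def CofibSpace : Type u := Quot (CofibRel f)

instance : TopologicalSpace (CofibSpace f) := inferInstanceAs (TopologicalSpace (Quot _))

theorem isQuotientMap_cofibMk : IsQuotientMap (Quot.mk (CofibRel f) : _ → CofibSpace f) :=
  isQuotientMap_quot_mk

instance : CompactlyGeneratedSpace (CofibSpace f) :=
  have : UCompactlyGeneratedSpace.{u} ((X.carrier × unitInterval) ⊕ Y.carrier) := inferInstance
  uCompactlyGeneratedSpace_of_coinduced (isQuotientMap_cofibMk f).continuous
    (isQuotientMap_cofibMk f).eq_coinduced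

open Classical in
/-- Normal forms of the points of the homotopy cofiber. -/
noncomputable def cofibNormal (a : (X.carrier × unitInterval) ⊕ Y.carrier) :
    (X.carrier × unitInterval) ⊕ Y.carrier :=
  a.elim (fun p => if p.2 = 0 ∨ p.1 = X.pt then Sum.inr Y.pt
    else if p.2 = 1 then Sum.inr (f.map p.1) else Sum.inl p) Sum.inr

theorem cofibMk_eq_iff (a b : (X.carrier × unitInterval) ⊕ Y.carrier) :
    Quot.mk (CofibRel f) a = Quot.mk (CofibRel f) b ↔ cofibNormal f a = cofibNormal f b := by
  constructor
  · intro h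
    have : ∀ a b, CofibRel f a b → cofibNormal f a = cofibNormal f b := by
      rintro _ _ (x | t | x)
      · simp [cofibNormal]
      · simp [cofibNormal]
      · by_cases hx : x = X.pt
        · subst hx
          simp [cofibNormal, f.map_pt]
        · simp [cofibNormal, hx]
    exact congrArg (Quot.lift (cofibNormal f) this) h
  · intro h
    have key : ∀ a, Quot.mk (CofibRel f) (cofibNormal f a) = Quot.mk (CofibRel f) a := by
      rintro (⟨x, t⟩ | y)
      · by_cases h0 : t = 0
        · subst h0
          simpa [cofibNormal] using (Quot.sound (CofibRel.zero x)).symm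
        · by_cases hx : x = X.pt
          · subst hx
            simpa [cofibNormal] using (Quot.sound (CofibRel.pt t)).symm
          · by_cases h1 : t = 1
            · subst h1
              simpa [cofibNormal, hx] using (Quot.sound (CofibRel.one x)).symm
            · simp [cofibNormal, h0, hx, h1]
      · rfl
    rw [← key a, ← key b, h]

instance : WeaklyHausdorffSpace (CofibSpace f) := by
  refine wh_of_isQuotientMap (isQuotientMap_cofibMk f) fun K a b => ?_
  let Z := (X.carrier × unitInterval) ⊕ Y.carrier
  let φ : Bool → C(Z, Y.carrier) := fun i => bif i then
    ⟨Sum.elim (fun p => f.map p.1) _root_.id, by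
      refine continuous_sumElim.2 ⟨by fun_prop, continuous_id⟩⟩ else ContinuousMap.const _ Y.pt
  let px : C(Z, X.carrier) := ⟨Sum.elim Prod.fst fun _ => X.pt,
    continuous_sumElim.2 ⟨continuous_fst, continuous_const⟩⟩
  let py : C(Z, Y.carrier) := ⟨Sum.elim (fun _ => Y.pt) _root_.id,
    continuous_sumElim.2 ⟨continuous_const, continuous_id⟩⟩
  let pt : C(Z, unitInterval) := ⟨Sum.elim Prod.snd fun _ => 0,
    continuous_sumElim.2 ⟨continuous_snd, continuous_const⟩⟩
  let pb : C(Z, Bool) := ⟨Sum.elim (fun _ => true) fun _ => false,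
    continuous_sumElim.2 ⟨continuous_const, continuous_const⟩⟩
  let D : Bool → Set Z := fun i => bif i then {z | pb z = false ∨ pt z = 1}
    else {z | pb z = true ∧ (pt z = 0 ∨ px z = X.pt)}
  have hD : ∀ i, IsClosed (D i) := by
    rintro (_ | _)
    · exact ((isClosed_discrete {true}).preimage pb.continuous).inter
        ((isClosed_singleton.preimage pt.continuous).union
          ((isClosed_pt X.pt).preimage px.continuous))
    · exact ((isClosed_discrete {false}).preimage pb.continuous).union
        (isClosed_singleton.preimage pt.continuous)
  have hset : {k | Quot.mk (CofibRel f) (a k) = Quot.mk (CofibRel f) (b k)} =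
      (({k | (px.comp a) k = (px.comp b) k} ∩ {k | (py.comp a) k = (py.comp b) k}) ∩
        ({k | (pt.comp a) k = (pt.comp b) k} ∩ {k | (pb.comp a) k = (pb.comp b) k})) ∪
      ⋃ i : Bool, ⋃ j : Bool, (a ⁻¹' D i ∩ b ⁻¹' D j) ∩
        {k | ((φ i).comp a) k = ((φ j).comp b) k} := by
    ext k
    simp only [Set.mem_ofPred_eq, Set.mem_union, Set.mem_inter_iff, Set.mem_iUnion,
      ContinuousMap.comp_apply, cofibMk_eq_iff, Set.mem_preimage]
    generalize a k = z
    generalize b k = w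
    have hsame : (((px z = px w ∧ py z = py w) ∧ (pt z = pt w ∧ pb z = pb w)) ↔ z = w) := by
      rcases z with ⟨x, t⟩ | y <;> rcases w with ⟨x', t'⟩ | y' <;>
        simp [px, py, pt, pb]
    rw [hsame]
    have hφ : ∀ i z, z ∈ D i → (cofibNormal f z = Sum.inr (φ i z)) := by
      rintro (_ | _) (⟨x, t⟩ | y) hz
      · simp [D, pb, pt, px] at hz
        simp [cofibNormal, φ, hz]
      · simp [D, pb] at hz
      · simp [D, pb, pt] at hz
        subst hz
        by_cases hx : x = X.pt
        · subst hx
          simp [cofibNormal, φ, f.map_pt]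
        · simp [cofibNormal, φ, hx]
      · simp [cofibNormal, φ]
    have hn : ∀ z, (∃ i, z ∈ D i) ∨ cofibNormal f z = z ∧ ∃ p, z = Sum.inl p := by
      rintro (⟨x, t⟩ | y)
      · by_cases h0 : t = 0 ∨ x = X.pt
        · exact Or.inl ⟨false, by simpa [D, pb, pt, px] using h0⟩
        · by_cases h1 : t = 1
          · exact Or.inl ⟨true, by simpa [D, pb, pt, px] using h1⟩
          · exact Or.inr ⟨by simp [cofibNormal, h0, h1], _, rfl⟩
      · exact Or.inl ⟨true, by simp [D, pb]⟩
    constructor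
    · intro h
      rcases hn z with ⟨i, hi⟩ | ⟨hz, p, hp⟩ <;> rcases hn w with ⟨j, hj⟩ | ⟨hw, q, hq⟩
      · rw [hφ i z hi, hφ j w hj] at h
        exact Or.inr ⟨i, j, ⟨hi, hj⟩, Sum.inr_injective h⟩
      · rw [hφ i z hi, hw, hq] at h
        cases h
      · rw [hz, hφ j w hj, hp] at h
        cases h
      · rw [hz, hw] at h
        exact Or.inl h
    · rintro (h | ⟨i, j, ⟨hi, hj⟩, h⟩)
      · rw [h]
      · rw [hφ i z hi, hφ j w hj, h]
  change IsClosed {k | Quot.mk (CofibRel f) (a k) = Quot.mk (CofibRel f) (b k)}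
  rw [hset]
  refine IsClosed.union (((isClosed_eq_of_wh K _ _).inter (isClosed_eq_of_wh K _ _)).inter
    ((isClosed_eq (pt.comp a).continuous (pt.comp b).continuous).inter
      (isClosed_eq (pb.comp a).continuous (pb.comp b).continuous))) ?_
  refine isClosed_iUnion_of_finite fun i => isClosed_iUnion_of_finite fun j => ?_
  exact (((hD i).preimage a.continuous).inter ((hD j).preimage b.continuous)).inter
    (isClosed_eq_of_wh K _ _)

/-- The reduced homotopy cofiber `(X ∧ [0,1]) ∪_X Y` of a based map `f : X → Y`. -/
def hcofib : BasedSpace.{u} where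
  carrier := CofibSpace f
  pt := Quot.mk _ (Sum.inr Y.pt)

end Cofiber

section WedgeProduct

variable {J : Type} (X : J → BasedSpace.{u})

/-- The generating relation of the wedge. -/
inductive WedgeRel : PUnit.{u + 1} ⊕ (Σ j, (X j).carrier) →
    PUnit.{u + 1} ⊕ (Σ j, (X j).carrier) → Prop
  | glue (j : J) : WedgeRel (Sum.inr ⟨j, (X j).pt⟩) (Sum.inl PUnit.unit)

/-- The underlying space of the wedge. -/
def WedgeSpace : Type u := Quot (WedgeRel X)

instance : TopologicalSpace (WedgeSpace X) := inferInstanceAs (TopologicalSpace (Quot _))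

theorem isQuotientMap_wedgeMk : IsQuotientMap (Quot.mk (WedgeRel X) : _ → WedgeSpace X) :=
  isQuotientMap_quot_mk

instance : CompactlyGeneratedSpace (WedgeSpace X) :=
  have : UCompactlyGeneratedSpace.{u} (Σ j, (X j).carrier) := inferInstance
  have : UCompactlyGeneratedSpace.{u} (PUnit.{u + 1} ⊕ (Σ j, (X j).carrier)) := inferInstance
  uCompactlyGeneratedSpace_of_coinduced (isQuotientMap_wedgeMk X).continuous
    (isQuotientMap_wedgeMk X).eq_coinduced

/-- The map out of the wedge given by a point and a family of maps which preserve it. -/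
def wedgeSpaceDesc {W : Type*} [TopologicalSpace W] (w : W) (g : ∀ j, C((X j).carrier, W))
    (h : ∀ j, g j (X j).pt = w) : C(WedgeSpace X, W) where
  toFun := Quot.lift (Sum.elim (fun _ => w) fun p => g p.1 p.2) (by rintro _ _ ⟨j⟩; exact h j)
  continuous_toFun := continuous_quot_lift _
    (continuous_sumElim.2 ⟨continuous_const, continuous_sigma fun j => (g j).continuous⟩)

open Classical in
/-- The identity map if `j = i` and the constant map otherwise. -/
noncomputable def deltaMap (j i : J) : BasedMap (X j) (X i) :=
  if h : j = i then h ▸ BasedMap.id (X j) else ⟨ContinuousMap.const _ (X i).pt, rfl⟩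

theorem deltaMap_self (j : J) : deltaMap X j j = BasedMap.id (X j) := by simp [deltaMap]

theorem deltaMap_ne {j i : J} (h : j ≠ i) (x : (X j).carrier) :
    (deltaMap X j i).map x = (X i).pt := by simp [deltaMap, h]

/-- The collapse of the wedge onto a summand. -/
noncomputable def wedgeSpaceCollapse (i : J) : C(WedgeSpace X, (X i).carrier) :=
  wedgeSpaceDesc X (X i).pt (fun j => (deltaMap X j i).map) fun j => (deltaMap X j i).map_pt

theorem wedgeSpace_ext (p q : WedgeSpace X)
    (h : ∀ i, wedgeSpaceCollapse X i p = wedgeSpaceCollapse X i q) : p = q := by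
  have hself : ∀ i (x : (X i).carrier),
      wedgeSpaceCollapse X i (Quot.mk _ (Sum.inr ⟨i, x⟩)) = x := fun i x => by
    change (deltaMap X i i).map x = x
    rw [deltaMap_self]; rfl
  have hne : ∀ i j (x : (X j).carrier), j ≠ i →
      wedgeSpaceCollapse X i (Quot.mk _ (Sum.inr ⟨j, x⟩)) = (X i).pt :=
    fun i j x hji => deltaMap_ne X hji x
  have hpt : ∀ i, wedgeSpaceCollapse X i (Quot.mk _ (Sum.inl PUnit.unit)) = (X i).pt :=
    fun i => rfl
  have hglue : ∀ i, (Quot.mk (WedgeRel X) (Sum.inr ⟨i, (X i).pt⟩)) =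
      Quot.mk (WedgeRel X) (Sum.inl PUnit.unit) := fun i => Quot.sound (WedgeRel.glue i)
  obtain ⟨⟨⟩ | ⟨i, x⟩⟩ := p <;> obtain ⟨⟨⟩ | ⟨j, y⟩⟩ := q
  · rfl
  · have := h j
    rw [hpt, hself] at this
    rw [← this, hglue]
  · have := h i
    rw [hpt, hself] at this
    rw [this, hglue]
  · by_cases hij : i = j
    · subst hij
      have := h i
      rw [hself, hself] at this
      rw [this]
    · have h1 := h i
      have h2 := h j
      rw [hself, hne i j y (Ne.symm hij)] at h1
      rw [hself, hne j i x hij] at h2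
      rw [h1, ← h2, hglue, hglue]

instance : WeaklyHausdorffSpace (WedgeSpace X) :=
  wh_of_separating (fun j => (X j).carrier) (wedgeSpaceCollapse X) (wedgeSpace_ext X)

/-- The wedge of based spaces. -/
def wedgeObj : BasedSpace.{u} where
  carrier := WedgeSpace X
  pt := Quot.mk _ (Sum.inl PUnit.unit)

instance : WeaklyHausdorffSpace (Kify (∀ j, (X j).carrier)) := by
  refine wh_of_separating (fun j => (X j).carrier)
    (fun j => ⟨fun p => p.out j, (continuous_apply j).comp Kify.continuous_out⟩) ?_
  rintro ⟨x⟩ ⟨y⟩ h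
  exact congrArg Kify.mk (funext h)

/-- The product of based spaces (in compactly generated spaces). -/
def prodObj : BasedSpace.{u} where
  carrier := Kify (∀ j, (X j).carrier)
  pt := ⟨fun j => (X j).pt⟩

end WedgeProduct

/-! ### Prespectra -/

/-- A prespectrum: based spaces `E k` with structure maps `E k ∧ S¹ → E (k + 1)`, the latter
given as maps `E k × [0,1] → E (k + 1)` which collapse `E k × {0, 1} ∪ {pt} × [0,1]`. -/
structure Prespectrum : Type (u + 1) where
  level : ℕ → BasedSpace.{u}
  str : ∀ k, C((level k).carrier × unitInterval, (level (k + 1)).carrier)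
  str_zero : ∀ k x, str k (x, 0) = (level (k + 1)).pt
  str_one : ∀ k x, str k (x, 1) = (level (k + 1)).pt
  str_pt : ∀ k t, str k ((level k).pt, t) = (level (k + 1)).pt

namespace Prespectrum

/-- A map of prespectra: levelwise based maps commuting with the structure maps. -/
@[ext]
structure Hom (E E' : Prespectrum.{u}) : Type u where
  app : ∀ k, BasedMap (E.level k) (E'.level k)
  app_str : ∀ k x t, (app (k + 1)).map (E.str k (x, t)) = E'.str k ((app k).map x, t)

instance : Category.{u} Prespectrum.{u} where
  Hom := Hom
  id E := ⟨fun k => BasedMap.id (E.level k), fun _ _ _ => rfl⟩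
  comp f g := ⟨fun k => (f.app k).comp (g.app k), fun k x t =>
    (congrArg (g.app (k + 1)).map (f.app_str k x t)).trans (g.app_str k _ t)⟩

theorem hom_ext {E E' : Prespectrum.{u}} {f g : E ⟶ E'}
    (h : ∀ k x, (f.app k).map x = (g.app k).map x) : f = g :=
  Hom.ext (funext fun k => BasedMap.ext (ContinuousMap.ext (h k)))

@[simp]
theorem id_app_map_apply (E : Prespectrum.{u}) (k : ℕ) (x : (E.level k).carrier) :
    (Hom.app (𝟙 E) k).map x = x := rfl

@[simp]
theorem comp_app_map_apply {E E' E'' : Prespectrum.{u}} (f : E ⟶ E') (g : E' ⟶ E'') (k : ℕ)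
    (x : (E.level k).carrier) :
    ((f ≫ g).app k).map x = (g.app k).map ((f.app k).map x) := rfl

/-! #### Stable homotopy groups and stable equivalences -/

section StableHomotopy

open scoped Topology.Homotopy

/-- The suspension of a based map `I^m → E k` that is trivial on the boundary, composed with the
structure map. -/
def suspendLoop (E : Prespectrum.{u}) (k m : ℕ)
    (γ : GenLoop (Fin m) (E.level k).carrier (E.level k).pt) :
    GenLoop (Fin (m + 1)) (E.level (k + 1)).carrier (E.level (k + 1)).pt :=
  ⟨⟨fun t => E.str k (γ (Fin.init t), t (Fin.last m)), by
      refine (E.str k).continuous.comp (Continuous.prodMk (γ.1.continuous.comp ?_)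
        (continuous_apply _))
      exact continuous_pi fun i => continuous_apply _⟩, by
    rintro t ⟨i, hi⟩
    change E.str k (γ (Fin.init t), t (Fin.last m)) = _
    induction i using Fin.lastCases with
    | last =>
      rcases hi with hi | hi
      · rw [hi, E.str_zero]
      · rw [hi, E.str_one]
    | cast i =>
      rw [GenLoop.boundary γ (Fin.init t) ⟨i, hi⟩, E.str_pt]⟩

theorem suspendLoop_homotopic (E : Prespectrum.{u}) (k m : ℕ)
    {γ γ' : GenLoop (Fin m) (E.level k).carrier (E.level k).pt} (h : GenLoop.Homotopic γ γ') :
    GenLoop.Homotopic (E.suspendLoop k m γ) (E.suspendLoop k m γ') := by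
  obtain ⟨H⟩ := h
  refine ⟨⟨⟨⟨fun p => E.str k (H (p.1, Fin.init p.2), p.2 (Fin.last m)), ?_⟩, ?_, ?_⟩, ?_⟩⟩
  · refine (E.str k).continuous.comp (Continuous.prodMk (H.continuous.comp ?_) (by fun_prop))
    exact continuous_fst.prodMk (continuous_pi fun i => by
      change Continuous fun p : unitInterval × (Fin (m + 1) → unitInterval) => p.2 i.castSucc
      fun_prop)
  · intro t
    change E.str k (H (0, Fin.init t), t (Fin.last m)) = _
    rw [H.apply_zero]
    rfl
  · intro t
    change E.str k (H (1, Fin.init t), t (Fin.last m)) = _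
    rw [H.apply_one]
    rfl
  · rintro s t ⟨i, hi⟩
    change E.str k (H (s, Fin.init t), t (Fin.last m)) = E.str k (γ (Fin.init t), t (Fin.last m))
    induction i using Fin.lastCases with
    | last =>
      rcases hi with hi | hi
      · rw [hi, E.str_zero, E.str_zero]
      · rw [hi, E.str_one, E.str_one]
    | cast i =>
      have h1 : H (s, Fin.init t) = γ (Fin.init t) := H.eq_fst s ⟨i, hi⟩
      rw [h1]

/-- The stabilization map `π_m (E k) → π_{m+1} (E (k + 1))`. -/
def stabilize (E : Prespectrum.{u}) (k m : ℕ) :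
    HomotopyGroup.Pi m (E.level k).carrier (E.level k).pt →
      HomotopyGroup.Pi (m + 1) (E.level (k + 1)).carrier (E.level (k + 1)).pt :=
  Quotient.map (E.suspendLoop k m) fun _ _ h => E.suspendLoop_homotopic k m h

/-- The relation identifying an element of a sequential system with its image in the next term. -/
inductive StableRel (E : Prespectrum.{u}) (a b : ℕ) :
    (Σ j, HomotopyGroup.Pi (a + j) (E.level (b + j)).carrier (E.level (b + j)).pt) →
    (Σ j, HomotopyGroup.Pi (a + j) (E.level (b + j)).carrier (E.level (b + j)).pt) → Prop
  | step (j : ℕ) (x : HomotopyGroup.Pi (a + j) (E.level (b + j)).carrier (E.level (b + j)).pt) :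
    StableRel E a b ⟨j, x⟩ ⟨j + 1, E.stabilize (b + j) (a + j) x⟩

/-- (The underlying set of) the stable homotopy group `π_q E = colim_k π_{q + k} (E k)`, `q ∈ ℤ`,
written as the colimit over `j` of `π_{a + j} (E (b + j))` where `a` and `b` are the positive
and the negative part of `q`. -/
def stablePi (q : ℤ) (E : Prespectrum.{u}) : Type u :=
  Quot (StableRel E q.toNat (-q).toNat)

/-- The map induced on `m`-dimensional loops by a based map. -/
def mapLoop {X Y : BasedSpace.{u}} (f : BasedMap X Y) (m : ℕ)
    (γ : GenLoop (Fin m) X.carrier X.pt) : GenLoop (Fin m) Y.carrier Y.pt :=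
  ⟨f.map.comp γ.1, fun t ht => (congrArg f.map (γ.2 t ht)).trans f.map_pt⟩

/-- The map induced on homotopy groups by a based map. -/
def mapPi {X Y : BasedSpace.{u}} (f : BasedMap X Y) (m : ℕ) :
    HomotopyGroup.Pi m X.carrier X.pt → HomotopyGroup.Pi m Y.carrier Y.pt :=
  Quotient.map (mapLoop f m) fun _ _ h => ContinuousMap.HomotopicRel.comp_continuousMap h f.map

theorem mapPi_stabilize {E E' : Prespectrum.{u}} (f : E ⟶ E') (k m : ℕ)
    (x : HomotopyGroup.Pi m (E.level k).carrier (E.level k).pt) :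
    mapPi (f.app (k + 1)) (m + 1) (E.stabilize k m x) = E'.stabilize k m (mapPi (f.app k) m x) := by
  induction x using Quotient.inductionOn with
  | h γ =>
    refine congrArg (Quotient.mk _) (GenLoop.ext _ _ fun t => ?_)
    exact f.app_str k (γ (Fin.init t)) (t (Fin.last m))

/-- The map induced on stable homotopy groups. -/
def stablePiMap (q : ℤ) {E E' : Prespectrum.{u}} (f : E ⟶ E') : stablePi q E → stablePi q E' :=
  Quot.map (fun x => ⟨x.1, mapPi (f.app _) _ x.2⟩) (by
    rintro _ _ ⟨j, x⟩
    have := StableRel.step j (mapPi (f.app ((-q).toNat + j)) (q.toNat + j) x)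
    rw [← mapPi_stabilize] at this
    exact this)

/-- A map of prespectra is a stable equivalence if it induces isomorphisms on all stable
homotopy groups. -/
def IsStableEquiv {E E' : Prespectrum.{u}} (f : E ⟶ E') : Prop :=
  ∀ q : ℤ, Function.Bijective (stablePiMap q f)

end StableHomotopy

/-! #### Homotopy fibers and cofibers -/

section Fiber

variable {E E' : Prespectrum.{u}} (f : E ⟶ E')

/-- The map `[0,1] × A → W` in the form of a map from `A` to paths in `W`. -/
theorem continuous_path {A W : Type*} [TopologicalSpace A] [TopologicalSpace W]
    (g : A → C(unitInterval, W)) (hg : Continuous fun p : A × unitInterval => g p.1 p.2) :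
    Continuous g :=
  ContinuousMap.continuous_of_continuous_uncurry _ hg

/-- The structure maps of the homotopy fiber on points. -/
def fibStr (k : ℕ) (p : FibPre (f.app k)) (t : unitInterval) : FibPre (f.app (k + 1)) :=
  ⟨(E.str k (p.1.1, t), ⟨fun s => E'.str k (p.1.2 s, t), by fun_prop⟩), by
    change E'.str k (p.1.2 0, t) = _
    rw [p.2.1, E'.str_pt], by
    change E'.str k (p.1.2 1, t) = (f.app (k + 1)).map (E.str k (p.1.1, t))
    rw [p.2.2, f.app_str]⟩

theorem continuous_fibStr (k : ℕ) :
    Continuous fun p : Kify (FibPre (f.app k)) × unitInterval => fibStr f k p.1.out p.2 := by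
  have h : Continuous fun p : Kify (FibPre (f.app k)) × unitInterval => p.1.out.1 :=
    (continuous_fibPre_val _).comp (Kify.continuous_out.comp continuous_fst)
  refine Continuous.subtype_mk (Continuous.prodMk ?_ (continuous_path _ ?_)) _
  · exact (E.str k).continuous.comp ((continuous_fst.comp h).prodMk continuous_snd)
  · refine (E'.str k).continuous.comp (Continuous.prodMk ?_ (continuous_snd.comp continuous_fst))
    exact continuous_eval.comp
      ((continuous_snd.comp (h.comp continuous_fst)).prodMk continuous_snd)

/-- The homotopy fiber of a map of prespectra, formed levelwise. -/
def fib : Prespectrum.{u} where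
  level k := hfib (f.app k)
  str k := ⟨fun p => ⟨fibStr f k p.1.out p.2⟩,
    Kify.continuous_mk_of_cg (continuous_fibStr f k)⟩
  str_zero k _ := congrArg Kify.mk (Subtype.ext (Prod.ext (E.str_zero k _)
    (ContinuousMap.ext fun _ => E'.str_zero k _)))
  str_one k _ := congrArg Kify.mk (Subtype.ext (Prod.ext (E.str_one k _)
    (ContinuousMap.ext fun _ => E'.str_one k _)))
  str_pt k _ := congrArg Kify.mk (Subtype.ext (Prod.ext (E.str_pt k _)
    (ContinuousMap.ext fun _ => E'.str_pt k _)))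

/-- The projection of the homotopy fiber of `E → E'` to `E`. -/
def fibFst : fib f ⟶ E where
  app k := ⟨⟨fun p => p.out.1.1, continuous_fst.comp
    ((continuous_fibPre_val _).comp Kify.continuous_out)⟩, rfl⟩
  app_str _ _ _ := rfl

variable {f} {D D' : Prespectrum.{u}} {g : D ⟶ D'}

/-- The effect of a commutative square on points of the homotopy fibers. -/
def fibMapPre (a : E ⟶ D) (b : E' ⟶ D') (w : f ≫ b = a ≫ g) (k : ℕ)
    (p : FibPre (f.app k)) : FibPre (g.app k) :=
  ⟨((a.app k).map p.1.1, (b.app k).map.comp p.1.2), by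
    change (b.app k).map (p.1.2 0) = _
    rw [p.2.1, (b.app k).map_pt], by
    change (b.app k).map (p.1.2 1) = (g.app k).map ((a.app k).map p.1.1)
    rw [p.2.2, ← comp_app_map_apply, w, comp_app_map_apply]⟩

theorem continuous_fibMapPre (a : E ⟶ D) (b : E' ⟶ D') (w : f ≫ b = a ≫ g) (k : ℕ) :
    Continuous (fibMapPre a b w k) := by
  refine Continuous.subtype_mk (Continuous.prodMk ?_ ?_) _
  · exact (a.app k).map.continuous.comp (continuous_fst.comp (continuous_fibPre_val _))
  · exact (ContinuousMap.continuous_postcomp _).comp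
      (continuous_snd.comp (continuous_fibPre_val _))

/-- The map of homotopy fibers induced by a commutative square. -/
def fibMap (a : E ⟶ D) (b : E' ⟶ D') (w : f ≫ b = a ≫ g) : fib f ⟶ fib g where
  app k := ⟨⟨fun p => ⟨fibMapPre a b w k p.out⟩, Kify.continuous_mk_of_cg
      ((continuous_fibMapPre a b w k).comp Kify.continuous_out)⟩,
    congrArg Kify.mk (Subtype.ext (Prod.ext (a.app k).map_pt
      (ContinuousMap.ext fun _ => (b.app k).map_pt)))⟩
  app_str k p t := congrArg Kify.mk (Subtype.ext (Prod.ext (a.app_str k _ t)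
    (ContinuousMap.ext fun _ => b.app_str k _ t)))

/-- The homotopy fiber of a natural transformation of functors to prespectra. -/
def fibFunctor {K : Type*} [Category K] {F G : K ⥤ Prespectrum.{u}} (η : F ⟶ G) :
    K ⥤ Prespectrum.{u} where
  obj x := fib (η.app x)
  map h := fibMap (F.map h) (G.map h) (η.naturality h).symm
  map_id x := hom_ext fun k p => congrArg Kify.mk (Subtype.ext (by
    change ((F.map (𝟙 x)).app k |>.map p.out.1.1, ((G.map (𝟙 x)).app k).map.comp p.out.1.2) = _
    rw [F.map_id, G.map_id]; rfl))
  map_comp {x y z} h h' := hom_ext fun k p => congrArg Kify.mk (Subtype.ext (by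
    change ((F.map (h ≫ h')).app k |>.map p.out.1.1,
      ((G.map (h ≫ h')).app k).map.comp p.out.1.2) = _
    rw [F.map_comp, G.map_comp]; rfl))

end Fiber

section Cofiber

variable {E E' : Prespectrum.{u}} (f : E ⟶ E')

/-- The structure maps of the homotopy cofiber on points. -/
def cofibStr (k : ℕ) (p : CofibSpace (f.app k)) (t : unitInterval) : CofibSpace (f.app (k + 1)) :=
  Quot.map (Sum.map (fun q => (E.str k (q.1, t), q.2)) fun y => E'.str k (y, t)) (by
    rintro _ _ (x | s | x)
    · have := CofibRel.zero (f := f.app (k + 1)) (E.str k (x, t))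
      rwa [← E'.str_pt k t] at this
    · have := CofibRel.pt (f := f.app (k + 1)) s
      rw [← E'.str_pt k t, ← E.str_pt k t] at this
      exact this
    · have := CofibRel.one (f := f.app (k + 1)) (E.str k (x, t))
      rw [f.app_str] at this
      exact this) p

theorem continuous_cofibStr (k : ℕ) :
    Continuous fun p : CofibSpace (f.app k) × unitInterval => cofibStr f k p.1 p.2 := by
  refine (isQuotientMap_cofibMk (f.app k)).continuous_lift_prod_left ?_
  have h : Continuous fun p : (((E.level k).carrier × unitInterval) × unitInterval) ⊕
      ((E'.level k).carrier × unitInterval) =>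
      (Sum.map (fun q => (E.str k (q.1.1, q.2), q.1.2)) (fun y => E'.str k y) p :
        ((E.level (k + 1)).carrier × unitInterval) ⊕ (E'.level (k + 1)).carrier) :=
    Continuous.sumMap (by fun_prop) (by fun_prop)
  have h2 := (isQuotientMap_cofibMk (f.app (k + 1))).continuous.comp
    (h.comp (Homeomorph.sumProdDistrib (X := (E.level k).carrier × unitInterval)
      (Y := (E'.level k).carrier) (Z := unitInterval)).continuous)
  convert! h2 using 1
  ext ⟨p | y, t⟩ <;> rfl

/-- The (reduced) homotopy cofiber of a map of prespectra, formed levelwise. -/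
def cofib : Prespectrum.{u} where
  level k := hcofib (f.app k)
  str k := ⟨fun p => cofibStr f k p.1 p.2, continuous_cofibStr f k⟩
  str_zero k p := by
    obtain ⟨⟨x, s⟩ | y⟩ := p
    · change Quot.mk _ (Sum.inl (E.str k (x, 0), s)) = Quot.mk _ (Sum.inr _)
      rw [E.str_zero]
      exact Quot.sound (CofibRel.pt s)
    · exact congrArg (fun y => Quot.mk _ (Sum.inr y)) (E'.str_zero k y)
  str_one k p := by
    obtain ⟨⟨x, s⟩ | y⟩ := p
    · change Quot.mk _ (Sum.inl (E.str k (x, 1), s)) = Quot.mk _ (Sum.inr _)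
      rw [E.str_one]
      exact Quot.sound (CofibRel.pt s)
    · exact congrArg (fun y => Quot.mk _ (Sum.inr y)) (E'.str_one k y)
  str_pt k t := congrArg (fun y => Quot.mk _ (Sum.inr y)) (E'.str_pt k t)

/-- The inclusion of `E'` into the homotopy cofiber of `E → E'`. -/
def cofibInr : E' ⟶ cofib f where
  app k := ⟨⟨fun y => Quot.mk _ (Sum.inr y), continuous_quot_mk.comp continuous_inr⟩, rfl⟩
  app_str _ _ _ := rfl

variable {f} {D D' : Prespectrum.{u}} {g : D ⟶ D'}

/-- The map of homotopy cofibers induced by a commutative square. -/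
def cofibMap (a : E ⟶ D) (b : E' ⟶ D') (w : f ≫ b = a ≫ g) : cofib f ⟶ cofib g where
  app k := ⟨⟨Quot.map (Sum.map (Prod.map (a.app k).map _root_.id) (b.app k).map) (by
      rintro _ _ (x | t | x)
      · have := CofibRel.zero (f := g.app k) ((a.app k).map x)
        rwa [← (b.app k).map_pt] at this
      · have := CofibRel.pt (f := g.app k) t
        rwa [← (b.app k).map_pt, ← (a.app k).map_pt] at this
      · have := CofibRel.one (f := g.app k) ((a.app k).map x)
        rw [← comp_app_map_apply, ← w] at this
        exact this),
    continuous_quot_lift _ (continuous_quot_mk.comp (Continuous.sumMap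
      ((a.app k).map.continuous.prodMap continuous_id) (b.app k).map.continuous))⟩,
    congrArg (fun y => Quot.mk _ (Sum.inr y)) (b.app k).map_pt⟩
  app_str k p t := by
    obtain ⟨⟨x, s⟩ | y⟩ := p
    · exact congrArg (fun y => Quot.mk _ (Sum.inl (y, s))) (a.app_str k x t)
    · exact congrArg (fun y => Quot.mk _ (Sum.inr y)) (b.app_str k y t)

/-- The homotopy cofiber of a natural transformation of functors to prespectra. -/
def cofibFunctor {K : Type*} [Category K] {F G : K ⥤ Prespectrum.{u}} (η : F ⟶ G) :
    K ⥤ Prespectrum.{u} where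
  obj x := cofib (η.app x)
  map h := cofibMap (F.map h) (G.map h) (η.naturality h).symm
  map_id x := hom_ext fun k p => by
    obtain ⟨⟨y, s⟩ | y⟩ := p
    · change Quot.mk _ (Sum.inl (((F.map (𝟙 x)).app k).map y, s)) = _
      rw [F.map_id]; rfl
    · change Quot.mk _ (Sum.inr (((G.map (𝟙 x)).app k).map y)) = _
      rw [G.map_id]; rfl
  map_comp h h' := hom_ext fun k p => by
    obtain ⟨⟨y, s⟩ | y⟩ := p
    · change Quot.mk _ (Sum.inl (((F.map (h ≫ h')).app k).map y, s)) = _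
      rw [F.map_comp]; rfl
    · change Quot.mk _ (Sum.inr (((G.map (h ≫ h')).app k).map y)) = _
      rw [G.map_comp]; rfl

end Cofiber

/-! #### Products and wedges -/

section WedgeProduct

variable {J : Type} (E : J → Prespectrum.{u})

/-- The product of prespectra, formed levelwise. -/
def product : Prespectrum.{u} where
  level k := prodObj fun j => (E j).level k
  str k := ⟨fun p => ⟨fun j => (E j).str k (p.1.out j, p.2)⟩, Kify.continuous_mk_of_cg
    (continuous_pi fun j => ((E j).str k).continuous.comp (Continuous.prodMk
      ((continuous_apply j).comp (Kify.continuous_out.comp continuous_fst)) continuous_snd))⟩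
  str_zero k _ := congrArg Kify.mk (funext fun j => (E j).str_zero k _)
  str_one k _ := congrArg Kify.mk (funext fun j => (E j).str_one k _)
  str_pt k _ := congrArg Kify.mk (funext fun j => (E j).str_pt k _)

variable {E}

/-- The map into a product with given components. -/
def productLift {D : Prespectrum.{u}} (f : ∀ j, D ⟶ E j) : D ⟶ product E where
  app k := ⟨⟨fun x => ⟨fun j => ((f j).app k).map x⟩, Kify.continuous_mk_of_cg
      (continuous_pi fun j => ((f j).app k).map.continuous)⟩,
    congrArg Kify.mk (funext fun j => ((f j).app k).map_pt)⟩
  app_str k x t := congrArg Kify.mk (funext fun j => (f j).app_str k x t)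

/-- The projections of a product. -/
def productProj (j : J) : product E ⟶ E j where
  app k := ⟨⟨fun p => p.out j, (continuous_apply j).comp Kify.continuous_out⟩, rfl⟩
  app_str _ _ _ := rfl

/-- The product of a family of maps. -/
def productMap {E' : J → Prespectrum.{u}} (f : ∀ j, E j ⟶ E' j) : product E ⟶ product E' :=
  productLift fun j => productProj j ≫ f j

variable (E)

/-- The structure maps of a wedge on points. -/
def wedgeStr (k : ℕ) (p : WedgeSpace fun j => (E j).level k) (t : unitInterval) :
    WedgeSpace fun j => (E j).level (k + 1) :=
  Quot.map (Sum.map _root_.id fun q => ⟨q.1, (E q.1).str k (q.2, t)⟩) (by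
    rintro _ _ ⟨j⟩
    have := WedgeRel.glue (X := fun j => (E j).level (k + 1)) j
    rw [← (E j).str_pt k t] at this
    exact this) p

theorem continuous_wedgeStr (k : ℕ) :
    Continuous fun p : (WedgeSpace fun j => (E j).level k) × unitInterval =>
      wedgeStr E k p.1 p.2 := by
  refine (isQuotientMap_wedgeMk _).continuous_lift_prod_left ?_
  have h : Continuous fun p : (PUnit.{u + 1} × unitInterval) ⊕
      (Σ j, ((E j).level k).carrier × unitInterval) =>
      (Sum.map Prod.fst (fun q => ⟨q.1, (E q.1).str k q.2⟩) p :
        PUnit.{u + 1} ⊕ (Σ j, ((E j).level (k + 1)).carrier)) :=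
    Continuous.sumMap continuous_fst (continuous_sigma fun j =>
      continuous_sigmaMk.comp ((E j).str k).continuous)
  have h1 : Continuous fun p : (PUnit.{u + 1} ⊕ (Σ j, ((E j).level k).carrier)) × unitInterval =>
      (Sum.map _root_.id (Homeomorph.sigmaProdDistrib (X := fun j => ((E j).level k).carrier)
        (Y := unitInterval)) (Homeomorph.sumProdDistrib p) : (PUnit.{u + 1} × unitInterval) ⊕
          (Σ j, ((E j).level k).carrier × unitInterval)) :=
    (Continuous.sumMap continuous_id (Homeomorph.continuous _)).comp (Homeomorph.continuous _)
  have h2 := (isQuotientMap_wedgeMk fun j => (E j).level (k + 1)).continuous.comp (h.comp h1)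
  convert! h2 using 1
  ext ⟨p | y, t⟩ <;> rfl

/-- The wedge of prespectra, formed levelwise. -/
def wedge : Prespectrum.{u} where
  level k := wedgeObj fun j => (E j).level k
  str k := ⟨fun p => wedgeStr E k p.1 p.2, continuous_wedgeStr E k⟩
  str_zero k p := by
    obtain ⟨⟨⟩ | ⟨j, x⟩⟩ := p
    · rfl
    · change Quot.mk _ (Sum.inr ⟨j, (E j).str k (x, 0)⟩ : PUnit.{u + 1} ⊕ (Σ j, ((E j).level (k + 1)).carrier)) =
        Quot.mk _ (Sum.inl _)
      rw [(E j).str_zero]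
      exact Quot.sound (WedgeRel.glue j)
  str_one k p := by
    obtain ⟨⟨⟩ | ⟨j, x⟩⟩ := p
    · rfl
    · change Quot.mk _ (Sum.inr ⟨j, (E j).str k (x, 1)⟩ : PUnit.{u + 1} ⊕ (Σ j, ((E j).level (k + 1)).carrier)) =
        Quot.mk _ (Sum.inl _)
      rw [(E j).str_one]
      exact Quot.sound (WedgeRel.glue j)
  str_pt _ _ := rfl

variable {E}

/-- The map out of a wedge with given components. -/
def wedgeDesc {D : Prespectrum.{u}} (f : ∀ j, E j ⟶ D) : wedge E ⟶ D where
  app k := ⟨wedgeSpaceDesc _ (D.level k).pt (fun j => ((f j).app k).map)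
    fun j => ((f j).app k).map_pt, rfl⟩
  app_str k p t := by
    obtain ⟨⟨⟩ | ⟨j, x⟩⟩ := p
    · exact (D.str_pt k t).symm
    · exact (f j).app_str k x t

variable (E)

open Classical in
/-- The map `E j → E i` which is the identity if `j = i` and the constant map otherwise. -/
noncomputable def delta (j i : J) : E j ⟶ E i :=
  if h : j = i then eqToHom (congrArg E h) else
    { app := fun k => ⟨ContinuousMap.const _ ((E i).level k).pt, rfl⟩
      app_str := fun k _ t => ((E i).str_pt k t).symm }

/-- The canonical map from the wedge to the product. -/
noncomputable def wedgeToProd : wedge E ⟶ product E :=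
  wedgeDesc fun j => productLift fun i => delta E j i

end WedgeProduct

end Prespectrum

/-! ### Cubes, total homotopy fibers and total homotopy cofibers -/

section Cubes

/-- The inclusion of the face of an `(n + 1)`-cube whose vertices are the subsets not
containing `0`. -/
def faceLow (n : ℕ) : Finset (Fin n) ⥤ Finset (Fin (n + 1)) :=
  Monotone.functor (f := fun S => S.map (Fin.succEmb n)) fun _ _ h => Finset.map_subset_map.2 h

/-- The inclusion of the face of an `(n + 1)`-cube whose vertices are the subsets containing `0`. -/
def faceUp (n : ℕ) : Finset (Fin n) ⥤ Finset (Fin (n + 1)) :=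
  Monotone.functor (f := fun S => insert 0 (S.map (Fin.succEmb n)))
    fun _ _ h => Finset.insert_subset_insert _ (Finset.map_subset_map.2 h)

/-- The inclusions `S ⊆ S ∪ {0}`. -/
def lowToUp (n : ℕ) : faceLow n ⟶ faceUp n where
  app _ := homOfLE (Finset.subset_insert _ _)
  naturality _ _ _ := Subsingleton.elim _ _

theorem univ_le_faceUp (n : ℕ) :
    (Finset.univ : Finset (Fin (n + 1))) ≤ (faceUp n).obj Finset.univ := by
  intro i _
  change i ∈ insert 0 (Finset.univ.map (Fin.succEmb n))
  induction i using Fin.cases <;> simp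

open Prespectrum

/-- The total homotopy fiber of an `n`-cube of prespectra whose maps `Q T → Q S` are indexed by
the inclusions `S ⊆ T`, so that its initial vertex is at the full set. An `(n + 1)`-cube is a map
of `n`-cubes, and its total homotopy fiber is the homotopy fiber of the map of total homotopy
fibers. -/
def tfib : ∀ n : ℕ, ((Finset (Fin n))ᵒᵖ ⥤ Prespectrum.{u}) ⥤ Prespectrum.{u}
  | 0 => (evaluation _ _).obj (op Finset.univ)
  | n + 1 => fibFunctor
      (Functor.whiskerRight ((Functor.whiskeringLeft _ _ _).map (NatTrans.op (lowToUp n))) (tfib n))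

/-- The total homotopy cofiber of an `n`-cube of prespectra whose maps `P S → P T` are indexed by
the inclusions `S ⊆ T`, so that its final vertex is at the full set. -/
def tcofib : ∀ n : ℕ, (Finset (Fin n) ⥤ Prespectrum.{u}) ⥤ Prespectrum.{u}
  | 0 => (evaluation _ _).obj Finset.univ
  | n + 1 => cofibFunctor
      (Functor.whiskerRight ((Functor.whiskeringLeft _ _ _).map (lowToUp n)) (tcofib n))

/-- The map from the total homotopy fiber to the initial vertex. -/
def tfibι : ∀ (n : ℕ) (Q : (Finset (Fin n))ᵒᵖ ⥤ Prespectrum.{u}),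
    (tfib n).obj Q ⟶ Q.obj (op Finset.univ)
  | 0, _ => 𝟙 _
  | n + 1, Q => fibFst _ ≫ tfibι n ((faceUp n).op ⋙ Q) ≫ Q.map (homOfLE (univ_le_faceUp n)).op

/-- The map from the final vertex to the total homotopy cofiber. -/
def tcofibπ : ∀ (n : ℕ) (P : Finset (Fin n) ⥤ Prespectrum.{u}),
    P.obj Finset.univ ⟶ (tcofib n).obj P
  | 0, _ => 𝟙 _
  | n + 1, P => P.map (homOfLE (univ_le_faceUp n)) ≫ tcofibπ n (faceUp n ⋙ P) ≫ cofibInr _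

end Cubes

/-! ### Cross effects -/

section CrossEffects

universe w

variable {C : Type w} [Category.{v} C] [HasZeroMorphisms C] [HasFiniteCoproducts C] {n : ℕ}
  (X : Fin n → C)

/-- The union `⋃_{i ∈ S} X_i`. In retractive spaces over `B`, the coproduct is the pushout
along `B`. -/
noncomputable abbrev union (S : Finset (Fin n)) : C := ∐ fun i : {i // i ∈ S} => X i.1

/-- The cube `S ↦ ⋃_{i ∈ S} X_i` whose maps are the inclusions. -/
noncomputable def inclusionCube : Finset (Fin n) ⥤ C where
  obj S := union X S
  map {S T} h := Sigma.desc fun i : {i // i ∈ S} =>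
    Sigma.ι (fun i : {i // i ∈ T} => X i.1) ⟨i.1, leOfHom h i.2⟩
  map_id S := Sigma.hom_ext _ _ fun i => by simp
  map_comp f g := Sigma.hom_ext _ _ fun i => by simp

/-- The cube `S ↦ ⋃_{i ∈ S} X_i` whose maps `⋃_{i ∈ T} X_i → ⋃_{i ∈ S} X_i`, for `S ⊆ T`, are the
collapse maps: they send `X_i` identically to `X_i` if `i ∈ S`, and to the base otherwise. -/
noncomputable def collapseCube : (Finset (Fin n))ᵒᵖ ⥤ C where
  obj S := union X S.unop
  map {T S} _ := Sigma.desc fun i : {i // i ∈ T.unop} =>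
    if h : i.1 ∈ S.unop then Sigma.ι (fun i : {i // i ∈ S.unop} => X i.1) ⟨i.1, h⟩ else 0
  map_id S := Sigma.hom_ext _ _ fun i => by simp
  map_comp {T S R} f g := Sigma.hom_ext _ _ fun i => by
    have hRS : R.unop ⊆ S.unop := leOfHom g.unop
    by_cases hS : i.1 ∈ S.unop
    · simp [hS]
    · have hR : i.1 ∉ R.unop := fun h => hS (hRS h)
      simp [hS, hR]

/-- The subfamily `(X_s : s ∈ S)`, listed in increasing order of the indices. -/
noncomputable def sub (S : Finset (Fin n)) : Fin S.card → C := fun k => X (S.orderEmbOfFin rfl k)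

/-- The union of the subfamily `(X_s : s ∈ S)` is `⋃_{s ∈ S} X_s`. -/
noncomputable def unionSubIso (S : Finset (Fin n)) : union (sub X S) Finset.univ ≅ union X S :=
  Sigma.whiskerEquiv (f := fun k : {k // k ∈ (Finset.univ : Finset (Fin S.card))} => sub X S k.1)
    (g := fun i : {i // i ∈ S} => X i.1)
    ((Equiv.subtypeUnivEquiv Finset.mem_univ).trans (S.orderIsoOfFin rfl).toEquiv)
    fun _ => Iso.refl _

section Contravariant

variable (F : Cᵒᵖ ⥤ Prespectrum.{u})

/-- The `n`-th cross effect of a contravariant functor: the total homotopy fiber of the cube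
`S ↦ F (⋃_{i ∈ S} X_i)` with the maps induced by the inclusions. -/
noncomputable def cross : Prespectrum.{u} := (tfib n).obj ((inclusionCube X).op ⋙ F)

/-- The `n`-th co-cross effect of a contravariant functor: the total homotopy cofiber of the cube
`S ↦ F (⋃_{i ∈ S} X_i)` with the maps induced by the collapse maps. -/
noncomputable def cocross : Prespectrum.{u} := (tcofib n).obj ((collapseCube X).rightOp ⋙ F)

/-- The natural map `i_n` from the cross effect. -/
noncomputable def crossι : cross X F ⟶ F.obj (op (union X Finset.univ)) :=
  tfibι n ((inclusionCube X).op ⋙ F)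

/-- The natural map `p_n` to the co-cross effect. -/
noncomputable def cocrossπ : F.obj (op (union X Finset.univ)) ⟶ cocross X F :=
  tcofibπ n ((collapseCube X).rightOp ⋙ F)

/-- The map from the cross effect of `(X_s : s ∈ S)` to `F (⋃_{i ∈ S} X_i)`, followed by the map
to `F (⋃_i X_i)` induced by the collapse. -/
noncomputable def crossSummand (S : Finset (Fin n)) :
    cross (sub X S) F ⟶ F.obj (op (union X Finset.univ)) :=
  crossι (sub X S) F ≫ F.map (unionSubIso X S).inv.op ≫
    F.map ((collapseCube X).map (homOfLE (Finset.subset_univ S)).op).op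

/-- The map from `F (⋃_i X_i)` to `F (⋃_{i ∈ S} X_i)` induced by the inclusion, followed by the map
to the co-cross effect of `(X_s : s ∈ S)`. -/
noncomputable def cocrossFactor (S : Finset (Fin n)) :
    F.obj (op (union X Finset.univ)) ⟶ cocross (sub X S) F :=
  F.map ((inclusionCube X).map (homOfLE (Finset.subset_univ S))).op ≫
    F.map (unionSubIso X S).hom.op ≫ cocrossπ (sub X S) F

end Contravariant

section Covariant

variable (F : C ⥤ Prespectrum.{u})

/-- The `n`-th cross effect of a covariant functor: the total homotopy fiber of the cube
`S ↦ F (⋃_{i ∈ S} X_i)` with the maps induced by the collapse maps. -/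
noncomputable def covCross : Prespectrum.{u} := (tfib n).obj (collapseCube X ⋙ F)

/-- The `n`-th co-cross effect of a covariant functor: the total homotopy cofiber of the cube
`S ↦ F (⋃_{i ∈ S} X_i)` with the maps induced by the inclusions. -/
noncomputable def covCocross : Prespectrum.{u} := (tcofib n).obj (inclusionCube X ⋙ F)

/-- The natural map `i_n` from the cross effect. -/
noncomputable def covCrossι : covCross X F ⟶ F.obj (union X Finset.univ) :=
  tfibι n (collapseCube X ⋙ F)

/-- The natural map `p_n` to the co-cross effect. -/
noncomputable def covCocrossπ : F.obj (union X Finset.univ) ⟶ covCocross X F :=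
  tcofibπ n (inclusionCube X ⋙ F)

/-- The map from the cross effect of `(X_s : s ∈ S)` to `F (⋃_{i ∈ S} X_i)`, followed by the map
to `F (⋃_i X_i)` induced by the inclusion. -/
noncomputable def covCrossSummand (S : Finset (Fin n)) :
    covCross (sub X S) F ⟶ F.obj (union X Finset.univ) :=
  covCrossι (sub X S) F ≫ F.map (unionSubIso X S).hom ≫
    F.map ((inclusionCube X).map (homOfLE (Finset.subset_univ S)))

/-- The map from `F (⋃_i X_i)` to `F (⋃_{i ∈ S} X_i)` induced by the collapse, followed by the map
to the co-cross effect of `(X_s : s ∈ S)`. -/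
noncomputable def covCocrossFactor (S : Finset (Fin n)) :
    F.obj (union X Finset.univ) ⟶ covCocross (sub X S) F :=
  F.map ((collapseCube X).map (homOfLE (Finset.subset_univ S)).op) ≫
    F.map (unionSubIso X S).inv ≫ covCocrossπ (sub X S) F

end Covariant

end CrossEffects

end CrossEffects

open CrossEffects

/-! Put `G S = F(⋃_S X_i)`. Inclusions and collapses give two families of maps between these
vertices: restrictions from larger to smaller sets and extensions from smaller to larger ones. They
satisfy base change: extending from `S` and then restricting to `T` agrees with restricting to `S ∩
T` and then extending to `T` (`unionIncl_collapse`). In particular every extension is a section of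
the corresponding restriction. The rest is formal and is proved for an arbitrary `BiCube`;
contravariant and covariant functors only differ in which family comes from the inclusions.

The homotopy theory enters through split maps. If `e : E ⟶ E'` has retraction `r`, then `fib r → E'`
and `E' → cofib e` identify the stable homotopy of both ends with the kernel of `r` on the stable
homotopy of `E'`. No long exact sequence is needed: the difference of the structure map `ΣE'_k →
E'_{k+1}` and its precomposition with `r ≫ e`, formed along the suspension coordinate, extends over
the cofiber and lifts to the fiber (`cofibSection`, `fibRetraction`). On homotopy groups this
supplies the missing inverse up to one stabilization (`map_fib_to_cofib_bijective`).

An `(n + 1)`-cube is a map between its upper and lower faces. By base change the opposite structure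
maps give a section of this map on total fibers and a retraction on total cofibers. The comparison
from total fiber to total cofiber factors through the comparison of the upper face and is compatible
with that of the lower face. Induction on `n` shows that it is an equivalence
(`map_comparison_bijective`).

For the splitting, let `s_S` and `p_S` be the maps from the fiber of the face of subsets of `S` and
to its cofiber. Base change makes `s_S ≫ p_T` factor through `S ∩ T`, so it vanishes on homotopy for
`S ≠ T`, and for `S = T` it is the comparison. The family `p_S` is jointly injective: if all proper
restrictions of an element of `π_* (G S)` vanish, it comes from the total fiber, where `p_S` detects
it; strong induction on `S` does the rest (`eq_zero_of_map_factor`). A diagonal matrix of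
isomorphisms then gives both splittings (`bijective_of_diagonal`), because stable homotopy takes
finite products and finite wedges to products. -/

namespace CrossEffects

namespace Prespectrum

open scoped Topology.Homotopy unitInterval

/-! ### Stable homotopy groups as sequential colimits -/

section Colimit

/-- The terms of the sequential systems defining the stable homotopy groups. -/
abbrev Stage (E : Prespectrum.{u}) (a b j : ℕ) : Type u :=
  HomotopyGroup.Pi (a + j) (E.level (b + j)).carrier (E.level (b + j)).pt

/-- The colimit of the homotopy groups `π_{a + j} (E (b + j))`. -/
def ColimPi (a b : ℕ) (E : Prespectrum.{u}) : Type u := Quot (StableRel E a b)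

namespace ColimPi

variable {a b : ℕ} {E E' E'' : Prespectrum.{u}}

/-- The class in the colimit of an element of a homotopy group. -/
def mk (j : ℕ) (x : Stage E a b j) : ColimPi a b E := Quot.mk _ ⟨j, x⟩

/-- The transition maps of the system. -/
def step {j : ℕ} (x : Stage E a b j) : Stage E a b (j + 1) := E.stabilize (b + j) (a + j) x

theorem mk_step {j : ℕ} (x : Stage E a b j) : mk (j + 1) (step x) = mk j x :=
  (Quot.sound (StableRel.step j x)).symm

/-- The composites of the transition maps. -/
def raise {j k : ℕ} (h : j ≤ k) (x : Stage E a b j) : Stage E a b k :=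
  Nat.leRecOn h (fun {_} => step) x

theorem raise_self {j : ℕ} (x : Stage E a b j) : raise le_rfl x = x := Nat.leRecOn_self _

theorem raise_succ {j k : ℕ} (h : j ≤ k) (x : Stage E a b j) :
    raise (Nat.le_succ_of_le h) x = step (raise h x) := Nat.leRecOn_succ h x

theorem raise_trans {j k l : ℕ} (h : j ≤ k) (h' : k ≤ l) (x : Stage E a b j) :
    raise h' (raise h x) = raise (h.trans h') x := (Nat.leRecOn_trans h h' x).symm

theorem mk_raise {j k : ℕ} (h : j ≤ k) (x : Stage E a b j) : mk k (raise h x) = mk j x := by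
  induction k, h using Nat.le_induction with
  | base => rw [raise_self]
  | succ k h ih => rw [raise_succ h, mk_step, ih]

/-- Representatives exist at all late stages, so finitely many classes can be moved to a common one.
-/
theorem exists_rep (x : ColimPi a b E) : ∃ N, ∀ k, N ≤ k → ∃ y : Stage E a b k, mk k y = x := by
  obtain ⟨j, y⟩ := x
  exact ⟨j, fun k h => ⟨raise h y, mk_raise h y⟩⟩

/-- The map of homotopy groups at a stage induced by a map of prespectra. -/
def stageMap (f : E ⟶ E') {j : ℕ} (x : Stage E a b j) : Stage E' a b j := mapPi (f.app _) _ x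

theorem stageMap_step (f : E ⟶ E') {j : ℕ} (x : Stage E a b j) :
    stageMap f (step x) = step (stageMap f x) := mapPi_stabilize f _ _ x

theorem stageMap_raise (f : E ⟶ E') {j k : ℕ} (h : j ≤ k) (x : Stage E a b j) :
    stageMap f (raise h x) = raise h (stageMap f x) := by
  induction k, h using Nat.le_induction with
  | base => rw [raise_self, raise_self]
  | succ k h ih => rw [raise_succ h, raise_succ h, stageMap_step, ih]

/-- The map of colimits induced by a map of prespectra. -/
def map (f : E ⟶ E') : ColimPi a b E → ColimPi a b E' :=
  Quot.map (fun x => ⟨x.1, stageMap f x.2⟩) (by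
    rintro _ _ ⟨j, x⟩
    have := StableRel.step (a := a) (b := b) j (stageMap f x)
    exact (stageMap_step f x) ▸ this)

theorem map_mk (f : E ⟶ E') {j : ℕ} (x : Stage E a b j) :
    map f (mk j x) = mk j (stageMap f x) := rfl

theorem map_id (x : ColimPi a b E) : map (𝟙 E) x = x := by
  obtain ⟨j, x⟩ := x
  induction x using Quotient.inductionOn
  rfl

theorem map_comp (f : E ⟶ E') (g : E' ⟶ E'') (x : ColimPi a b E) :
    map (f ≫ g) x = map g (map f x) := by
  obtain ⟨j, x⟩ := x
  induction x using Quotient.inductionOn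
  rfl

end ColimPi

/-- The integer `q` only enters through `a` and `b`; all arguments below are for arbitrary `a` and
`b`. -/
theorem isStableEquiv_iff {E E' : Prespectrum.{u}} (f : E ⟶ E') :
    IsStableEquiv f ↔
      ∀ q : ℤ, Function.Bijective (ColimPi.map (a := q.toNat) (b := (-q).toNat) f) := Iff.rfl

end Colimit

/-! ### The group structure -/

section Groups

variable {E E' : Prespectrum.{u}}

/-- Suspension adds a new last coordinate, so it does not interfere with concatenation along an old
one. -/
theorem suspendLoop_transAt (k m : ℕ) (i : Fin m)
    (γ γ' : GenLoop (Fin m) (E.level k).carrier (E.level k).pt) :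
    E.suspendLoop k m (GenLoop.transAt i γ γ') =
      GenLoop.transAt i.castSucc (E.suspendLoop k m γ) (E.suspendLoop k m γ') := by
  have hu : ∀ (t : Fin (m + 1) → I) (s : I),
      Fin.init (Function.update t i.castSucc s) = Function.update (Fin.init t : Fin m → I) i s := by
    intro t s
    ext j
    simp [Fin.init, Function.update_apply]
  refine GenLoop.ext _ _ fun t => ?_
  change E.str k ((GenLoop.transAt i γ γ') (Fin.init t), t (Fin.last m)) = ite _
    (E.str k (γ (Fin.init (Function.update t _ _)), Function.update t _ _ (Fin.last m)))
    (E.str k (γ' (Fin.init (Function.update t _ _)), Function.update t _ _ (Fin.last m)))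
  rw [hu, hu, Function.update_of_ne (Fin.castSucc_lt_last i).ne',
    Function.update_of_ne (Fin.castSucc_lt_last i).ne']
  change E.str k (ite _ _ _, _) = _
  change E.str k (if (t i.castSucc : ℝ) ≤ 1 / 2 then _ else _, _) = _
  split_ifs <;> rfl

theorem mapLoop_transAt {X Y : BasedSpace.{u}} (f : BasedMap X Y) (m : ℕ) (i : Fin m)
    (γ γ' : GenLoop (Fin m) X.carrier X.pt) :
    mapLoop f m (GenLoop.transAt i γ γ') = GenLoop.transAt i (mapLoop f m γ) (mapLoop f m γ') := by
  refine GenLoop.ext _ _ fun t => ?_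
  change f.map (ite _ _ _) = ite _ (f.map _) (f.map _)
  split_ifs <;> rfl

theorem stabilize_mul (k m : ℕ)
    (x y : HomotopyGroup.Pi (m + 1) (E.level k).carrier (E.level k).pt) :
    E.stabilize k (m + 1) (x * y) = E.stabilize k (m + 1) x * E.stabilize k (m + 1) y := by
  induction x, y using Quotient.inductionOn₂ with
  | h γ γ' =>
    -- `mul_spec` computes the product along any chosen coordinate, with the factors in reverse
    -- order. The coordinate `0` and its image under `castSucc` are chosen so that suspension
    -- matches the two concatenations.
    have h1 := HomotopyGroup.mul_spec (i := (0 : Fin (m + 1))) (p := γ) (q := γ')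
    have h2 := HomotopyGroup.mul_spec (i := (0 : Fin (m + 1)).castSucc)
      (p := E.suspendLoop k _ γ) (q := E.suspendLoop k _ γ')
    refine (congrArg (E.stabilize k (m + 1)) h1).trans (Eq.trans ?_ h2.symm)
    exact congrArg (Quotient.mk _) (suspendLoop_transAt k (m + 1) 0 γ' γ)

theorem mapPi_mul {X Y : BasedSpace.{u}} (f : BasedMap X Y) (m : ℕ)
    (x y : HomotopyGroup.Pi (m + 1) X.carrier X.pt) :
    mapPi f (m + 1) (x * y) = mapPi f (m + 1) x * mapPi f (m + 1) y := by
  induction x, y using Quotient.inductionOn₂ with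
  | h γ γ' =>
    have h1 := HomotopyGroup.mul_spec (i := (0 : Fin (m + 1))) (p := γ) (q := γ')
    have h2 := HomotopyGroup.mul_spec (i := (0 : Fin (m + 1)))
      (p := mapLoop f _ γ) (q := mapLoop f _ γ')
    refine (congrArg (mapPi f (m + 1)) h1).trans (Eq.trans ?_ h2.symm)
    exact congrArg (Quotient.mk _) (mapLoop_transAt f (m + 1) 0 γ' γ)

namespace ColimPi

variable {a b : ℕ}

noncomputable instance (j : ℕ) : Group (Stage E a b (j + 1)) :=
  inferInstanceAs (Group (HomotopyGroup (Fin ((a + j) + 1)) _ _))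

noncomputable instance (j : ℕ) : CommGroup (Stage E a b (j + 2)) :=
  inferInstanceAs (CommGroup (HomotopyGroup (Fin ((a + j) + 2)) _ _))

theorem step_mul {j : ℕ} (x y : Stage E a b (j + 1)) : step (x * y) = step x * step y :=
  stabilize_mul (E := E) _ _ x y

theorem stageMap_mul (f : E ⟶ E') {j : ℕ} (x y : Stage E a b (j + 1)) :
    stageMap f (x * y) = stageMap f x * stageMap f y := mapPi_mul _ _ x y

theorem raise_mul {j k : ℕ} (h : j ≤ k) (x y : Stage E a b (j + 1)) :
    raise (Nat.succ_le_succ h) (x * y) =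
      raise (Nat.succ_le_succ h) x * raise (Nat.succ_le_succ h) y := by
  induction k, h using Nat.le_induction with
  | base => simp only [raise_self]
  | succ k h ih =>
    rw [raise_succ (Nat.succ_le_succ h), raise_succ (Nat.succ_le_succ h),
      raise_succ (Nat.succ_le_succ h), ih]
    exact step_mul _ _

variable (a b E) in
/-- The terms of the system which are abelian groups. -/
abbrev AbStage (j : ℕ) : Type u := Additive (Stage E a b (j + 2))

/-- The transition maps as homomorphisms of abelian groups. -/
noncomputable def abRaise (j k : ℕ) (h : j ≤ k) : AbStage E a b j →+ AbStage E a b k :=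
  MonoidHom.toAdditive (MonoidHom.mk' (raise (Nat.add_le_add_right h 2))
    (raise_mul (Nat.succ_le_succ h)))

instance : DirectedSystem (AbStage E a b) (abRaise · · ·) where
  map_self _ x := raise_self x.toMul
  map_map _ _ _ h h' x := raise_trans (Nat.add_le_add_right h 2) (Nat.add_le_add_right h' 2) x.toMul

variable (a b E) in
/-- The comparison with the direct limit of abelian groups. -/
noncomputable def equivDirectLimit : ColimPi a b E ≃ DirectLimit (AbStage E a b) abRaise where
  -- The stages from `2` on are abelian groups and are cofinal, so a representative is moved up by
  -- two.
  toFun := Quot.lift (fun x => ⟦⟨x.1, Additive.ofMul (raise (Nat.le_add_right x.1 2) x.2)⟩⟧) (by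
    rintro _ _ ⟨j, x⟩
    refine Quotient.sound ⟨j + 1, Nat.le_succ j, le_rfl, ?_⟩
    have h : step x = raise (Nat.le_succ j) x := by rw [raise_succ le_rfl, raise_self]
    change raise (Nat.add_le_add_right (Nat.le_succ j) 2) (raise (Nat.le_add_right j 2) x) =
      raise le_rfl (raise (Nat.le_add_right (j + 1) 2) (step x))
    rw [h, raise_trans, raise_trans, raise_trans])
  invFun := DirectLimit.lift _ (fun j x => mk (j + 2) x.toMul)
    fun j k h x => (mk_raise (Nat.add_le_add_right h 2) x.toMul).symm
  left_inv x := by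
    obtain ⟨j, x⟩ := x
    exact mk_raise _ x
  right_inv x := by
    induction x using DirectLimit.induction with
    | ih j x =>
      refine Quotient.sound ⟨j + 2, le_rfl, Nat.le_add_right j 2, ?_⟩
      change raise le_rfl (raise (Nat.le_add_right (j + 2) 2) x.toMul) =
        raise (Nat.add_le_add_right (Nat.le_add_right j 2) 2) x.toMul
      rw [raise_self]

noncomputable instance : AddCommGroup (ColimPi a b E) := (equivDirectLimit E a b).addCommGroup

/-- Equality in the quotient is a priori a zigzag of steps. In the direct limit over the directed
set `ℕ` it means agreement at one later stage. -/
theorem mk_eq_mk_iff {j : ℕ} (x y : Stage E a b j) :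
    mk j x = mk j y ↔ ∃ (k : ℕ) (h : j ≤ k), raise h x = raise h y := by
  constructor
  · intro h
    obtain ⟨k, hk, _, h⟩ := Quotient.exact (congrArg (equivDirectLimit E a b) h)
    refine ⟨k + 2, hk.trans (Nat.le_add_right k 2), ?_⟩
    have h' : raise (Nat.add_le_add_right hk 2) (raise (Nat.le_add_right j 2) x) =
      raise (Nat.add_le_add_right hk 2) (raise (Nat.le_add_right j 2) y) := h
    rwa [raise_trans, raise_trans] at h'
  · rintro ⟨k, h, hxy⟩
    rw [← mk_raise h, hxy, mk_raise h]

theorem mk_mul {j : ℕ} (x y : Stage E a b (j + 1)) :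
    mk (j + 1) (x * y) = mk (j + 1) x + mk (j + 1) y := by
  have key : ∀ (j : ℕ) (x y : Stage E a b (j + 2)),
      mk (j + 2) (x * y) = mk (j + 2) x + mk (j + 2) y := by
    intro j x y
    have h : ∀ z : Stage E a b (j + 2), mk (j + 2) z =
        (equivDirectLimit E a b).symm ⟦⟨j, Additive.ofMul z⟩⟧ := fun z => rfl
    rw [h, h, h, Equiv.add_def, Equiv.apply_symm_apply, Equiv.apply_symm_apply,
      DirectLimit.add_def]
    rfl
  -- The addition is transported from the stages of index at least `2`; one step brings stage `j +
  -- 1` into that range.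
  rw [← mk_step, step_mul, ← mk_step x, ← mk_step y]
  exact key j _ _

theorem mk_one {j : ℕ} : mk (j + 1) (1 : Stage E a b (j + 1)) = 0 := by
  have h := mk_mul (1 : Stage E a b (j + 1)) 1
  rw [mul_one] at h
  exact left_eq_add.1 h

/-- The class of the constant loop. -/
def stageOne {j : ℕ} : Stage E a b j := Quotient.mk _ GenLoop.const

theorem stageMap_one (f : E ⟶ E') {j : ℕ} : stageMap f (stageOne : Stage E a b j) = stageOne :=
  congrArg (Quotient.mk _) (GenLoop.ext _ _ fun _ => (f.app _).map_pt)

theorem step_one {j : ℕ} : step (stageOne : Stage E a b j) = stageOne :=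
  congrArg (Quotient.mk _) (GenLoop.ext _ _ fun _ => E.str_pt _ _)

theorem raise_one {j k : ℕ} (h : j ≤ k) : raise h (stageOne : Stage E a b j) = stageOne := by
  induction k, h using Nat.le_induction with
  | base => rw [raise_self]
  | succ k h ih => rw [raise_succ h, ih, step_one]

theorem stageMap_comp {E'' : Prespectrum.{u}} (f : E ⟶ E') (g : E' ⟶ E'') {j : ℕ}
    (x : Stage E a b j) : stageMap (f ≫ g) x = stageMap g (stageMap f x) := by
  induction x using Quotient.inductionOn
  rfl

/-- This covers stage `0` as well, where the homotopy set need not be a group. -/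
theorem mk_stageOne {j : ℕ} : mk j (stageOne : Stage E a b j) = 0 := by
  rw [← mk_step, step_one]
  exact mk_one

theorem map_add (f : E ⟶ E') (x y : ColimPi a b E) : map f (x + y) = map f x + map f y := by
  obtain ⟨N, hN⟩ := exists_rep x
  obtain ⟨M, hM⟩ := exists_rep y
  obtain ⟨x, rfl⟩ := hN (N + M + 1) (by omega)
  obtain ⟨y, rfl⟩ := hM (N + M + 1) (by omega)
  rw [← mk_mul, map_mk, map_mk, map_mk, ← mk_mul, stageMap_mul]

/-- The homomorphism of stable homotopy groups induced by a map of prespectra. -/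
noncomputable def mapHom (f : E ⟶ E') : ColimPi a b E →+ ColimPi a b E' :=
  AddMonoidHom.mk' (map f) (map_add f)

theorem map_zero (f : E ⟶ E') : map f (0 : ColimPi a b E) = 0 :=
  (mapHom (a := a) (b := b) f).map_zero

end ColimPi

end Groups

end Prespectrum

end CrossEffects

namespace CrossEffects

open scoped unitInterval

/-! ### Reparametrizations of the unit interval -/

section Interval

/-- The map `t ↦ 2t`, cut off at `1`. -/
noncomputable def dblLeft (t : I) : I := Set.projIcc 0 1 zero_le_one (2 * (t : ℝ))

/-- The map `t ↦ 2t - 1`, cut off at `0`. -/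
noncomputable def dblRight (t : I) : I := Set.projIcc 0 1 zero_le_one (2 * (t : ℝ) - 1)

@[fun_prop]
theorem continuous_dblLeft : Continuous dblLeft := continuous_projIcc.comp (by fun_prop)

@[fun_prop]
theorem continuous_dblRight : Continuous dblRight := continuous_projIcc.comp (by fun_prop)

theorem dblLeft_of_ge {t : I} (h : 1 / 2 ≤ (t : ℝ)) : dblLeft t = 1 :=
  Set.projIcc_of_right_le _ (by linarith)

theorem dblRight_of_le {t : I} (h : (t : ℝ) ≤ 1 / 2) : dblRight t = 0 :=
  Set.projIcc_of_le_left _ (by linarith)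

@[simp] theorem dblLeft_zero : dblLeft 0 = 0 := Set.projIcc_of_le_left _ (by simp)

@[simp] theorem dblLeft_one : dblLeft 1 = 1 := dblLeft_of_ge (by norm_num)

@[simp] theorem dblRight_zero : dblRight 0 = 0 := dblRight_of_le (by norm_num)

@[simp] theorem dblRight_one : dblRight 1 = 1 := Set.projIcc_of_right_le _ (by norm_num)

/-- The path going from `0` to `1` and back. -/
noncomputable def tent (t : I) : I := dblLeft t ⊓ σ (dblRight t)

@[fun_prop]
theorem continuous_tent : Continuous tent :=
  continuous_dblLeft.inf (unitInterval.continuous_symm.comp continuous_dblRight)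

theorem tent_of_le {t : I} (h : (t : ℝ) ≤ 1 / 2) : tent t = dblLeft t := by
  rw [tent, dblRight_of_le h, unitInterval.symm_zero]
  exact inf_of_le_left unitInterval.le_one'

theorem tent_of_ge {t : I} (h : 1 / 2 ≤ (t : ℝ)) : tent t = σ (dblRight t) := by
  rw [tent, dblLeft_of_ge h]
  exact inf_of_le_right unitInterval.le_one'

@[simp] theorem tent_zero : tent 0 = 0 := by rw [tent_of_le (by norm_num), dblLeft_zero]

@[simp] theorem tent_one : tent 1 = 0 := by
  rw [tent_of_ge (by norm_num), dblRight_one, unitInterval.symm_one]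

/-- The convex combination `(1 - u) s + u t`. -/
def mix (u s t : I) : I :=
  ⟨(1 - (u : ℝ)) * s + u * t, by
    have hu := u.2; have hs := s.2; have ht := t.2
    simp only [Set.mem_Icc] at hu hs ht ⊢
    constructor
    · nlinarith [mul_nonneg hu.1 ht.1, mul_nonneg (sub_nonneg.2 hu.2) hs.1]
    · nlinarith [mul_nonneg hu.1 (sub_nonneg.2 ht.2),
        mul_nonneg (sub_nonneg.2 hu.2) (sub_nonneg.2 hs.2)]⟩

@[fun_prop]
theorem continuous_mix {Z : Type*} [TopologicalSpace Z] {f g h : Z → I} (hf : Continuous f)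
    (hg : Continuous g) (hh : Continuous h) : Continuous fun z => mix (f z) (g z) (h z) :=
  Continuous.subtype_mk (by fun_prop) _

@[simp] theorem mix_zero (s t : I) : mix 0 s t = s := Subtype.ext (by simp [mix])

@[simp] theorem mix_one (s t : I) : mix 1 s t = t := Subtype.ext (by simp [mix])

@[simp] theorem mix_self (u s : I) : mix u s s = s := Subtype.ext (by simp [mix]; ring)

end Interval

/-! ### Maps out of suspensions -/

/-- A based map `X ∧ S¹ → Y`, given as a map `X × [0,1] → Y`. -/
@[ext]
structure SuspMap (X Y : BasedSpace.{u}) where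
  map : C(X.carrier × I, Y.carrier)
  map_zero : ∀ x, map (x, 0) = Y.pt
  map_one : ∀ x, map (x, 1) = Y.pt
  map_pt : ∀ t, map (X.pt, t) = Y.pt

namespace BasedMap

variable {X Y Z : BasedSpace.{u}}

/-- Based homotopy of based maps. -/
def Homotopic (f g : BasedMap X Y) : Prop :=
  ∃ L : C(X.carrier × I, Y.carrier), (∀ x, L (x, 0) = f.map x) ∧ (∀ x, L (x, 1) = g.map x) ∧
    ∀ v, L (X.pt, v) = Y.pt

/-- The constant map. -/
def const (X Y : BasedSpace.{u}) : BasedMap X Y := ⟨ContinuousMap.const _ Y.pt, rfl⟩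

open Prespectrum in
theorem Homotopic.mapPi_eq {f g : BasedMap X Y} (h : Homotopic f g) (m : ℕ)
    (x : HomotopyGroup.Pi m X.carrier X.pt) : mapPi f m x = mapPi g m x := by
  obtain ⟨L, h0, h1, hp⟩ := h
  induction x using Quotient.inductionOn with
  | h γ =>
    refine Quotient.sound ⟨⟨⟨⟨fun p => L (γ p.2, p.1), by fun_prop⟩, fun t => h0 _,
      fun t => h1 _⟩, ?_⟩⟩
    intro v t ht
    change L (γ t, v) = f.map (γ t)
    rw [GenLoop.boundary γ t ht, hp, f.map_pt]

open Prespectrum in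
theorem mapPi_const (m : ℕ) (x : HomotopyGroup.Pi m X.carrier X.pt) :
    mapPi (const X Y) m x = Quotient.mk _ GenLoop.const := by
  induction x using Quotient.inductionOn
  rfl

end BasedMap

namespace SuspMap

open Prespectrum

variable {X Y Z : BasedSpace.{u}}

/-- The suspension of a loop followed by a map. -/
def loop (κ : SuspMap X Y) (m : ℕ) (γ : GenLoop (Fin m) X.carrier X.pt) :
    GenLoop (Fin (m + 1)) Y.carrier Y.pt :=
  ⟨⟨fun t => κ.map (γ (Fin.init t), t (Fin.last m)), by
      refine κ.map.continuous.comp (Continuous.prodMk (γ.1.continuous.comp ?_)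
        (continuous_apply _))
      exact continuous_pi fun i => continuous_apply _⟩, by
    rintro t ⟨i, hi⟩
    change κ.map (γ (Fin.init t), t (Fin.last m)) = _
    induction i using Fin.lastCases with
    | last =>
      rcases hi with hi | hi
      · rw [hi, κ.map_zero]
      · rw [hi, κ.map_one]
    | cast i =>
      rw [GenLoop.boundary γ (Fin.init t) ⟨i, hi⟩, κ.map_pt]⟩

theorem loop_homotopic (κ : SuspMap X Y) (m : ℕ) {γ γ' : GenLoop (Fin m) X.carrier X.pt}
    (h : GenLoop.Homotopic γ γ') : GenLoop.Homotopic (κ.loop m γ) (κ.loop m γ') := by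
  obtain ⟨H⟩ := h
  refine ⟨⟨⟨⟨fun p => κ.map (H (p.1, Fin.init p.2), p.2 (Fin.last m)), ?_⟩, ?_, ?_⟩, ?_⟩⟩
  · refine κ.map.continuous.comp (Continuous.prodMk (H.continuous.comp ?_) (by fun_prop))
    exact continuous_fst.prodMk (continuous_pi fun i => by
      change Continuous fun p : I × (Fin (m + 1) → I) => p.2 i.castSucc
      fun_prop)
  · intro t
    change κ.map (H (0, Fin.init t), t (Fin.last m)) = _
    rw [H.apply_zero]
    rfl
  · intro t
    change κ.map (H (1, Fin.init t), t (Fin.last m)) = _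
    rw [H.apply_one]
    rfl
  · rintro s t ht
    rw [ContinuousMap.coe_mk]
    have hb : κ.map (γ (Fin.init t), t (Fin.last m)) = Y.pt := (κ.loop m γ).2 t ht
    change κ.map (H (s, Fin.init t), t (Fin.last m)) = κ.map (γ (Fin.init t), t (Fin.last m))
    rw [hb]
    obtain ⟨i, hi⟩ := ht
    induction i using Fin.lastCases with
    | last =>
      rcases hi with hi | hi
      · rw [hi, κ.map_zero]
      · rw [hi, κ.map_one]
    | cast i =>
      have h1 : H (s, Fin.init t) = γ (Fin.init t) := H.eq_fst s ⟨i, hi⟩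
      rw [h1, hb]

/-- The induced map `π_m X → π_{m+1} Y`. -/
def pi (κ : SuspMap X Y) (m : ℕ) (x : HomotopyGroup.Pi m X.carrier X.pt) :
    HomotopyGroup.Pi (m + 1) Y.carrier Y.pt :=
  Quotient.map (κ.loop m) (fun _ _ h => κ.loop_homotopic m h) x

/-- Composition with a based map on the target. -/
def postcomp (κ : SuspMap X Y) (f : BasedMap Y Z) : SuspMap X Z where
  map := f.map.comp κ.map
  map_zero x := (congrArg f.map (κ.map_zero x)).trans f.map_pt
  map_one x := (congrArg f.map (κ.map_one x)).trans f.map_pt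
  map_pt t := (congrArg f.map (κ.map_pt t)).trans f.map_pt

/-- Composition with a based map on the source. -/
def precomp (f : BasedMap X Y) (κ : SuspMap Y Z) : SuspMap X Z where
  map := ⟨fun p => κ.map (f.map p.1, p.2), by fun_prop⟩
  map_zero _ := κ.map_zero _
  map_one _ := κ.map_one _
  map_pt t := (congrArg (fun y => κ.map (y, t)) f.map_pt).trans (κ.map_pt t)

theorem pi_postcomp (κ : SuspMap X Y) (f : BasedMap Y Z) (m : ℕ)
    (x : HomotopyGroup.Pi m X.carrier X.pt) :
    (κ.postcomp f).pi m x = mapPi f (m + 1) (κ.pi m x) := by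
  induction x using Quotient.inductionOn
  rfl

theorem pi_precomp (f : BasedMap X Y) (κ : SuspMap Y Z) (m : ℕ)
    (x : HomotopyGroup.Pi m X.carrier X.pt) :
    (precomp f κ).pi m x = κ.pi m (mapPi f m x) := by
  induction x using Quotient.inductionOn
  rfl

theorem pi_const (κ : SuspMap X Y) (m : ℕ) : κ.pi m (Quotient.mk _ GenLoop.const) = 1 :=
  congrArg (Quotient.mk _) (GenLoop.ext _ _ fun _ => κ.map_pt _)

/-- Based homotopy of maps out of the suspension. -/
def Homotopic (κ κ' : SuspMap X Y) : Prop :=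
  ∃ L : C((X.carrier × I) × I, Y.carrier), (∀ p, L (p, 0) = κ.map p) ∧ (∀ p, L (p, 1) = κ'.map p) ∧
    (∀ x v, L ((x, 0), v) = Y.pt) ∧ (∀ x v, L ((x, 1), v) = Y.pt) ∧
    ∀ t v, L ((X.pt, t), v) = Y.pt

theorem Homotopic.pi_eq {κ κ' : SuspMap X Y} (h : Homotopic κ κ') (m : ℕ)
    (x : HomotopyGroup.Pi m X.carrier X.pt) : κ.pi m x = κ'.pi m x := by
  obtain ⟨L, h0, h1, hz, ho, hp⟩ := h
  induction x using Quotient.inductionOn with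
  | h γ =>
    refine Quotient.sound ⟨⟨⟨⟨fun p => L ((γ (Fin.init p.2), p.2 (Fin.last m)), p.1), ?_⟩,
      fun t => h0 _, fun t => h1 _⟩, ?_⟩⟩
    · refine L.continuous.comp (((γ.1.continuous.comp ?_).prodMk (by fun_prop)).prodMk
        continuous_fst)
      exact continuous_pi fun i => by
        change Continuous fun p : I × (Fin (m + 1) → I) => p.2 i.castSucc
        fun_prop
    · rintro v t ht
      have hb : κ.map (γ (Fin.init t), t (Fin.last m)) = Y.pt := (κ.loop m γ).2 t ht
      change L ((γ (Fin.init t), t (Fin.last m)), v) = κ.map (γ (Fin.init t), t (Fin.last m))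
      rw [hb]
      obtain ⟨i, hi⟩ := ht
      induction i using Fin.lastCases with
      | last =>
        rcases hi with hi | hi
        · rw [hi, hz]
        · rw [hi, ho]
      | cast i => rw [GenLoop.boundary γ (Fin.init t) ⟨i, hi⟩, hp]

/-- The constant map. -/
def const (X Y : BasedSpace.{u}) : SuspMap X Y := ⟨ContinuousMap.const _ Y.pt, fun _ => rfl,
  fun _ => rfl, fun _ => rfl⟩

theorem pi_const_map (m : ℕ) (x : HomotopyGroup.Pi m X.carrier X.pt) :
    (const X Y).pi m x = 1 := by
  induction x using Quotient.inductionOn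
  rfl

/-- The concatenation of two maps along the suspension coordinate. -/
noncomputable def concat (κ κ' : SuspMap X Y) : SuspMap X Y where
  map := ⟨fun p => if (p.2 : ℝ) ≤ 1 / 2 then κ.map (p.1, dblLeft p.2)
      else κ'.map (p.1, dblRight p.2), by
    refine Continuous.if_le (by fun_prop) (by fun_prop) (by fun_prop) (by fun_prop) ?_
    intro p hp
    rw [dblLeft_of_ge hp.ge, dblRight_of_le hp.le, κ.map_one, κ'.map_zero]⟩
  map_zero x := by simp [κ.map_zero]
  map_one x := by
    have : ¬ ((1 : ℝ) ≤ 1 / 2) := by norm_num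
    simp only [ContinuousMap.coe_mk, Set.Icc.coe_one, this, if_false, dblRight_one, κ'.map_one]
  map_pt t := by simp [κ.map_pt, κ'.map_pt]

/-- The reversal along the suspension coordinate. -/
def symm (κ : SuspMap X Y) : SuspMap X Y where
  map := ⟨fun p => κ.map (p.1, σ p.2), by fun_prop⟩
  map_zero x := by simp [κ.map_one]
  map_one x := by simp [κ.map_zero]
  map_pt t := by simp [κ.map_pt]

theorem init_update_last {m : ℕ} (t : Fin (m + 1) → I) (s : I) :
    (Fin.init (Function.update t (Fin.last m) s) : Fin m → I) = Fin.init t := by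
  ext i
  simp [Fin.init, (Fin.castSucc_lt_last i).ne]

/-- Concatenation along the suspension coordinate is the group law in the last coordinate of the
loop; the order is reversed by the convention of `mul_spec`. -/
theorem pi_concat (κ κ' : SuspMap X Y) (m : ℕ) (x : HomotopyGroup.Pi m X.carrier X.pt) :
    (concat κ κ').pi m x = κ'.pi m x * κ.pi m x := by
  induction x using Quotient.inductionOn with
  | h γ =>
    refine Eq.trans ?_ (HomotopyGroup.mul_spec (i := Fin.last m)
      (p := κ'.loop m γ) (q := κ.loop m γ)).symm
    refine congrArg (Quotient.mk _) (GenLoop.ext _ _ fun t => ?_)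
    change ite _ _ _ = ite _ (κ.map (γ (Fin.init (Function.update t _ _)), Function.update t _ _ _))
      (κ'.map (γ (Fin.init (Function.update t _ _)), Function.update t _ _ _))
    rw [init_update_last, init_update_last, Function.update_self, Function.update_self]
    rfl

theorem pi_symm (κ : SuspMap X Y) (m : ℕ) (x : HomotopyGroup.Pi m X.carrier X.pt) :
    κ.symm.pi m x = (κ.pi m x)⁻¹ := by
  induction x using Quotient.inductionOn with
  | h γ =>
    refine Eq.trans ?_ (HomotopyGroup.inv_spec (i := Fin.last m) (p := κ.loop m γ)).symm
    refine congrArg (Quotient.mk _) (GenLoop.ext _ _ fun t => ?_)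
    change κ.map (γ (Fin.init t), σ (t (Fin.last m))) =
      κ.map (γ (Fin.init fun j => if j = Fin.last m then σ (t (Fin.last m)) else t j),
        if Fin.last m = Fin.last m then σ (t (Fin.last m)) else t (Fin.last m))
    rw [if_pos rfl]
    congr 3
    ext i
    simp [Fin.init, (Fin.castSucc_lt_last i).ne]

/-- The difference of two maps along the suspension coordinate. -/
noncomputable def diff (κ κ' : SuspMap X Y) : SuspMap X Y := concat κ κ'.symm

theorem pi_diff (κ κ' : SuspMap X Y) (m : ℕ) (x : HomotopyGroup.Pi m X.carrier X.pt) :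
    (diff κ κ').pi m x = (κ'.pi m x)⁻¹ * κ.pi m x := by
  rw [diff, pi_concat, pi_symm]

/-- The second map is traversed backwards, so on both halves the suspension coordinate is `tent t`.
-/
theorem diff_apply_of_le (κ κ' : SuspMap X Y) (x : X.carrier) {t : I} (h : (t : ℝ) ≤ 1 / 2) :
    (diff κ κ').map (x, t) = κ.map (x, tent t) := by
  rw [tent_of_le h]
  exact if_pos h

theorem diff_apply_of_ge (κ κ' : SuspMap X Y) (x : X.carrier) {t : I} (h : 1 / 2 ≤ (t : ℝ)) :
    (diff κ κ').map (x, t) = κ'.map (x, tent t) := by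
  by_cases h' : (t : ℝ) ≤ 1 / 2
  · rw [diff_apply_of_le _ _ _ h', tent_of_le h', dblLeft_of_ge h, κ.map_one, κ'.map_one]
  · rw [tent_of_ge h]
    exact if_neg h'

/-- Where the two maps agree, the difference runs along a path and back. Such a loop is contracted
by capping `tent`, and all null-homotopies below are of this kind. -/
theorem diff_apply_of_eq (κ κ' : SuspMap X Y) (x : X.carrier)
    (h : ∀ t, κ.map (x, t) = κ'.map (x, t)) (t : I) :
    (diff κ κ').map (x, t) = κ.map (x, tent t) := by
  rcases le_total (t : ℝ) (1 / 2) with ht | ht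
  · exact diff_apply_of_le _ _ _ ht
  · rw [diff_apply_of_ge _ _ _ ht, h]

end SuspMap

namespace Prespectrum

variable (E : Prespectrum.{u})

/-- The structure maps of a prespectrum. -/
def strMap (k : ℕ) : SuspMap (E.level k) (E.level (k + 1)) :=
  ⟨E.str k, E.str_zero k, E.str_one k, E.str_pt k⟩

end Prespectrum

end CrossEffects

namespace CrossEffects

open scoped unitInterval

/-! ### The homotopy cofiber of a split inclusion -/

section CofiberMaps

variable {X Y : BasedSpace.{u}} (f : BasedMap X Y)

/-- A family of maps out of the homotopy cofiber. -/
def cofibDesc {K W : Type*} [TopologicalSpace K] [LocallyCompactSpace K] [TopologicalSpace W]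
    (g : C((X.carrier × I) × K, W)) (h : C(Y.carrier × K, W))
    (h0 : ∀ x c, g ((x, 0), c) = h (Y.pt, c)) (hp : ∀ t c, g ((X.pt, t), c) = h (Y.pt, c))
    (h1 : ∀ x c, g ((x, 1), c) = h (f.map x, c)) : C(CofibSpace f × K, W) where
  toFun p := Quot.lift (Sum.elim (fun q => g (q, p.2)) fun y => h (y, p.2)) (by
    rintro _ _ (x | t | x)
    · exact h0 x p.2
    · exact hp t p.2
    · exact h1 x p.2) p.1
  continuous_toFun := by
    refine (isQuotientMap_cofibMk f).continuous_lift_prod_left ?_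
    have h2 := (continuous_sumElim.2 ⟨g.continuous, h.continuous⟩).comp
      (Homeomorph.sumProdDistrib (X := X.carrier × I) (Y := Y.carrier) (Z := K)).continuous
    convert! h2 using 1
    ext ⟨p | y, c⟩ <;> rfl

/-- The points of the cone. -/
def cofibInl (x : X.carrier) (t : I) : CofibSpace f := Quot.mk _ (Sum.inl (x, t))

@[fun_prop]
theorem continuous_cofibInl {K : Type*} [TopologicalSpace K] {g : K → X.carrier} {h : K → I}
    (hg : Continuous g) (hh : Continuous h) : Continuous fun c => cofibInl f (g c) (h c) :=
  continuous_quot_mk.comp (continuous_inl.comp (hg.prodMk hh))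

theorem cofibInl_zero (x : X.carrier) : cofibInl f x 0 = (hcofib f).pt :=
  Quot.sound (CofibRel.zero x)

theorem cofibInl_pt (t : I) : cofibInl f X.pt t = (hcofib f).pt := Quot.sound (CofibRel.pt t)

theorem cofibInl_one (x : X.carrier) : cofibInl f x 1 = Quot.mk _ (Sum.inr (f.map x)) :=
  Quot.sound (CofibRel.one x)

end CofiberMaps

namespace Prespectrum

variable {E E' : Prespectrum.{u}} (e : E ⟶ E')

/-- The homotopy slides down the cone, from height `1`, which is glued to `e x`, to height `0`, the
base point. -/
theorem cofib_null (k : ℕ) :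
    ((e ≫ cofibInr e).app k).Homotopic (BasedMap.const (E.level k) ((cofib e).level k)) := by
  refine ⟨⟨fun p => cofibInl (e.app k) p.1 (σ p.2), by fun_prop⟩, fun x => ?_, fun x => ?_,
    fun v => cofibInl_pt _ _⟩
  · change cofibInl (e.app k) x (σ 0) = _
    rw [unitInterval.symm_zero]
    exact cofibInl_one _ x
  · change cofibInl (e.app k) x (σ 1) = _
    rw [unitInterval.symm_one]
    exact cofibInl_zero _ x

variable (r : E' ⟶ E) (w : e ≫ r = 𝟙 E)

include w in
theorem split_apply (k : ℕ) (x : (E.level k).carrier) :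
    (r.app k).map ((e.app k).map x) = x := by
  rw [← comp_app_map_apply, w]
  rfl

/-- The difference of the structure map and its composition with an endomorphism. -/
noncomputable def diffStr {E : Prespectrum.{u}} (a : E ⟶ E) (k : ℕ) :
    SuspMap (E.level k) (E.level (k + 1)) :=
  SuspMap.diff (E.strMap k) (SuspMap.precomp (a.app k) (E.strMap k))

theorem pi_diffStr {E : Prespectrum.{u}} (a : E ⟶ E) (k m : ℕ)
    (x : HomotopyGroup.Pi m (E.level k).carrier (E.level k).pt) :
    (diffStr a k).pi m x = (E.stabilize k m (mapPi (a.app k) m x))⁻¹ * E.stabilize k m x := by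
  rw [diffStr, SuspMap.pi_diff, SuspMap.pi_precomp]
  rfl

include w in
-- The endomorphism `r ≫ e` fixes the image of `e`, so the difference there is an out-and-back loop.
-- Hence it extends over the cone on `E`.
theorem diffStr_section (k : ℕ) (x : (E.level k).carrier) (t : I) :
    (diffStr (r ≫ e) k).map ((e.app k).map x, t) = (e.app (k + 1)).map (E.str k (x, tent t)) := by
  have h : ((r ≫ e).app k).map ((e.app k).map x) = (e.app k).map x := by
    rw [comp_app_map_apply, split_apply e r w]
  rw [diffStr, SuspMap.diff_apply_of_eq]
  · exact (e.app_str k x _).symm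
  · intro t
    exact congrArg (fun y => E'.str k (y, t)) h.symm

include w in
-- Since `r ≫ e ≫ r = r`, both halves of the difference have the same image under `r`. The resulting
-- out-and-back loop is contractible, which allows a lift to the homotopy fiber of `r`.
theorem retraction_diffStr (k : ℕ) (y : (E'.level k).carrier) (t : I) :
    (r.app (k + 1)).map ((diffStr (r ≫ e) k).map (y, t)) =
      E.str k ((r.app k).map y, tent t) := by
  rcases le_total (t : ℝ) (1 / 2) with ht | ht
  · rw [diffStr, SuspMap.diff_apply_of_le _ _ _ ht]
    exact r.app_str k y _
  · rw [diffStr, SuspMap.diff_apply_of_ge _ _ _ ht]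
    refine (r.app_str k _ _).trans (congrArg (fun z => E.str k (z, tent t)) ?_)
    exact split_apply e r w k _

/-- The stable section of `E' → cofib e` for a split inclusion `e`. -/
noncomputable def cofibSection (k : ℕ) : SuspMap ((cofib e).level k) (E'.level (k + 1)) where
  map := cofibDesc (e.app k)
    -- The cone coordinate caps `tent`: at height `1` this is the full loop prescribed by `diffStr`
    -- on the image of `e`, at height `0` it is constant.
    ⟨fun p => (e.app (k + 1)).map (E.str k (p.1.1, tent p.2 ⊓ p.1.2)), by fun_prop⟩
    (diffStr (r ≫ e) k).map
    (fun x t => by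
      rw [(diffStr (r ≫ e) k).map_pt]
      change (e.app (k + 1)).map (E.str k (x, tent t ⊓ 0)) = _
      rw [inf_of_le_right unitInterval.nonneg', E.str_zero, (e.app (k + 1)).map_pt])
    (fun s t => by
      rw [(diffStr (r ≫ e) k).map_pt]
      change (e.app (k + 1)).map (E.str k (_, _)) = _
      rw [E.str_pt, (e.app (k + 1)).map_pt])
    (fun x t => by
      rw [diffStr_section e r w]
      change (e.app (k + 1)).map (E.str k (x, tent t ⊓ 1)) = _
      rw [inf_of_le_left unitInterval.le_one'])
  map_zero p := by
    obtain ⟨⟨x, s⟩ | y⟩ := p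
    · change (e.app (k + 1)).map (E.str k (x, tent 0 ⊓ s)) = _
      rw [tent_zero, inf_of_le_left unitInterval.nonneg', E.str_zero, (e.app (k + 1)).map_pt]
    · exact (diffStr (r ≫ e) k).map_zero y
  map_one p := by
    obtain ⟨⟨x, s⟩ | y⟩ := p
    · change (e.app (k + 1)).map (E.str k (x, tent 1 ⊓ s)) = _
      rw [tent_one, inf_of_le_left unitInterval.nonneg', E.str_zero, (e.app (k + 1)).map_pt]
    · exact (diffStr (r ≫ e) k).map_one y
  map_pt t := (diffStr (r ≫ e) k).map_pt t

/-- The null-homotopy of the endomorphism of the homotopy cofiber induced by the retraction. -/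
def cofibContraction (k : ℕ) : C(CofibSpace (e.app k) × I, CofibSpace (e.app k)) :=
  -- The parameter `v` caps the height in the cone. At `v = 1` the map is the identity on the cone
  -- and `r ≫ e` on `E'`; at `v = 0` it is constant.
  cofibDesc (e.app k) ⟨fun p => cofibInl (e.app k) p.1.1 (p.1.2 ⊓ p.2), by fun_prop⟩
    ⟨fun p => cofibInl (e.app k) ((r.app k).map p.1) p.2, by fun_prop⟩
    (fun x v => by
      change cofibInl _ x (0 ⊓ v) = cofibInl _ ((r.app k).map _) v
      rw [inf_of_le_left unitInterval.nonneg', cofibInl_zero, (r.app k).map_pt, cofibInl_pt])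
    (fun s v => by
      change cofibInl _ _ (s ⊓ v) = cofibInl _ ((r.app k).map _) v
      rw [cofibInl_pt, (r.app k).map_pt, cofibInl_pt])
    (fun x v => by
      change cofibInl _ x (1 ⊓ v) = cofibInl _ ((r.app k).map ((e.app k).map x)) v
      rw [inf_of_le_right unitInterval.le_one', split_apply e r w])

theorem cofibContraction_inr (k : ℕ) (y : (E'.level k).carrier) (v : I) :
    cofibContraction e r w k (Quot.mk _ (Sum.inr y), v) =
      cofibInl (e.app k) ((r.app k).map y) v := rfl

theorem cofibContraction_inl (k : ℕ) (x : (E.level k).carrier) (s v : I) :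
    cofibContraction e r w k (Quot.mk _ (Sum.inl (x, s)), v) =
      cofibInl (e.app k) x (s ⊓ v) := rfl

/-- The endomorphism of the homotopy cofiber of a split inclusion induced by the retraction. -/
def cofibRetract (k : ℕ) : BasedMap ((cofib e).level k) ((cofib e).level k) where
  map := ⟨fun p => cofibContraction e r w k (p, 1),
    (cofibContraction e r w k).continuous.comp (continuous_id.prodMk continuous_const)⟩
  map_pt := by
    change cofibInl _ ((r.app k).map (E'.level k).pt) 1 = _
    rw [(r.app k).map_pt]
    exact cofibInl_pt _ _

theorem cofibRetract_homotopic (k : ℕ) :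
    (cofibRetract e r w k).Homotopic (BasedMap.const _ _) := by
  refine ⟨⟨fun p => cofibContraction e r w k (p.1, σ p.2),
    (cofibContraction e r w k).continuous.comp
      (continuous_fst.prodMk (unitInterval.continuous_symm.comp continuous_snd))⟩,
    fun p => ?_, fun p => ?_,
    fun v => ?_⟩
  · change cofibContraction e r w k (p, σ 0) = _
    rw [unitInterval.symm_zero]
    rfl
  · change cofibContraction e r w k (p, σ 1) = (hcofib (e.app k)).pt
    rw [unitInterval.symm_one]
    obtain ⟨⟨x, s⟩ | y⟩ := p
    · rw [cofibContraction_inl, inf_of_le_right unitInterval.nonneg', cofibInl_zero]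
    · rw [cofibContraction_inr, cofibInl_zero]
  · change cofibInl _ ((r.app k).map (E'.level k).pt) _ = _
    rw [(r.app k).map_pt]
    exact cofibInl_pt _ _

theorem precomp_cofibSection (k : ℕ) :
    SuspMap.precomp ((cofibInr e).app k) (cofibSection e r w k) = diffStr (r ≫ e) k := rfl

/-- After `r`, the section is an out-and-back loop of the structure map of `E`, capped by the height
on the cone. Lowering a further cap to `0` contracts it. -/
theorem cofibSection_retraction (k : ℕ) :
    ((cofibSection e r w k).postcomp (r.app (k + 1))).Homotopic (SuspMap.const _ _) := by
  let L : C(CofibSpace (e.app k) × (I × I), (E.level (k + 1)).carrier) :=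
    cofibDesc (e.app k)
      ⟨fun p => E.str k (p.1.1, tent p.2.1 ⊓ p.1.2 ⊓ σ p.2.2), by fun_prop⟩
      ⟨fun p => E.str k ((r.app k).map p.1, tent p.2.1 ⊓ σ p.2.2), by fun_prop⟩
      (fun x c => by
        change E.str k (x, tent c.1 ⊓ 0 ⊓ σ c.2) = E.str k ((r.app k).map _, _)
        rw [(r.app k).map_pt, E.str_pt, inf_of_le_right unitInterval.nonneg',
          inf_of_le_left unitInterval.nonneg', E.str_zero])
      (fun s c => by
        change E.str k _ = E.str k ((r.app k).map _, _)
        rw [(r.app k).map_pt, E.str_pt, E.str_pt])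
      (fun x c => by
        change E.str k (x, tent c.1 ⊓ 1 ⊓ σ c.2) = E.str k ((r.app k).map ((e.app k).map x), _)
        rw [split_apply e r w, inf_of_le_left (a := tent c.1) unitInterval.le_one'])
  refine ⟨⟨fun p => L (p.1.1, (p.1.2, p.2)), by fun_prop⟩, ?_, ?_, ?_, ?_, ?_⟩
  · rintro ⟨⟨⟨x, s⟩ | y⟩, t⟩
    · change E.str k (x, tent t ⊓ s ⊓ σ 0) = (r.app (k + 1)).map ((e.app (k + 1)).map _)
      rw [split_apply e r w, unitInterval.symm_zero, inf_of_le_left unitInterval.le_one']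
    · change E.str k ((r.app k).map y, tent t ⊓ σ 0) = _
      rw [unitInterval.symm_zero, inf_of_le_left unitInterval.le_one']
      exact (retraction_diffStr e r w k y t).symm
  · rintro ⟨⟨⟨x, s⟩ | y⟩, t⟩
    · change E.str k (x, tent t ⊓ s ⊓ σ 1) = _
      rw [unitInterval.symm_one, inf_of_le_right unitInterval.nonneg', E.str_zero]
      rfl
    · change E.str k ((r.app k).map y, tent t ⊓ σ 1) = _
      rw [unitInterval.symm_one, inf_of_le_right unitInterval.nonneg', E.str_zero]
      rfl
  · rintro ⟨⟨x, s⟩ | y⟩ v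
    · change E.str k (x, tent 0 ⊓ s ⊓ σ v) = _
      rw [tent_zero, inf_assoc, inf_of_le_left unitInterval.nonneg', E.str_zero]
    · change E.str k ((r.app k).map y, tent 0 ⊓ σ v) = _
      rw [tent_zero, inf_of_le_left unitInterval.nonneg', E.str_zero]
  · rintro ⟨⟨x, s⟩ | y⟩ v
    · change E.str k (x, tent 1 ⊓ s ⊓ σ v) = _
      rw [tent_one, inf_assoc, inf_of_le_left unitInterval.nonneg', E.str_zero]
    · change E.str k ((r.app k).map y, tent 1 ⊓ σ v) = _
      rw [tent_one, inf_of_le_left unitInterval.nonneg', E.str_zero]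
  · intro t v
    change E.str k ((r.app k).map (E'.level k).pt, _) = _
    rw [(r.app k).map_pt, E.str_pt]

/-- The left side is the structure map of the cofiber minus its composite with the null-homotopic
`cofibRetract`, so on homotopy groups it is stabilization. Thus the section is a right inverse of
`E' → cofib e` up to one stabilization. -/
theorem cofibSection_homotopic (k : ℕ) :
    (SuspMap.diff ((cofib e).strMap k)
      (SuspMap.precomp (cofibRetract e r w k) ((cofib e).strMap k))).Homotopic
    ((cofibSection e r w k).postcomp ((cofibInr e).app (k + 1))) := by
  let ι := (cofibInr e).app (k + 1)
  let D := diffStr (r ≫ e) k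
  let L : C(CofibSpace (e.app k) × (I × I), CofibSpace (e.app (k + 1))) :=
    cofibDesc (e.app k)
      -- On the cone, the first half of the homotopy lowers the cap on `tent` from `1` to the height
      -- `s`, and the second half raises the height from `s` to `1`. The two moves must be
      -- consecutive: at `s = 0` either the height or the cap is then `0` at every moment, so the
      -- base point is preserved.
      ⟨fun p => cofibInl (e.app (k + 1))
        (E.str k (p.1.1, tent p.2.1 ⊓ (p.1.2 ⊔ σ (dblLeft p.2.2)))) (p.1.2 ⊔ dblRight p.2.2),
        by fun_prop⟩
      ⟨fun p => ι.map (D.map (p.1, p.2.1)),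
        ι.map.continuous.comp (D.map.continuous.comp (by fun_prop))⟩
      (fun x c => by
        change cofibInl _ (E.str k (x, tent c.1 ⊓ (0 ⊔ σ (dblLeft c.2)))) (0 ⊔ dblRight c.2) =
          ι.map (D.map (_, _))
        rw [D.map_pt, ι.map_pt, sup_of_le_right unitInterval.nonneg',
          sup_of_le_right unitInterval.nonneg']
        rcases le_total (c.2 : ℝ) (1 / 2) with h | h
        · rw [dblRight_of_le h]
          exact cofibInl_zero _ _
        · rw [dblLeft_of_ge h, unitInterval.symm_one, inf_of_le_right unitInterval.nonneg',
            E.str_zero]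
          exact cofibInl_pt _ _)
      (fun s c => by
        change cofibInl _ (E.str k (_, _)) _ = ι.map (D.map (_, _))
        rw [D.map_pt, ι.map_pt, E.str_pt]
        exact cofibInl_pt _ _)
      (fun x c => by
        change cofibInl _ (E.str k (x, tent c.1 ⊓ (1 ⊔ _))) (1 ⊔ _) =
          ι.map (D.map ((e.app k).map x, c.1))
        rw [sup_of_le_left unitInterval.le_one', sup_of_le_left unitInterval.le_one',
          inf_of_le_left unitInterval.le_one', cofibInl_one, diffStr_section e r w]
        rfl)
  refine ⟨⟨fun p => L (p.1.1, (p.1.2, p.2)), L.continuous.comp (by fun_prop)⟩, ?_, ?_, ?_, ?_, ?_⟩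
  · rintro ⟨⟨⟨x, s⟩ | y⟩, t⟩
    · refine Eq.trans ?_ (SuspMap.diff_apply_of_eq _ _ _ (fun t => ?_) t).symm
      · change cofibInl _ (E.str k (x, tent t ⊓ (s ⊔ σ (dblLeft 0)))) (s ⊔ dblRight 0) =
          cofibInl _ (E.str k (x, tent t)) s
        rw [dblLeft_zero, dblRight_zero, unitInterval.symm_zero,
          sup_of_le_right unitInterval.le_one', sup_of_le_left unitInterval.nonneg',
          inf_of_le_left unitInterval.le_one']
      · change cofibInl _ _ _ = (cofib e).str k (cofibInl _ _ _, t)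
        rw [inf_of_le_left unitInterval.le_one']
        rfl
    · change ι.map (D.map (y, t)) = _
      rcases le_total (t : ℝ) (1 / 2) with ht | ht
      · refine (congrArg ι.map (SuspMap.diff_apply_of_le _ _ _ ht)).trans
          (Eq.trans ?_ (SuspMap.diff_apply_of_le ((cofib e).strMap k) _ _ ht).symm)
        rfl
      · refine (congrArg ι.map (SuspMap.diff_apply_of_ge _ _ _ ht)).trans
          (Eq.trans ?_ (SuspMap.diff_apply_of_ge ((cofib e).strMap k) _ _ ht).symm)
        change _ = (cofib e).str k (cofibInl _ ((r.app k).map y) 1, tent t)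
        rw [cofibInl_one]
        rfl
  · rintro ⟨⟨⟨x, s⟩ | y⟩, t⟩
    · change cofibInl _ (E.str k (x, tent t ⊓ (s ⊔ σ (dblLeft 1)))) (s ⊔ dblRight 1) = _
      rw [dblLeft_one, dblRight_one, unitInterval.symm_one,
        sup_of_le_left unitInterval.nonneg', sup_of_le_right unitInterval.le_one', cofibInl_one]
      rfl
    · rfl
  · rintro ⟨⟨x, s⟩ | y⟩ v
    · change cofibInl _ (E.str k (x, tent 0 ⊓ _)) _ = _
      rw [tent_zero, inf_of_le_left unitInterval.nonneg', E.str_zero]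
      exact cofibInl_pt _ _
    · change ι.map (D.map (y, 0)) = _
      rw [D.map_zero, ι.map_pt]
  · rintro ⟨⟨x, s⟩ | y⟩ v
    · change cofibInl _ (E.str k (x, tent 1 ⊓ _)) _ = _
      rw [tent_one, inf_of_le_left unitInterval.nonneg', E.str_zero]
      exact cofibInl_pt _ _
    · change ι.map (D.map (y, 1)) = _
      rw [D.map_one, ι.map_pt]
  · intro t v
    change ι.map (D.map (_, t)) = _
    rw [D.map_pt, ι.map_pt]

/-! ### Homotopy groups of the cofiber of a split inclusion. -/

namespace ColimPi

variable {a b : ℕ}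

/-- The map of homotopy groups induced by the stable section. -/
noncomputable def sectionStage {j : ℕ} (z : Stage (cofib e) a b j) : Stage E' a b (j + 1) :=
  (cofibSection e r w (b + j)).pi (a + j) z

theorem sectionStage_inr {j : ℕ} (y : Stage E' a b j) :
    sectionStage e r w (stageMap (cofibInr e) y) =
      (step (stageMap (r ≫ e) y))⁻¹ * step y := by
  refine (SuspMap.pi_precomp ((cofibInr e).app (b + j)) (cofibSection e r w (b + j))
    (a + j) y).symm.trans ?_
  rw [precomp_cofibSection]
  exact pi_diffStr (r ≫ e) (b + j) (a + j) y

/-- By `cofibSection_homotopic` the left side is `step z` corrected by the effect of `cofibRetract`,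
which is trivial because that map is null-homotopic. -/
theorem inr_sectionStage {j : ℕ} (z : Stage (cofib e) a b j) :
    stageMap (cofibInr e) (sectionStage e r w z) = step z := by
  refine (SuspMap.pi_postcomp (cofibSection e r w (b + j)) ((cofibInr e).app (b + j + 1))
    (a + j) z).symm.trans ?_
  refine ((cofibSection_homotopic e r w (b + j)).pi_eq (a + j) z).symm.trans ?_
  rw [SuspMap.pi_diff, SuspMap.pi_precomp, (cofibRetract_homotopic e r w (b + j)).mapPi_eq,
    BasedMap.mapPi_const, SuspMap.pi_const, inv_one, one_mul]
  rfl

theorem retraction_sectionStage {j : ℕ} (z : Stage (cofib e) a b j) :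
    stageMap r (sectionStage e r w z) = 1 := by
  refine (SuspMap.pi_postcomp (cofibSection e r w (b + j)) (r.app (b + j + 1))
    (a + j) z).symm.trans ?_
  rw [(cofibSection_retraction e r w (b + j)).pi_eq]
  exact SuspMap.pi_const_map _ _

theorem map_comp_cofibInr (x : ColimPi a b E) : map (e ≫ cofibInr e) x = 0 := by
  obtain ⟨N, hN⟩ := exists_rep x
  obtain ⟨x, rfl⟩ := hN N le_rfl
  rw [map_mk, ← mk_stageOne (j := N)]
  refine congrArg (mk N) ?_
  exact ((cofib_null e (b + N)).mapPi_eq _ _).trans (BasedMap.mapPi_const _ _)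

end ColimPi

end Prespectrum

end CrossEffects

namespace CrossEffects

open scoped unitInterval

/-! ### The homotopy fiber of a split projection -/

namespace Prespectrum

variable {E E' : Prespectrum.{u}} (r : E' ⟶ E)

/-- The projection of the homotopy fiber to the source. -/
def fibPoint (k : ℕ) : C(((fib r).level k).carrier, (E'.level k).carrier) := ((fibFst r).app k).map

/-- The evaluation of the path component of a point of the homotopy fiber. -/
def fibPath (k : ℕ) : C(((fib r).level k).carrier × I, (E.level k).carrier) :=
  ⟨fun q => q.1.out.1.2 q.2, continuous_eval.comp (((continuous_snd.comp
    ((continuous_fibPre_val _).comp Kify.continuous_out)).comp continuous_fst).prodMk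
      continuous_snd)⟩

theorem fibPath_zero (k : ℕ) (p : ((fib r).level k).carrier) :
    fibPath r k (p, 0) = (E.level k).pt := p.out.2.1

theorem fibPath_one (k : ℕ) (p : ((fib r).level k).carrier) :
    fibPath r k (p, 1) = (r.app k).map (fibPoint r k p) := p.out.2.2

theorem fib_ext {k : ℕ} {p q : ((fib r).level k).carrier} (h : fibPoint r k p = fibPoint r k q)
    (h' : ∀ s, fibPath r k (p, s) = fibPath r k (q, s)) : p = q :=
  congrArg Kify.mk (Subtype.ext (Prod.ext h (ContinuousMap.ext h')))

theorem fibPath_pt (k : ℕ) (s : I) : fibPath r k (((fib r).level k).pt, s) = (E.level k).pt := rfl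

/-- The map to the homotopy fiber given by a map and a family of paths. -/
def fibLift {Z : Type u} [TopologicalSpace Z] [CompactlyGeneratedSpace Z] (k : ℕ)
    (g : C(Z, (E'.level k).carrier)) (p : C(Z × I, (E.level k).carrier))
    (h0 : ∀ z, p (z, 0) = (E.level k).pt) (h1 : ∀ z, p (z, 1) = (r.app k).map (g z)) :
    C(Z, ((fib r).level k).carrier) where
  toFun z := ⟨⟨(g z, ⟨fun s => p (z, s), by fun_prop⟩), h0 z, h1 z⟩⟩
  continuous_toFun := Kify.continuous_mk_of_cg (Continuous.subtype_mk
    (g.continuous.prodMk (Prespectrum.continuous_path _ p.continuous)) _)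

theorem fib_null (k : ℕ) :
    ((fibFst r ≫ r).app k).Homotopic (BasedMap.const ((fib r).level k) (E.level k)) := by
  refine ⟨⟨fun p => fibPath r k (p.1, σ p.2), (fibPath r k).continuous.comp
    (continuous_fst.prodMk (unitInterval.continuous_symm.comp continuous_snd))⟩, fun x => ?_,
    fun x => ?_, fun v => rfl⟩
  · change fibPath r k (x, σ 0) = _
    rw [unitInterval.symm_zero]
    exact fibPath_one r k x
  · change fibPath r k (x, σ 1) = _
    rw [unitInterval.symm_one]
    exact fibPath_zero r k x

variable (e : E ⟶ E') (w : e ≫ r = 𝟙 E)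

/-- The stable retraction of `fib r → E'` for a split projection `r`. -/
noncomputable def fibRetraction (k : ℕ) : SuspMap (E'.level k) ((fib r).level (k + 1)) where
  map := fibLift r (k + 1) (diffStr (r ≫ e) k).map
    -- By `retraction_diffStr` the point component maps to an out-and-back loop in `E`; raising the
    -- cap on `tent` from `0` to `1` is the path from the base point that a point of the fiber
    -- requires.
    ⟨fun p => E.str k ((r.app k).map p.1.1, tent p.1.2 ⊓ p.2), by fun_prop⟩
    (fun z => by
      change E.str k ((r.app k).map z.1, tent z.2 ⊓ 0) = _
      rw [inf_of_le_right unitInterval.nonneg', E.str_zero])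
    (fun z => by
      change E.str k ((r.app k).map z.1, tent z.2 ⊓ 1) = _
      rw [inf_of_le_left unitInterval.le_one']
      exact (retraction_diffStr e r w k z.1 z.2).symm)
  map_zero x := fib_ext _ ((diffStr (r ≫ e) k).map_zero x) fun s => by
    change E.str k ((r.app k).map x, tent 0 ⊓ s) = _
    rw [tent_zero, inf_of_le_left unitInterval.nonneg', E.str_zero]
    rfl
  map_one x := fib_ext _ ((diffStr (r ≫ e) k).map_one x) fun s => by
    change E.str k ((r.app k).map x, tent 1 ⊓ s) = _
    rw [tent_one, inf_of_le_left unitInterval.nonneg', E.str_zero]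
    rfl
  map_pt t := fib_ext _ ((diffStr (r ≫ e) k).map_pt t) fun s => by
    change E.str k ((r.app k).map _, tent t ⊓ s) = _
    rw [(r.app k).map_pt, E.str_pt]
    rfl

theorem postcomp_fibRetraction (k : ℕ) :
    (fibRetraction r e w k).postcomp ((fibFst r).app (k + 1)) = diffStr (r ≫ e) k := rfl

/-- The null-homotopy of the endomorphism of the homotopy fiber induced by the section. -/
def fibContraction (k : ℕ) :
    C(((fib r).level k).carrier × I, ((fib r).level k).carrier) :=
  fibLift r k
    -- At time `v` the path `γ` of a fiber point is stopped at `v` and the point becomes `e (γ v)`,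
    -- which lies over the new end point. At `v = 1` only the point component has changed, to its
    -- image under `r ≫ e`.
    ⟨fun p => (e.app k).map (fibPath r k p),
      (e.app k).map.continuous.comp (fibPath r k).continuous⟩
    ⟨fun p => fibPath r k (p.1.1, p.2 ⊓ p.1.2),
      (fibPath r k).continuous.comp (by fun_prop)⟩
    (fun p => by
      change fibPath r k (p.1, 0 ⊓ p.2) = _
      rw [inf_of_le_left unitInterval.nonneg', fibPath_zero])
    (fun p => by
      change fibPath r k (p.1, 1 ⊓ p.2) = (r.app k).map ((e.app k).map _)
      rw [inf_of_le_right unitInterval.le_one', split_apply e r w])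

theorem fibContraction_pt (k : ℕ) (v : I) :
    fibContraction r e w k (((fib r).level k).pt, v) = ((fib r).level k).pt :=
  fib_ext _ (e.app k).map_pt fun _ => rfl

/-- The endomorphism of the homotopy fiber of a split projection induced by the section. -/
def fibSection (k : ℕ) : BasedMap ((fib r).level k) ((fib r).level k) where
  map := ⟨fun p => fibContraction r e w k (p, 1),
    (fibContraction r e w k).continuous.comp (continuous_id.prodMk continuous_const)⟩
  map_pt := fibContraction_pt r e w k 1

theorem fibSection_homotopic (k : ℕ) :
    (fibSection r e w k).Homotopic (BasedMap.const _ _) := by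
  refine ⟨⟨fun p => fibContraction r e w k (p.1, σ p.2),
    (fibContraction r e w k).continuous.comp
      (continuous_fst.prodMk (unitInterval.continuous_symm.comp continuous_snd))⟩, fun p => ?_,
      fun p => ?_, fun v => fibContraction_pt r e w k _⟩
  · change fibContraction r e w k (p, σ 0) = _
    rw [unitInterval.symm_zero]
    rfl
  · change fibContraction r e w k (p, σ 1) = ((fib r).level k).pt
    rw [unitInterval.symm_one]
    refine fib_ext _ ?_ fun s => ?_
    · change (e.app k).map (fibPath r k (p, 0)) = (E'.level k).pt
      rw [fibPath_zero, (e.app k).map_pt]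
    · change fibPath r k (p, s ⊓ 0) = (E.level k).pt
      rw [inf_of_le_right unitInterval.nonneg', fibPath_zero]

/-- Dual to `cofibSection_homotopic`: the left side induces stabilization because `fibSection` is
null-homotopic, so the retraction is a left inverse of `fib r → E'` up to one stabilization. -/
theorem fibRetraction_homotopic (k : ℕ) :
    (SuspMap.diff ((fib r).strMap k)
      (SuspMap.precomp (fibSection r e w k) ((fib r).strMap k))).Homotopic
    (SuspMap.precomp ((fibFst r).app k) (fibRetraction r e w k)) := by
  let D := diffStr (r ≫ e) k
  let L : C((((fib r).level k).carrier × I) × I, ((fib r).level (k + 1)).carrier) :=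
    fibLift r (k + 1)
      ⟨fun p => D.map (fibPoint r k p.1.1, p.1.2),
        D.map.continuous.comp (((fibPoint r k).continuous.comp
          (continuous_fst.comp continuous_fst)).prodMk (continuous_snd.comp continuous_fst))⟩
      -- The point component stays fixed and only the path moves. First the cap on `tent` descends
      -- from `1` to the path parameter `s`, then the argument of the old path rises from `s` to
      -- `1`; in this order the path starts at the base point at every moment.
      ⟨fun p => E.str k (fibPath r k (p.1.1.1, p.2 ⊔ dblRight p.1.2),
          tent p.1.1.2 ⊓ (p.2 ⊔ σ (dblLeft p.1.2))),
        (E.str k).continuous.comp (((fibPath r k).continuous.comp (by fun_prop)).prodMk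
          (by fun_prop))⟩
      (fun p => by
        change E.str k (fibPath r k (p.1.1, 0 ⊔ dblRight p.2),
          tent p.1.2 ⊓ (0 ⊔ σ (dblLeft p.2))) = _
        rw [sup_of_le_right unitInterval.nonneg', sup_of_le_right unitInterval.nonneg']
        rcases le_total (p.2 : ℝ) (1 / 2) with h | h
        · rw [dblRight_of_le h, fibPath_zero, E.str_pt]
        · rw [dblLeft_of_ge h, unitInterval.symm_one, inf_of_le_right unitInterval.nonneg',
            E.str_zero])
      (fun p => by
        change E.str k (fibPath r k (p.1.1, 1 ⊔ _), tent p.1.2 ⊓ (1 ⊔ _)) = _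
        rw [sup_of_le_left unitInterval.le_one', sup_of_le_left unitInterval.le_one',
          inf_of_le_left unitInterval.le_one', fibPath_one]
        exact (retraction_diffStr e r w k _ _).symm)
  refine ⟨L, ?_, ?_, ?_, ?_, ?_⟩
  · rintro ⟨p, t⟩
    have h2 : ∀ s : I, E.str k (fibPath r k (p, s ⊔ dblRight 0),
        tent t ⊓ (s ⊔ σ (dblLeft 0))) = E.str k (fibPath r k (p, s), tent t) := by
      intro s
      rw [dblLeft_zero, dblRight_zero, unitInterval.symm_zero,
        sup_of_le_right unitInterval.le_one', sup_of_le_left unitInterval.nonneg',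
        inf_of_le_left unitInterval.le_one']
    rcases le_total (t : ℝ) (1 / 2) with ht | ht
    · refine Eq.trans ?_ (SuspMap.diff_apply_of_le ((fib r).strMap k) _ _ ht).symm
      exact fib_ext _ (SuspMap.diff_apply_of_le (E'.strMap k) _ _ ht) h2
    · refine Eq.trans ?_ (SuspMap.diff_apply_of_ge ((fib r).strMap k) _ _ ht).symm
      refine fib_ext _ ((SuspMap.diff_apply_of_ge (E'.strMap k) _ _ ht).trans ?_) fun s =>
        (h2 s).trans ?_
      · change E'.str k ((e.app k).map ((r.app k).map (fibPoint r k p)), tent t) =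
          E'.str k ((e.app k).map (fibPath r k (p, 1)), tent t)
        rw [fibPath_one]
      · change _ = E.str k (fibPath r k (p, s ⊓ 1), tent t)
        rw [inf_of_le_left unitInterval.le_one']
  · rintro ⟨p, t⟩
    refine fib_ext _ rfl fun s => ?_
    change E.str k (fibPath r k (p, s ⊔ dblRight 1), tent t ⊓ (s ⊔ σ (dblLeft 1))) =
      E.str k ((r.app k).map (fibPoint r k p), tent t ⊓ s)
    rw [dblLeft_one, dblRight_one, unitInterval.symm_one,
      sup_of_le_left unitInterval.nonneg', sup_of_le_right unitInterval.le_one', fibPath_one]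
  · intro p v
    refine fib_ext _ (D.map_zero _) fun s => ?_
    change E.str k (fibPath r k _, tent 0 ⊓ _) = (E.level (k + 1)).pt
    rw [tent_zero, inf_of_le_left unitInterval.nonneg', E.str_zero]
  · intro p v
    refine fib_ext _ (D.map_one _) fun s => ?_
    change E.str k (fibPath r k _, tent 1 ⊓ _) = (E.level (k + 1)).pt
    rw [tent_one, inf_of_le_left unitInterval.nonneg', E.str_zero]
  · intro t v
    refine fib_ext _ (D.map_pt _) fun s => ?_
    change E.str k (fibPath r k (((fib r).level k).pt, _), _) = (E.level (k + 1)).pt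
    rw [fibPath_pt, E.str_pt]

/-! ### Homotopy groups of the fiber of a split projection. -/

namespace ColimPi

variable {a b : ℕ}

/-- The map of homotopy groups induced by the stable retraction. -/
noncomputable def retractionStage {j : ℕ} (y : Stage E' a b j) : Stage (fib r) a b (j + 1) :=
  (fibRetraction r e w (b + j)).pi (a + j) y

theorem fst_retractionStage {j : ℕ} (y : Stage E' a b j) :
    stageMap (fibFst r) (retractionStage r e w y) =
      (step (stageMap (r ≫ e) y))⁻¹ * step y := by
  refine (SuspMap.pi_postcomp (fibRetraction r e w (b + j)) ((fibFst r).app (b + j + 1))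
    (a + j) y).symm.trans ?_
  rw [postcomp_fibRetraction]
  exact pi_diffStr (r ≫ e) (b + j) (a + j) y

theorem retractionStage_fst {j : ℕ} (z : Stage (fib r) a b j) :
    retractionStage r e w (stageMap (fibFst r) z) = step z := by
  refine (SuspMap.pi_precomp ((fibFst r).app (b + j)) (fibRetraction r e w (b + j))
    (a + j) z).symm.trans ?_
  refine ((fibRetraction_homotopic r e w (b + j)).pi_eq (a + j) z).symm.trans ?_
  rw [SuspMap.pi_diff, SuspMap.pi_precomp, (fibSection_homotopic r e w (b + j)).mapPi_eq,
    BasedMap.mapPi_const, SuspMap.pi_const, inv_one, one_mul]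
  rfl

theorem map_fibFst_comp (x : ColimPi a b (fib r)) : map (fibFst r ≫ r) x = 0 := by
  obtain ⟨N, hN⟩ := exists_rep x
  obtain ⟨x, rfl⟩ := hN N le_rfl
  rw [map_mk, ← mk_stageOne (j := N)]
  refine congrArg (mk N) ?_
  exact ((fib_null r (b + N)).mapPi_eq _ _).trans (BasedMap.mapPi_const _ _)

/-! ### Exactness for split maps -/

include e w

/-- At each stage `retractionStage` undoes the projection up to `step`, which is invisible in the
colimit. -/
theorem map_fibFst_injective : Function.Injective (map (a := a) (b := b) (fibFst r)) := by
  intro x y h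
  obtain ⟨N, hN⟩ := exists_rep x
  obtain ⟨M, hM⟩ := exists_rep y
  obtain ⟨x, rfl⟩ := hN (N + M) (by omega)
  obtain ⟨y, rfl⟩ := hM (N + M) (by omega)
  rw [map_mk, map_mk, mk_eq_mk_iff] at h
  obtain ⟨k, hk, h⟩ := h
  rw [← stageMap_raise, ← stageMap_raise] at h
  have h' := congrArg (retractionStage r e w) h
  rw [retractionStage_fst, retractionStage_fst] at h'
  rw [← mk_raise hk, ← mk_raise hk y, ← mk_step, ← mk_step (raise hk y), h']

/-- Projecting `retractionStage` back to `E'` gives `step y` minus the step of the image of `y`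
under `r ≫ e`, and the latter is trivial at a late stage. -/
theorem exists_map_fibFst (y : ColimPi a b E') (hy : map r y = 0) :
    ∃ z, map (fibFst r) z = y := by
  obtain ⟨N, hN⟩ := exists_rep y
  obtain ⟨y, rfl⟩ := hN N le_rfl
  rw [map_mk, ← mk_stageOne (j := N), mk_eq_mk_iff] at hy
  obtain ⟨k, hk, h⟩ := hy
  refine ⟨mk _ (retractionStage r e w (raise hk y)), ?_⟩
  have h1 : step (stageMap (r ≫ e) (raise hk y)) = 1 := by
    rw [stageMap_comp, stageMap_raise, h, raise_one, stageMap_one, step_one]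
    rfl
  rw [map_mk, fst_retractionStage, h1, inv_one, one_mul, mk_step, mk_raise]

end ColimPi

end Prespectrum

end CrossEffects

namespace CrossEffects

open scoped unitInterval

namespace Prespectrum

namespace ColimPi

variable {a b : ℕ}

/-! ### The composite from the fiber of a projection to the cofiber of an inclusion -/

section Split

variable {E E' D D' : Prespectrum.{u}} {e : E ⟶ E'} {r : E' ⟶ E} {e' : D ⟶ D'} {r' : D' ⟶ D}

theorem exists_map_cofibInr (w : e ≫ r = 𝟙 E) (z : ColimPi a b (cofib e)) :
    ∃ y, map r y = 0 ∧ map (cofibInr e) y = z := by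
  obtain ⟨N, hN⟩ := exists_rep z
  obtain ⟨z, rfl⟩ := hN N le_rfl
  refine ⟨mk _ (sectionStage e r w z), ?_, ?_⟩
  · rw [map_mk, retraction_sectionStage, mk_one]
  · rw [map_mk, inr_sectionStage, mk_step]

/-- On classes killed by `r` the correction term in `sectionStage_inr` disappears at late stages, so
the section undoes `E' → cofib e` up to `step`. -/
theorem map_cofibInr_injOn (w : e ≫ r = 𝟙 E) {y y' : ColimPi a b E'} (hy : map r y = 0)
    (hy' : map r y' = 0) (h : map (cofibInr e) y = map (cofibInr e) y') : y = y' := by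
  obtain ⟨N, hN⟩ := exists_rep y
  obtain ⟨M, hM⟩ := exists_rep y'
  obtain ⟨y, rfl⟩ := hN (N + M) (by omega)
  obtain ⟨y', rfl⟩ := hM (N + M) (by omega)
  have key : ∀ y : Stage E' a b (N + M), map r (mk (N + M) y) = 0 → ∃ k, ∀ l, k ≤ l →
      ∀ hl : N + M ≤ l, step (stageMap (r ≫ e) (raise hl y)) = 1 := by
    intro y hy
    rw [map_mk, ← mk_stageOne (j := N + M), mk_eq_mk_iff] at hy
    obtain ⟨k, hk, h⟩ := hy
    refine ⟨k, fun l hkl hl => ?_⟩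
    rw [← raise_trans hk hkl, stageMap_comp, stageMap_raise r hkl, stageMap_raise r hk, h,
      raise_one, raise_one, stageMap_one, step_one]
    rfl
  obtain ⟨k, hk⟩ := key y hy
  obtain ⟨k', hk'⟩ := key y' hy'
  rw [map_mk, map_mk, mk_eq_mk_iff] at h
  obtain ⟨l, hl, h⟩ := h
  have hl' : N + M ≤ k + k' + l := by omega
  have h' : stageMap (cofibInr e) (raise hl' y) = stageMap (cofibInr e) (raise hl' y') := by
    rw [stageMap_raise, stageMap_raise, ← raise_trans hl (by omega), h, raise_trans]
  have h'' := congrArg (sectionStage e r w) h'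
  rw [sectionStage_inr, sectionStage_inr, hk _ (by omega), hk' _ (by omega), inv_one, one_mul,
    one_mul] at h''
  rw [← mk_raise hl', ← mk_raise hl' y', ← mk_step, h'', mk_step]

/-- The fiber of `r` sees the kernel of `r` and the cofiber of `e'` sees the kernel of `r'`. The
square makes `φ` map the first kernel to the second; injectivity of `φ₀` puts preimages back into
the first. The sections `e` and `e'` need not correspond under `φ`. -/
theorem map_fib_to_cofib_bijective (w : e ≫ r = 𝟙 E) (w' : e' ≫ r' = 𝟙 D) {φ₀ : E ⟶ D}
    {φ : E' ⟶ D'} (h : r ≫ φ₀ = φ ≫ r') (hφ₀ : Function.Bijective (map (a := a) (b := b) φ₀))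
    (hφ : Function.Bijective (map (a := a) (b := b) φ)) :
    Function.Bijective (map (a := a) (b := b) (fibFst r ≫ φ ≫ cofibInr e')) := by
  have hr : ∀ y, map (a := a) (b := b) φ₀ (map r y) = map r' (map φ y) := fun y => by
    rw [← map_comp, h, map_comp]
  have hr0 : ∀ x, map (a := a) (b := b) r' (map φ (map (fibFst r) x)) = 0 := fun x => by
    rw [← hr, ← map_comp (fibFst r) r, map_fibFst_comp, map_zero]
  constructor
  · intro x y hxy
    rw [map_comp, map_comp, map_comp, map_comp] at hxy
    exact map_fibFst_injective r e w
      (hφ.1 (map_cofibInr_injOn w' (hr0 x) (hr0 y) hxy))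
  · intro z
    obtain ⟨y', hy', rfl⟩ := exists_map_cofibInr w' z
    obtain ⟨y, rfl⟩ := hφ.2 y'
    rw [← hr, ← map_zero φ₀] at hy'
    obtain ⟨x, rfl⟩ := exists_map_fibFst r e w y (hφ₀.1 hy')
    exact ⟨x, by rw [map_comp, map_comp]⟩

end Split

/-! ### Products -/

section Product

variable {J : Type} [Finite J] {E : J → Prespectrum.{u}}

/-- Cubes live in `Type`, whereas the test spaces of `Kify` live in universe `u`; `ULift` bridges
the two. -/
theorem continuous_kify_mk {Z : Type} [TopologicalSpace Z] [CompactSpace Z] [T2Space Z]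
    {X : Type u} [TopologicalSpace X] {f : Z → X} (hf : Continuous f) :
    Continuous fun z => (⟨f z⟩ : Kify X) :=
  (Kify.continuous_mk_comp (f := fun z : ULift.{u} Z => f z.down)
    (hf.comp continuous_uliftDown)).comp continuous_uliftUp

theorem exists_forall_le {P : J → ℕ → Prop} (h : ∀ j, ∃ N, ∀ k, N ≤ k → P j k) :
    ∃ N, ∀ k, N ≤ k → ∀ j, P j k := by
  have := Fintype.ofFinite J
  choose N hN using h
  exact ⟨Finset.univ.sup N, fun k hk j =>
    hN j k ((Finset.le_sup (Finset.mem_univ j)).trans hk)⟩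

/-- Finiteness of `J` provides one stage at which all components agree; there the homotopies of the
components assemble into one homotopy in the product. -/
theorem product_ext {x y : ColimPi a b (product E)}
    (h : ∀ j, map (productProj j) x = map (productProj j) y) : x = y := by
  obtain ⟨N, hN⟩ := exists_rep x
  obtain ⟨M, hM⟩ := exists_rep y
  obtain ⟨x, rfl⟩ := hN (N + M) (by omega)
  obtain ⟨y, rfl⟩ := hM (N + M) (by omega)
  have h1 : ∀ j, ∃ k, ∀ l, k ≤ l → ∀ hl : N + M ≤ l,
      stageMap (productProj j) (raise hl x) = stageMap (productProj j) (raise hl y) := by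
    intro j
    obtain ⟨k, hk, hxy⟩ := (mk_eq_mk_iff _ _).1 (h j)
    refine ⟨k, fun l hl hl' => ?_⟩
    rw [stageMap_raise, stageMap_raise, ← raise_trans hk hl, hxy, raise_trans]
  obtain ⟨k, hk⟩ := exists_forall_le h1
  have hl : N + M ≤ N + M + k := by omega
  have h2 := fun j => hk (N + M + k) (by omega) j hl
  rw [← mk_raise hl, ← mk_raise hl y]
  refine congrArg (mk _) ?_
  generalize raise hl x = x' at h2
  generalize raise hl y = y' at h2
  induction x', y' using Quotient.inductionOn₂ with
  | h γ γ' =>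
    have h3 := fun j => (Quotient.exact (h2 j) : GenLoop.Homotopic _ _)
    have H := fun j => Classical.choice (h3 j)
    refine Quotient.sound ⟨⟨⟨⟨fun p => ⟨fun j => H j p⟩,
      continuous_kify_mk (continuous_pi fun j => (H j).continuous)⟩, fun t => ?_, fun t => ?_⟩,
      fun s t ht => ?_⟩⟩
    · exact congrArg Kify.mk (funext fun j => (H j).apply_zero t)
    · exact congrArg Kify.mk (funext fun j => (H j).apply_one t)
    · exact congrArg Kify.mk (funext fun j => (H j).eq_fst s ht)

theorem exists_product (x : ∀ j, ColimPi a b (E j)) :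
    ∃ z : ColimPi a b (product E), ∀ j, map (productProj j) z = x j := by
  obtain ⟨N, hN⟩ := exists_forall_le fun j => exists_rep (x j)
  choose y hy using hN N le_rfl
  choose γ hγ using fun j => Quotient.exists_rep (y j)
  let δ : GenLoop (Fin (a + N)) ((product E).level (b + N)).carrier
      ((product E).level (b + N)).pt :=
    ⟨⟨fun t => ⟨fun j => γ j t⟩, continuous_kify_mk (continuous_pi fun j => (γ j).1.continuous)⟩,
      fun t ht => congrArg Kify.mk (funext fun j => (γ j).2 t ht)⟩
  refine ⟨mk N (Quotient.mk _ δ), fun j => ?_⟩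
  rw [← hy j, ← hγ j]
  rfl

theorem bijective_productLift_iff {D : Prespectrum.{u}} (f : ∀ j, D ⟶ E j) :
    Function.Bijective (map (a := a) (b := b) (productLift f)) ↔
      Function.Bijective fun (x : ColimPi a b D) j => map (f j) x := by
  have h : ∀ (x : ColimPi a b D) j, map (productProj j) (map (productLift f) x) = map (f j) x :=
    fun x j => (map_comp _ _ x).symm
  constructor
  · rintro ⟨h1, h2⟩
    constructor
    · exact fun x y hxy => h1 (product_ext fun j => by rw [h, h]; exact congrFun hxy j)
    · intro y
      obtain ⟨z, hz⟩ := exists_product y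
      obtain ⟨x, rfl⟩ := h2 z
      exact ⟨x, funext fun j => by rw [← hz, h]⟩
  · rintro ⟨h1, h2⟩
    constructor
    · exact fun x y hxy => h1 (funext fun j => (h x j).symm.trans
        ((congrArg _ hxy).trans (h y j)))
    · intro z
      obtain ⟨x, hx⟩ := h2 fun j => map (productProj j) z
      exact ⟨x, product_ext fun j => (h x j).trans (congrFun hx j)⟩

theorem bijective_productMap {E' : J → Prespectrum.{u}} (f : ∀ j, E j ⟶ E' j)
    (hf : ∀ j, Function.Bijective (map (a := a) (b := b) (f j))) :
    Function.Bijective (map (a := a) (b := b) (productMap f)) := by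
  refine (bijective_productLift_iff _).2 ⟨fun x y hxy => product_ext fun j => (hf j).1 ?_,
    fun z => ?_⟩
  · rw [← map_comp, ← map_comp]
    exact congrFun hxy j
  · choose y hy using fun j => (hf j).2 (z j)
    obtain ⟨x, hx⟩ := exists_product y
    exact ⟨x, funext fun j => (map_comp _ _ x).trans (by rw [hx, hy])⟩

end Product

/-! ### Wedges -/

section Wedge

/-- The sum of two maps, at each point of which one of them is trivial. -/
theorem map_eq_add_of_disjoint {E E' : Prespectrum.{u}} (f g h : E ⟶ E')
    (hfg : ∀ k x, ((f.app k).map x = (E'.level k).pt ∧ (h.app k).map x = (g.app k).map x) ∨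
      ((g.app k).map x = (E'.level k).pt ∧ (h.app k).map x = (f.app k).map x))
    (x : ColimPi a b E) : map h x = map f x + map g x := by
  -- After one suspension `h` can be reparametrized pointwise. Where `f` is trivial, `h = g` is
  -- squeezed into the first half of the suspension coordinate; where `g` is trivial, `h = f` is
  -- squeezed into the second half. The result is the concatenation representing the sum.
  have key : ∀ k, (SuspMap.precomp (h.app k) (E'.strMap k)).Homotopic
      (SuspMap.concat (SuspMap.precomp (g.app k) (E'.strMap k))
        (SuspMap.precomp (f.app k) (E'.strMap k))) := by
    intro k
    classical
    let LA : ((E.level k).carrier × I) × I → (E'.level (k + 1)).carrier := fun p =>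
      E'.str k ((h.app k).map p.1.1, mix p.2 p.1.2 (dblRight p.1.2))
    let LB : ((E.level k).carrier × I) × I → (E'.level (k + 1)).carrier := fun p =>
      E'.str k ((h.app k).map p.1.1, mix p.2 p.1.2 (dblLeft p.1.2))
    let L : ((E.level k).carrier × I) × I → (E'.level (k + 1)).carrier := fun p =>
      if (f.app k).map p.1.1 = (E'.level k).pt then LB p else LA p
    have hLB : ∀ p : ((E.level k).carrier × I) × I,
        (f.app k).map p.1.1 = (E'.level k).pt → L p = LB p := fun p hp => if_pos hp
    have hLA : ∀ p : ((E.level k).carrier × I) × I,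
        (g.app k).map p.1.1 = (E'.level k).pt → L p = LA p := by
      intro p hp
      by_cases hp' : (f.app k).map p.1.1 = (E'.level k).pt
      · have hh : (h.app k).map p.1.1 = (E'.level k).pt := by
          rcases hfg k p.1.1 with h1 | h1 <;> rw [h1.2]
          · exact hp
          · exact hp'
        rw [hLB p hp']
        change E'.str k (_, _) = E'.str k (_, _)
        rw [hh, E'.str_pt, E'.str_pt]
      · exact if_neg hp'
    have hL : Continuous L := by
      rw [← continuousOn_univ]
      have hcover : (Set.univ : Set (((E.level k).carrier × I) × I)) =
          {p | (f.app k).map p.1.1 = (E'.level k).pt} ∪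
            {p | (g.app k).map p.1.1 = (E'.level k).pt} := by
        refine (Set.eq_univ_of_forall fun p => ?_).symm
        rcases hfg k p.1.1 with h1 | h1
        · exact Or.inl h1.1
        · exact Or.inr h1.1
      rw [hcover]
      -- The two loci cover everything and are closed, since points of a weak Hausdorff space are
      -- closed.
      refine ContinuousOn.union_of_isClosed ?_ ?_ ?_ ?_
      · exact Continuous.continuousOn (by fun_prop) |>.congr (f := LB) hLB
      · exact Continuous.continuousOn (by fun_prop) |>.congr (f := LA) hLA
      · exact (isClosed_pt _).preimage
          ((f.app k).map.continuous.comp (continuous_fst.comp continuous_fst))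
      · exact (isClosed_pt _).preimage
          ((g.app k).map.continuous.comp (continuous_fst.comp continuous_fst))
    have hval : ∀ p : ((E.level k).carrier × I) × I,
        (f.app k).map p.1.1 = (E'.level k).pt ∧ (h.app k).map p.1.1 = (g.app k).map p.1.1 ∧
          L p = E'.str k ((h.app k).map p.1.1, mix p.2 p.1.2 (dblLeft p.1.2)) ∨
        (g.app k).map p.1.1 = (E'.level k).pt ∧ (h.app k).map p.1.1 = (f.app k).map p.1.1 ∧
          L p = E'.str k ((h.app k).map p.1.1, mix p.2 p.1.2 (dblRight p.1.2)) := by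
      intro p
      rcases hfg k p.1.1 with h1 | h1
      · exact Or.inl ⟨h1.1, h1.2, hLB p h1.1⟩
      · exact Or.inr ⟨h1.1, h1.2, hLA p h1.1⟩
    refine ⟨⟨L, hL⟩, ?_, ?_, ?_, ?_, ?_⟩
    · intro p
      change L (p, 0) = E'.str k ((h.app k).map p.1, p.2)
      rcases hval (p, 0) with ⟨-, -, h1⟩ | ⟨-, -, h1⟩ <;> rw [h1, mix_zero]
    · rintro ⟨x, t⟩
      change L ((x, t), 1) = if (t : ℝ) ≤ 1 / 2 then E'.str k ((g.app k).map x, dblLeft t)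
        else E'.str k ((f.app k).map x, dblRight t)
      rcases hval ((x, t), 1) with ⟨h1, h2, h3⟩ | ⟨h1, h2, h3⟩ <;> rw [h3, mix_one, h2, h1] <;>
        split_ifs with ht
      · rfl
      · rw [dblLeft_of_ge (le_of_not_ge ht), E'.str_one, E'.str_pt]
      · rw [dblRight_of_le ht, E'.str_zero, E'.str_pt]
      · rfl
    · intro x v
      change L ((x, 0), v) = _
      rcases hval ((x, 0), v) with ⟨-, -, h1⟩ | ⟨-, -, h1⟩ <;> rw [h1] <;> simp [E'.str_zero]
    · intro x v
      change L ((x, 1), v) = _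
      rcases hval ((x, 1), v) with ⟨-, -, h1⟩ | ⟨-, -, h1⟩ <;> rw [h1] <;> simp [E'.str_one]
    · intro t v
      change L (((E.level k).pt, t), v) = _
      rcases hval (((E.level k).pt, t), v) with ⟨-, -, h1⟩ | ⟨-, -, h1⟩ <;>
        rw [h1, (h.app k).map_pt, E'.str_pt]
  obtain ⟨N, hN⟩ := exists_rep x
  obtain ⟨x, rfl⟩ := hN N le_rfl
  have h1 := (key (b + N)).pi_eq (a + N) x
  rw [SuspMap.pi_concat, SuspMap.pi_precomp, SuspMap.pi_precomp, SuspMap.pi_precomp] at h1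
  have h2 : step (stageMap h x) = step (stageMap f x) * step (stageMap g x) := h1
  rw [map_mk, map_mk, map_mk, ← mk_step, h2, mk_mul, mk_step, mk_step]

end Wedge

end ColimPi

end Prespectrum

end CrossEffects

/-! ### Homotopy groups of finite wedges and the splitting criterion. -/

namespace CrossEffects

namespace Prespectrum

/-- The constant map of prespectra. -/
def constHom (E E' : Prespectrum.{u}) : E ⟶ E' where
  app _ := BasedMap.const _ _
  app_str k _ t := (E'.str_pt k t).symm

section

variable {J : Type} (E : J → Prespectrum.{u})

/-- The inclusion of a summand of a wedge. -/
def wedgeIncl (j : J) : E j ⟶ wedge E where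
  app k := ⟨⟨fun x => Quot.mk _ (Sum.inr ⟨j, x⟩),
    continuous_quot_mk.comp (continuous_inr.comp continuous_sigmaMk)⟩,
    Quot.sound (WedgeRel.glue (X := fun j => (E j).level k) j)⟩
  app_str _ _ _ := rfl

/-- The collapse of a wedge onto a summand. -/
noncomputable def wedgeProj (j : J) : wedge E ⟶ E j := wedgeDesc fun i => delta E i j

open Classical in
/-- The endomorphism of a wedge which is the identity on some of the summands and trivial on the
others. -/
noncomputable def wedgePart (T : Finset J) : wedge E ⟶ wedge E :=
  wedgeDesc fun i => if i ∈ T then wedgeIncl E i else constHom _ _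

theorem wedgeToProd_eq : wedgeToProd E = productLift (wedgeProj E) := by
  refine hom_ext fun k x => ?_
  obtain ⟨⟨⟩ | ⟨j, x⟩⟩ := x <;> rfl

theorem wedgeIncl_desc {D : Prespectrum.{u}} (f : ∀ j, E j ⟶ D) (j : J) :
    wedgeIncl E j ≫ wedgeDesc f = f j := rfl

theorem delta_self (j : J) : delta E j j = 𝟙 _ := by simp [delta]

theorem delta_ne {i j : J} (h : i ≠ j) : delta E i j = constHom _ _ := by
  simp only [delta, h, dite_false]
  rfl

end

namespace ColimPi

variable {a b : ℕ}

theorem map_constHom {E E' : Prespectrum.{u}} (x : ColimPi a b E) :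
    map (constHom E E') x = 0 := by
  obtain ⟨N, hN⟩ := exists_rep x
  obtain ⟨x, rfl⟩ := hN N le_rfl
  rw [map_mk, ← mk_stageOne (j := N)]
  exact congrArg (mk N) (BasedMap.mapPi_const _ _)

variable {J : Type} (E : J → Prespectrum.{u})

/-- One summand is added at a time: at each point of the wedge either the part over `T` or the part
over the new index `j` is trivial, so `map_eq_add_of_disjoint` applies. -/
theorem map_wedgePart (T : Finset J) (x : ColimPi a b (wedge E)) :
    map (wedgePart E T) x = ∑ j ∈ T, map (wedgeIncl E j) (map (wedgeProj E j) x) := by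
  classical
  induction T using Finset.induction_on with
  | empty =>
    rw [Finset.sum_empty, ← map_constHom x (E' := wedge E)]
    congr 1
    refine hom_ext fun k p => ?_
    obtain ⟨⟨⟩ | ⟨j, p⟩⟩ := p <;> rfl
  | insert j T hj ih =>
    rw [Finset.sum_insert hj, ← ih, ← map_comp]
    refine map_eq_add_of_disjoint _ _ _ (fun k p => ?_) x
    obtain ⟨⟨⟩ | ⟨i, p⟩⟩ := p
    · exact Or.inl ⟨((wedgeIncl E j).app k).map_pt, rfl⟩
    · have hdesc : ∀ T : Finset J, ((wedgePart E T).app k).map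
          (((wedgeIncl E i).app k).map p) = if i ∈ T then ((wedgeIncl E i).app k).map p
            else ((wedge E).level k).pt := by
        intro T
        rw [← comp_app_map_apply, wedgePart, wedgeIncl_desc]
        split_ifs <;> rfl
      have hproj : ((wedgeProj E j ≫ wedgeIncl E j).app k).map (((wedgeIncl E i).app k).map p) =
          ((wedgeIncl E j).app k).map (((delta E i j).app k).map p) := rfl
      change _ = _ ∧ ((wedgePart E (insert j T)).app k).map (((wedgeIncl E i).app k).map p) =
        ((wedgePart E T).app k).map (((wedgeIncl E i).app k).map p) ∨
        ((wedgePart E T).app k).map (((wedgeIncl E i).app k).map p) = _ ∧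
        ((wedgePart E (insert j T)).app k).map (((wedgeIncl E i).app k).map p) =
          ((wedgeProj E j ≫ wedgeIncl E j).app k).map (((wedgeIncl E i).app k).map p)
      rw [hdesc, hdesc]
      by_cases hij : i = j
      · subst hij
        refine Or.inr ⟨if_neg hj, ?_⟩
        rw [if_pos (Finset.mem_insert_self i T), hproj, delta_self]
        rfl
      · refine Or.inl ⟨?_, ?_⟩
        · refine hproj.trans ?_
          rw [delta_ne E hij]
          exact ((wedgeIncl E j).app k).map_pt
        · simp only [Finset.mem_insert, hij, false_or]

theorem wedge_eq_sum [Fintype J] (x : ColimPi a b (wedge E)) :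
    ∑ j, map (wedgeIncl E j) (map (wedgeProj E j) x) = x := by
  rw [← map_wedgePart]
  conv_rhs => rw [← map_id x]
  congr 1
  refine hom_ext fun k p => ?_
  obtain ⟨⟨⟩ | ⟨j, p⟩⟩ := p
  · rfl
  · change ((wedgeIncl E j ≫ wedgePart E Finset.univ).app k).map p = _
    rw [wedgePart, wedgeIncl_desc, if_pos (Finset.mem_univ j)]
    rfl

theorem map_sum {E E' : Prespectrum.{u}} (f : E ⟶ E') (s : Finset J) (x : J → ColimPi a b E) :
    map f (∑ j ∈ s, x j) = ∑ j ∈ s, map f (x j) := _root_.map_sum (mapHom f) x s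

variable [Finite J]

/-- Inclusions and projections form a biproduct system on homotopy groups: orthogonality gives
surjectivity, and `wedge_eq_sum` gives injectivity. -/
theorem bijective_wedgeToProd : Function.Bijective (map (a := a) (b := b) (wedgeToProd E)) := by
  have := Fintype.ofFinite J
  rw [wedgeToProd_eq, bijective_productLift_iff]
  constructor
  · intro x y hxy
    rw [← wedge_eq_sum E x, ← wedge_eq_sum E y]
    exact Finset.sum_congr rfl fun j _ => congrArg _ (congrFun hxy j)
  · intro y
    refine ⟨∑ j, map (wedgeIncl E j) (y j), funext fun i => ?_⟩
    change map (wedgeProj E i) _ = _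
    rw [map_sum, Finset.sum_eq_single i]
    · rw [← map_comp, wedgeProj, wedgeIncl_desc, delta_self, map_id]
    · intro j _ hji
      rw [← map_comp, wedgeProj, wedgeIncl_desc, delta_ne E hji, map_constHom]
    · exact fun h => absurd (Finset.mem_univ i) h

variable {E} {D : J → Prespectrum.{u}} {G : Prespectrum.{u}} {s : ∀ j, E j ⟶ G} {p : ∀ j, G ⟶ D j}

/-- A splitting criterion: a prespectrum with maps from the `E j` and to the `D j` whose matrix is
diagonal, with equivalences on the diagonal. -/
theorem bijective_of_diagonal
    (hdiag : ∀ j, Function.Bijective (map (a := a) (b := b) (s j ≫ p j)))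
    (hoff : ∀ i j, i ≠ j → ∀ x : ColimPi a b (E i), map (s i ≫ p j) x = 0)
    (hinj : ∀ g : ColimPi a b G, (∀ j, map (p j) g = 0) → g = 0) :
    Function.Bijective (map (a := a) (b := b) (productLift p)) ∧
      Function.Bijective (map (a := a) (b := b) (wedgeDesc s)) := by
  have := Fintype.ofFinite J
  have hsum : ∀ (x : ∀ j, ColimPi a b (E j)) (i : J),
      map (p i) (∑ j, map (s j) (x j)) = map (s i ≫ p i) (x i) := by
    intro x i
    rw [map_sum, Finset.sum_eq_single i]
    · rw [map_comp]
    · intro j _ hji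
      rw [← map_comp, hoff j i hji]
    · exact fun h => absurd (Finset.mem_univ i) h
  have hp : Function.Bijective fun (g : ColimPi a b G) j => map (p j) g := by
    constructor
    · intro g g' h
      rw [← sub_eq_zero]
      refine hinj _ fun j => ?_
      change mapHom (p j) (g - g') = 0
      rw [_root_.map_sub, sub_eq_zero]
      exact congrFun h j
    · intro y
      choose x hx using fun j => (hdiag j).2 (y j)
      exact ⟨∑ j, map (s j) (x j), funext fun i => (hsum x i).trans (hx i)⟩
  refine ⟨(bijective_productLift_iff p).2 hp, ?_⟩
  have hw : ∀ (z : ColimPi a b (wedge E)),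
      map (wedgeDesc s) z = ∑ j, map (s j) (map (wedgeProj E j) z) := by
    intro z
    conv_lhs => rw [← wedge_eq_sum E z]
    rw [map_sum]
    refine Finset.sum_congr rfl fun j _ => ?_
    rw [← map_comp, wedgeIncl_desc]
  have hwp : Function.Bijective fun (z : ColimPi a b (wedge E)) j => map (wedgeProj E j) z := by
    rw [← bijective_productLift_iff, ← wedgeToProd_eq]
    exact bijective_wedgeToProd E
  -- With the wedge identified with the product of its summands, `wedgeDesc s` followed by all `p j`
  -- is the diagonal matrix. As the `p j` are already jointly bijective, so is `wedgeDesc s`.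
  have hcomp : (fun (g : ColimPi a b G) j => map (p j) g) ∘ map (wedgeDesc s) =
      (fun x j => map (s j ≫ p j) (x j)) ∘ fun z j => map (wedgeProj E j) z := by
    funext z i
    change map (p i) (map (wedgeDesc s) z) = _
    rw [hw, hsum]
    rfl
  rw [← Function.Bijective.of_comp_iff' hp, hcomp]
  refine Function.Bijective.comp ?_ hwp
  exact ⟨fun x y h => funext fun j => (hdiag j).1 (congrFun h j), fun y => by
    choose x hx using fun j => (hdiag j).2 (y j)
    exact ⟨x, funext hx⟩⟩

end ColimPi

end Prespectrum

end CrossEffects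

namespace CrossEffects

open Prespectrum Prespectrum.ColimPi

/-! ### Naturality and vanishing for total homotopy fibers and cofibers -/

section Total

variable {a b : ℕ}

theorem comp_square_three {K : Type*} [Category K] {A₁ A₂ A₃ A₄ B₁ B₂ B₃ B₄ : K}
    {f₁ : A₁ ⟶ A₂} {f₂ : A₂ ⟶ A₃} {f₃ : A₃ ⟶ A₄} {g₁ : B₁ ⟶ B₂} {g₂ : B₂ ⟶ B₃} {g₃ : B₃ ⟶ B₄}
    {a₁ : A₁ ⟶ B₁} {a₂ : A₂ ⟶ B₂} {a₃ : A₃ ⟶ B₃} {a₄ : A₄ ⟶ B₄}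
    (h₁ : a₁ ≫ g₁ = f₁ ≫ a₂) (h₂ : a₂ ≫ g₂ = f₂ ≫ a₃) (h₃ : a₃ ≫ g₃ = f₃ ≫ a₄) :
    a₁ ≫ g₁ ≫ g₂ ≫ g₃ = (f₁ ≫ f₂ ≫ f₃) ≫ a₄ := by
  rw [reassoc_of% h₁, reassoc_of% h₂, h₃]
  simp only [Category.assoc]

theorem tfibι_naturality (n : ℕ) {Q Q' : (Finset (Fin n))ᵒᵖ ⥤ Prespectrum.{u}} (η : Q ⟶ Q') :
    (tfib n).map η ≫ tfibι n Q' = tfibι n Q ≫ η.app (op Finset.univ) := by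
  induction n with
  | zero => rfl
  | succ n ih =>
    exact comp_square_three (a₁ := (tfib (n + 1)).map η)
      (a₂ := (tfib n).map (Functor.whiskerLeft (faceUp n).op η)) rfl
      (ih (Functor.whiskerLeft (faceUp n).op η)) (η.naturality _).symm

theorem tcofibπ_naturality (n : ℕ) {P P' : Finset (Fin n) ⥤ Prespectrum.{u}} (η : P ⟶ P') :
    tcofibπ n P ≫ (tcofib n).map η = η.app Finset.univ ≫ tcofibπ n P' := by
  induction n with
  | zero => rfl
  | succ n ih =>
    exact (comp_square_three (a₄ := (tcofib (n + 1)).map η)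
      (a₃ := (tcofib n).map (Functor.whiskerLeft (faceUp n) η)) (η.naturality _).symm
      (ih (Functor.whiskerLeft (faceUp n) η)).symm rfl).symm

/-- The map of `n`-cubes whose homotopy fiber defines the total homotopy fiber. -/
def faceRes (n : ℕ) (Q : (Finset (Fin (n + 1)))ᵒᵖ ⥤ Prespectrum.{u}) :
    (faceUp n).op ⋙ Q ⟶ (faceLow n).op ⋙ Q :=
  ((Functor.whiskeringLeft _ _ _).map (NatTrans.op (lowToUp n))).app Q

/-- The map of `n`-cubes whose homotopy cofiber defines the total homotopy cofiber. -/
def faceExt (n : ℕ) (P : Finset (Fin (n + 1)) ⥤ Prespectrum.{u}) :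
    faceLow n ⋙ P ⟶ faceUp n ⋙ P :=
  ((Functor.whiskeringLeft _ _ _).map (lowToUp n)).app P

/-! ### Composites that vanish on homotopy groups. -/

section Vanishing

variable {A A' B B' C C' D : Prespectrum.{u}}

theorem map_comp_eq_zero_of_square {f : A ⟶ B} {r : B ⟶ B'} {i : B ⟶ C} {i' : B' ⟶ C'}
    {ρ : C ⟶ C'} {q : C ⟶ A'} {q' : A' ⟶ D} {k : C' ⟶ D}
    (h₀ : ∀ x : ColimPi a b A, map (f ≫ r) x = 0) (h₁ : r ≫ i' = i ≫ ρ) (h₂ : q ≫ q' = ρ ≫ k)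
    (x : ColimPi a b A) : map ((f ≫ i ≫ q) ≫ q') x = 0 := by
  have : (f ≫ i ≫ q) ≫ q' = (f ≫ r) ≫ i' ≫ k := by
    simp only [Category.assoc]
    rw [h₂, reassoc_of% h₁]
  rw [this, map_comp, h₀, map_zero]

theorem map_comp_eq_zero_of_factor {f : A ⟶ B} {i : B ⟶ C} {q : C ⟶ A'} {q' : A' ⟶ D}
    {ρ : C ⟶ C'} {k : C' ⟶ D} (h₀ : ∀ x : ColimPi a b B, map (i ≫ ρ) x = 0)
    (h : q ≫ q' = ρ ≫ k) (x : ColimPi a b A) : map ((f ≫ i ≫ q) ≫ q') x = 0 := by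
  have : (f ≫ i ≫ q) ≫ q' = f ≫ (i ≫ ρ) ≫ k := by
    simp only [Category.assoc]
    rw [h]
  rw [this, map_comp, map_comp, h₀, map_zero]

theorem map_comp_eq_zero_of_square' {f : B ⟶ A} {r : B' ⟶ B} {i : C ⟶ B} {i' : C' ⟶ B'}
    {ρ : C' ⟶ C} {q : A' ⟶ C} {q' : D ⟶ A'} {k : D ⟶ C'}
    (h₀ : ∀ x : ColimPi a b B', map (r ≫ f) x = 0) (h₁ : i' ≫ r = ρ ≫ i) (h₂ : q' ≫ q = k ≫ ρ)
    (x : ColimPi a b D) : map (q' ≫ q ≫ i ≫ f) x = 0 := by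
  have : q' ≫ q ≫ i ≫ f = (k ≫ i') ≫ r ≫ f := by
    rw [reassoc_of% h₂, Category.assoc, reassoc_of% h₁]
  rw [this, map_comp, h₀]

theorem map_comp_eq_zero_of_factor' {f : B ⟶ A} {i : C ⟶ B} {q : A' ⟶ C} {q' : D ⟶ A'}
    {ρ : C' ⟶ C} {k : D ⟶ C'} (h₀ : ∀ x : ColimPi a b C', map (ρ ≫ i) x = 0)
    (h : q' ≫ q = k ≫ ρ) (x : ColimPi a b D) : map (q' ≫ q ≫ i ≫ f) x = 0 := by
  have : q' ≫ q ≫ i ≫ f = k ≫ (ρ ≫ i) ≫ f := by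
    rw [reassoc_of% h, Category.assoc]
  rw [this, map_comp, map_comp, h₀, map_zero]

end Vanishing

theorem le_faceLow_univ {n : ℕ} {S : Finset (Fin (n + 1))} (h : 0 ∉ S) :
    S ≤ (faceLow n).obj Finset.univ := by
  intro i hi
  change i ∈ Finset.univ.map (Fin.succEmb n)
  induction i using Fin.cases with
  | zero => exact absurd hi h
  | succ i => simp

theorem le_faceUp_erase {n : ℕ} {S : Finset (Fin (n + 1))} {i : Fin n} (h : i.succ ∉ S) :
    S ≤ (faceUp n).obj (Finset.univ.erase i) := by
  intro j hj
  change j ∈ insert 0 ((Finset.univ.erase i).map (Fin.succEmb n))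
  induction j using Fin.cases with
  | zero => simp
  | succ j =>
    have : j ≠ i := by
      rintro rfl
      exact h hj
    simp [this]

/-- If the missing index is `0`, the restriction factors through the lower face, and the composite
of the fiber with the map to that face is null. Otherwise it factors through a maximal proper subset
in the upper face, where induction applies. -/
theorem map_tfibι_res (n : ℕ) (Q : (Finset (Fin n))ᵒᵖ ⥤ Prespectrum.{u}) (i : Fin n)
    {S : Finset (Fin n)} (hS : i ∉ S) (x : ColimPi a b ((tfib n).obj Q)) :
    map (tfibι n Q ≫ Q.map (homOfLE (Finset.subset_univ S)).op) x = 0 := by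
  induction n with
  | zero => exact i.elim0
  | succ n ih =>
    induction i using Fin.cases with
    | zero =>
      have h : Q.map (homOfLE (univ_le_faceUp n)).op ≫
          Q.map (homOfLE (Finset.subset_univ S)).op =
          (faceRes n Q).app (op Finset.univ) ≫ Q.map (homOfLE (le_faceLow_univ hS)).op :=
        (Q.map_comp _ _).symm.trans
          (Q.map_comp ((lowToUp n).app Finset.univ).op (homOfLE (le_faceLow_univ hS)).op)
      exact map_comp_eq_zero_of_square (map_fibFst_comp ((tfib n).map (faceRes n Q)))
        (tfibι_naturality n (faceRes n Q)) h x
    | succ i =>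
      have h : Q.map (homOfLE (univ_le_faceUp n)).op ≫
          Q.map (homOfLE (Finset.subset_univ S)).op =
          ((faceUp n).op ⋙ Q).map (homOfLE (Finset.subset_univ (Finset.univ.erase i))).op ≫
            Q.map (homOfLE (le_faceUp_erase hS)).op :=
        (Q.map_comp _ _).symm.trans
          (Q.map_comp ((faceUp n).map (homOfLE (Finset.subset_univ (Finset.univ.erase i)))).op
            (homOfLE (le_faceUp_erase hS)).op)
      exact map_comp_eq_zero_of_factor
        (ih ((faceUp n).op ⋙ Q) i (Finset.notMem_erase i _)) h x

/-- Dual to `map_tfibι_res`: an extension from a set without `0` passes through the lower face,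
which the cofiber kills. -/
theorem map_ext_tcofibπ (n : ℕ) (P : Finset (Fin n) ⥤ Prespectrum.{u}) (i : Fin n)
    {S : Finset (Fin n)} (hS : i ∉ S) (x : ColimPi a b (P.obj S)) :
    map (P.map (homOfLE (Finset.subset_univ S)) ≫ tcofibπ n P) x = 0 := by
  induction n with
  | zero => exact i.elim0
  | succ n ih =>
    induction i using Fin.cases with
    | zero =>
      have h : P.map (homOfLE (Finset.subset_univ S)) ≫ P.map (homOfLE (univ_le_faceUp n)) =
          P.map (homOfLE (le_faceLow_univ hS)) ≫ (faceExt n P).app Finset.univ :=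
        (P.map_comp _ _).symm.trans
          (P.map_comp (homOfLE (le_faceLow_univ hS)) ((lowToUp n).app Finset.univ))
      exact map_comp_eq_zero_of_square' (map_comp_cofibInr ((tcofib n).map (faceExt n P)))
        (tcofibπ_naturality n (faceExt n P)) h x
    | succ i =>
      have h : P.map (homOfLE (Finset.subset_univ S)) ≫ P.map (homOfLE (univ_le_faceUp n)) =
          P.map (homOfLE (le_faceUp_erase hS)) ≫
          (faceUp n ⋙ P).map (homOfLE (Finset.subset_univ (Finset.univ.erase i))) :=
        (P.map_comp _ _).symm.trans (P.map_comp (homOfLE (le_faceUp_erase hS))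
          ((faceUp n).map (homOfLE (Finset.subset_univ (Finset.univ.erase i)))))
      exact map_comp_eq_zero_of_factor'
        (ih (faceUp n ⋙ P) i (Finset.notMem_erase i _)) h x

end Total

/-! ### Cubes with restriction and extension maps -/

/-- An `n`-cube with restriction maps and extension maps which satisfy a base change condition. -/
structure BiCube (n : ℕ) where
  obj : Finset (Fin n) → Prespectrum.{u}
  res : ∀ {S T : Finset (Fin n)}, S ≤ T → (obj T ⟶ obj S)
  ext : ∀ {S T : Finset (Fin n)}, S ≤ T → (obj S ⟶ obj T)
  res_self : ∀ S, res (le_refl S) = 𝟙 (obj S)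
  res_res : ∀ {S T U} (h : S ≤ T) (h' : T ≤ U), res h' ≫ res h = res (h.trans h')
  ext_self : ∀ S, ext (le_refl S) = 𝟙 (obj S)
  ext_ext : ∀ {S T U} (h : S ≤ T) (h' : T ≤ U), ext h ≫ ext h' = ext (h.trans h')
  -- The inequalities force `V = S ∩ T`; keeping `V` as a variable avoids transport along equalities
  -- of index sets.
  ext_res : ∀ {S T U V} (hS : S ≤ U) (hT : T ≤ U) (hVS : V ≤ S) (hVT : V ≤ T), S ∩ T ≤ V →
    ext hS ≫ res hT = res hVS ≫ ext hVT

namespace BiCube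

variable {n : ℕ}

/-- The cube of restriction maps. -/
def resCube (G : BiCube.{u} n) : (Finset (Fin n))ᵒᵖ ⥤ Prespectrum.{u} where
  obj S := G.obj S.unop
  map f := G.res (leOfHom f.unop)
  map_id S := G.res_self S.unop
  map_comp f g := (G.res_res (leOfHom g.unop) (leOfHom f.unop)).symm

/-- The cube of extension maps. -/
def extCube (G : BiCube.{u} n) : Finset (Fin n) ⥤ Prespectrum.{u} where
  obj S := G.obj S
  map f := G.ext (leOfHom f)
  map_id S := G.ext_self S
  map_comp f g := (G.ext_ext (leOfHom f) (leOfHom g)).symm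

theorem ext_res_self (G : BiCube.{u} n) {S T : Finset (Fin n)} (h : S ≤ T) :
    G.ext h ≫ G.res h = 𝟙 _ := by
  rw [G.ext_res h h le_rfl le_rfl (by simp), G.res_self, G.ext_self, Category.comp_id]

theorem faceLow_mono {S T : Finset (Fin n)} (h : S ≤ T) : (faceLow n).obj S ≤ (faceLow n).obj T :=
  leOfHom ((faceLow n).map (homOfLE h))

theorem faceUp_mono {S T : Finset (Fin n)} (h : S ≤ T) : (faceUp n).obj S ≤ (faceUp n).obj T :=
  leOfHom ((faceUp n).map (homOfLE h))

theorem faceLow_le_faceUp (S : Finset (Fin n)) : (faceLow n).obj S ≤ (faceUp n).obj S :=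
  leOfHom ((lowToUp n).app S)

theorem mem_faceLow {S : Finset (Fin n)} {i : Fin (n + 1)} :
    i ∈ (faceLow n).obj S ↔ ∃ j ∈ S, j.succ = i := Finset.mem_map

theorem mem_faceUp {S : Finset (Fin n)} {i : Fin (n + 1)} :
    i ∈ (faceUp n).obj S ↔ i = 0 ∨ ∃ j ∈ S, j.succ = i :=
  Finset.mem_insert.trans (or_congr_right Finset.mem_map)

theorem faceLow_inter {S T V : Finset (Fin n)} (h : S ∩ T ≤ V) :
    (faceLow n).obj S ∩ (faceLow n).obj T ≤ (faceLow n).obj V := by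
  intro i hi
  simp only [Finset.mem_inter, mem_faceLow] at hi ⊢
  obtain ⟨⟨j, hj, rfl⟩, k, hk, hkj⟩ := hi
  obtain rfl := Fin.succ_injective _ hkj
  exact ⟨k, h (Finset.mem_inter.2 ⟨hj, hk⟩), rfl⟩

theorem faceUp_inter {S T V : Finset (Fin n)} (h : S ∩ T ≤ V) :
    (faceUp n).obj S ∩ (faceUp n).obj T ≤ (faceUp n).obj V := by
  intro i hi
  simp only [Finset.mem_inter, mem_faceUp] at hi ⊢
  obtain ⟨rfl | ⟨j, hj, rfl⟩, h0 | ⟨k, hk, hkj⟩⟩ := hi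
  · exact Or.inl rfl
  · exact Or.inl rfl
  · exact Or.inl h0
  · obtain rfl := Fin.succ_injective _ hkj
    exact Or.inr ⟨k, h (Finset.mem_inter.2 ⟨hj, hk⟩), rfl⟩

theorem faceLow_inter_faceUp {S T V : Finset (Fin n)} (h : S ∩ T ≤ V) :
    (faceLow n).obj S ∩ (faceUp n).obj T ≤ (faceLow n).obj V := by
  intro i hi
  simp only [Finset.mem_inter, mem_faceLow, mem_faceUp] at hi ⊢
  obtain ⟨⟨j, hj, rfl⟩, h0 | ⟨k, hk, hkj⟩⟩ := hi
  · exact absurd h0 (Fin.succ_ne_zero j)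
  · obtain rfl := Fin.succ_injective _ hkj
    exact ⟨k, h (Finset.mem_inter.2 ⟨hj, hk⟩), rfl⟩

variable (G : BiCube.{u} (n + 1))

/-- The face of the subsets not containing `0`. -/
def low : BiCube.{u} n where
  obj S := G.obj ((faceLow n).obj S)
  res h := G.res (faceLow_mono h)
  ext h := G.ext (faceLow_mono h)
  res_self _ := G.res_self _
  res_res _ _ := G.res_res _ _
  ext_self _ := G.ext_self _
  ext_ext _ _ := G.ext_ext _ _
  ext_res _ _ _ _ h := G.ext_res _ _ _ _ (faceLow_inter h)

/-- The face of the subsets containing `0`. -/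
def up : BiCube.{u} n where
  obj S := G.obj ((faceUp n).obj S)
  res h := G.res (faceUp_mono h)
  ext h := G.ext (faceUp_mono h)
  res_self _ := G.res_self _
  res_res _ _ := G.res_res _ _
  ext_self _ := G.ext_self _
  ext_ext _ _ := G.ext_ext _ _
  ext_res _ _ _ _ h := G.ext_res _ _ _ _ (faceUp_inter h)

/-- The extension maps between the opposite faces as a map of cubes of restriction maps. -/
def faceSection : G.low.resCube ⟶ G.up.resCube where
  app S := G.ext (faceLow_le_faceUp S.unop)
  naturality S _ _ := (G.ext_res _ _ _ _
    (faceLow_inter_faceUp (Finset.inter_subset_right (s₁ := S.unop)))).symm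

/-- The restriction maps between the opposite faces as a map of cubes of extension maps. -/
def faceRetraction : G.up.extCube ⟶ G.low.extCube where
  app S := G.res (faceLow_le_faceUp S)
  naturality _ T _ := G.ext_res _ _ _ _ (by
    rw [Finset.inter_comm]
    exact faceLow_inter_faceUp (Finset.inter_subset_right (s₁ := T)))

theorem faceSection_faceRes : G.faceSection ≫ faceRes n G.resCube = 𝟙 _ := by
  ext S : 2
  exact G.ext_res_self _

theorem faceExt_faceRetraction : faceExt n G.extCube ≫ G.faceRetraction = 𝟙 _ := by
  ext S : 2
  exact G.ext_res_self _

/-- Functoriality of `tfib` turns the vertexwise splittings into a splitting of the map whose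
homotopy fiber is the total fiber. -/
theorem map_faceSection : (tfib n).map G.faceSection ≫ (tfib n).map (faceRes n G.resCube) =
    𝟙 ((tfib n).obj G.low.resCube) :=
  ((tfib n).map_comp _ _).symm.trans
    ((congrArg (tfib n).map G.faceSection_faceRes).trans ((tfib n).map_id _))

theorem map_faceRetraction : (tcofib n).map (faceExt n G.extCube) ≫
    (tcofib n).map G.faceRetraction = 𝟙 ((tcofib n).obj G.low.extCube) :=
  ((tcofib n).map_comp _ _).symm.trans
    ((congrArg (tcofib n).map G.faceExt_faceRetraction).trans ((tcofib n).map_id _))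

/-- The natural map from the total homotopy fiber to the total homotopy cofiber. -/
def comparison {n : ℕ} (G : BiCube.{u} n) : (tfib n).obj G.resCube ⟶ (tcofib n).obj G.extCube :=
  tfibι n G.resCube ≫ tcofibπ n G.extCube

/-- The two index sets are equal; `res` and `ext` along the inequality serve as the identification
of their vertices. -/
theorem res_ext_faceUp_univ : G.res (univ_le_faceUp n) ≫ G.ext (univ_le_faceUp n) = 𝟙 _ := by
  rw [← G.ext_res le_rfl le_rfl (univ_le_faceUp n) (univ_le_faceUp n) (Finset.subset_univ _),
    G.ext_self, G.res_self, Category.comp_id]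

/-- The inductive step: the new comparison has the shape treated in `map_fib_to_cofib_bijective`,
with the comparison of the upper face in the middle. -/
theorem comparison_succ : G.comparison = fibFst ((tfib n).map (faceRes n G.resCube)) ≫
    G.up.comparison ≫ cofibInr ((tcofib n).map (faceExt n G.extCube)) := by
  have key : ∀ {A B C C' B' A' : Prespectrum.{u}} (f : A ⟶ B) (i : B ⟶ C) (p : C ⟶ B')
      (g : B' ⟶ A') (ρ : C ⟶ C') (σ : C' ⟶ C), ρ ≫ σ = 𝟙 _ →
      (f ≫ i ≫ ρ) ≫ (σ ≫ p ≫ g) = f ≫ (i ≫ p) ≫ g := fun f i p g ρ σ h => by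
    simp only [Category.assoc]
    rw [reassoc_of% h]
  exact key _ _ _ _ _ _ G.res_ext_faceUp_univ

variable {a b : ℕ}

theorem map_comparison_bijective {n : ℕ} (G : BiCube.{u} n) :
    Function.Bijective (map (a := a) (b := b) G.comparison) := by
  induction n with
  | zero =>
    have : G.comparison = 𝟙 (G.obj Finset.univ) := Category.comp_id (𝟙 (G.obj Finset.univ))
    have h : map (a := a) (b := b) (𝟙 (G.obj Finset.univ)) = _root_.id := funext map_id
    exact (congrArg (fun f => Function.Bijective (map (a := a) (b := b) f)) this).mpr
      (h ▸ Function.bijective_id)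
  | succ n ih =>
    rw [comparison_succ]
    have key : ∀ {A A' B B' C C' : Prespectrum.{u}} {r : A ⟶ A'} {i : A ⟶ B} {i' : A' ⟶ B'}
        {ρ : B ⟶ B'} {p : B ⟶ C} {p' : B' ⟶ C'} {r' : C ⟶ C'}, r ≫ i' = i ≫ ρ →
        p ≫ r' = ρ ≫ p' → r ≫ i' ≫ p' = (i ≫ p) ≫ r' := fun h h' => by
      rw [Category.assoc, h', reassoc_of% h]
    -- The required square says that the comparisons of the two faces are compatible with `faceRes`
    -- on total fibers and `faceRetraction` on total cofibers; both outer squares are naturality.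
    exact map_fib_to_cofib_bijective G.map_faceSection G.map_faceRetraction
      (φ₀ := G.low.comparison) (φ := G.up.comparison)
      (key (tfibι_naturality n (faceRes n G.resCube)) (tcofibπ_naturality n G.faceRetraction))
      (ih G.low) (ih G.up)

theorem map_tfibι_injective {n : ℕ} (G : BiCube.{u} n) :
    Function.Injective (map (a := a) (b := b) (tfibι n G.resCube)) := by
  intro x y h
  apply G.map_comparison_bijective.1
  exact (map_comp _ _ x).trans ((congrArg _ h).trans (map_comp _ _ y).symm)

/-- An element which restricts to zero on the maximal proper subsets comes from the total
homotopy fiber. -/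
theorem exists_map_tfibι {n : ℕ} (G : BiCube.{u} n) (y : ColimPi a b (G.obj Finset.univ))
    (hy : ∀ i, map (G.res (Finset.subset_univ (Finset.univ.erase i))) y = 0) :
    ∃ x, map (tfibι n G.resCube) x = y := by
  induction n with
  | zero => exact ⟨y, map_id y⟩
  | succ n ih =>
    have hy' : ∀ {S : Finset (Fin (n + 1))} (i : Fin (n + 1)), i ∉ S →
        map (G.res (Finset.subset_univ S)) y = 0 := fun {S} i hi => by
      rw [← G.res_res (Finset.subset_erase.2 ⟨Finset.subset_univ S, hi⟩)
        (Finset.subset_univ (Finset.univ.erase i)), map_comp, hy, map_zero]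
    -- Moving `y` to the top vertex of the upper face does not change its restrictions.
    have hext : ∀ {S : Finset (Fin (n + 1))} (h : S ≤ (faceUp n).obj Finset.univ),
        map (G.res h) (map (G.ext (univ_le_faceUp n)) y) =
          map (G.res (Finset.subset_univ S)) y := fun {S} h => by
      rw [← map_comp, G.ext_res _ _ (Finset.subset_univ S) le_rfl Finset.inter_subset_right,
        G.ext_self, Category.comp_id]
    obtain ⟨z, hz⟩ := ih G.up (map (G.ext (univ_le_faceUp n)) y) fun i =>
      (hext _).trans (hy' i.succ fun h => by
        obtain h | ⟨j, hj, hji⟩ := mem_faceUp.1 h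
        · exact Fin.succ_ne_zero _ h
        · exact Finset.notMem_erase j Finset.univ (Fin.succ_injective _ hji ▸ hj))
    -- The total fiber of the lower face injects into its initial vertex. There the class becomes
    -- the restriction of `y` to a set without `0`, which vanishes.
    have hz0 : map ((tfib n).map (faceRes n G.resCube)) z = 0 := by
      apply G.low.map_tfibι_injective
      refine (map_comp _ _ z).symm.trans ((congrArg (fun f => map f z)
        (tfibι_naturality n (faceRes n G.resCube))).trans ((map_comp _ _ z).trans
        ((congrArg _ hz).trans ((hext (faceLow_le_faceUp _)).trans
        ((hy' 0 fun h => ?_).trans (map_zero _).symm)))))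
      obtain ⟨j, -, hj⟩ := mem_faceLow.1 h
      exact Fin.succ_ne_zero _ hj
    obtain ⟨x, hx⟩ := exists_map_fibFst _ _ G.map_faceSection z hz0
    refine ⟨x, (map_comp _ _ x).trans ((map_comp _ _ _).trans ?_)⟩
    refine (congrArg (fun z => map (G.res (univ_le_faceUp n)) (map (tfibι n G.up.resCube) z))
      hx).trans ((congrArg _ hz).trans ((hext _).trans ?_))
    exact (congrArg (fun f => map f y) (G.res_self _)).trans (map_id y)

end BiCube

end CrossEffects

/-! ### Faces of a bicube and the splitting theorem. -/

namespace CrossEffects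

open Prespectrum Prespectrum.ColimPi

namespace BiCube

variable {n : ℕ}

section

variable {a b : ℕ} (G : BiCube.{u} n)

/-- The map from the total homotopy fiber. -/
def fiberι : (tfib n).obj G.resCube ⟶ G.obj Finset.univ := tfibι n G.resCube

/-- The map to the total homotopy cofiber. -/
def cofiberπ : G.obj Finset.univ ⟶ (tcofib n).obj G.extCube := tcofibπ n G.extCube

theorem fiberι_cofiberπ : G.fiberι ≫ G.cofiberπ = G.comparison := rfl

theorem map_res_map_fiberι (i : Fin n) (x : ColimPi a b ((tfib n).obj G.resCube)) :
    map (G.res (Finset.subset_univ (Finset.univ.erase i))) (map G.fiberι x) = 0 :=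
  (map_comp _ _ x).symm.trans (map_tfibι_res _ G.resCube i (Finset.notMem_erase i Finset.univ) x)

theorem map_cofiberπ_map_ext (i : Fin n) (x : ColimPi a b (G.obj (Finset.univ.erase i))) :
    map G.cofiberπ (map (G.ext (Finset.subset_univ (Finset.univ.erase i))) x) = 0 :=
  (map_comp _ _ x).symm.trans (map_ext_tcofibπ _ G.extCube i (Finset.notMem_erase i Finset.univ) x)

end

/-- A bicube isomorphic to the one formed by the subsets of `S`. -/
structure FaceModel (G : BiCube.{u} n) (S : Finset (Fin n)) where
  cube : BiCube.{u} S.card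
  hom : cube.obj Finset.univ ⟶ G.obj S
  inv : G.obj S ⟶ cube.obj Finset.univ
  hom_inv : hom ≫ inv = 𝟙 _
  inv_hom : inv ≫ hom = 𝟙 _
  -- Compatibility is only asked for maximal proper subsets and only as a factorization. This
  -- suffices, since it is used solely to transport vanishing.
  hom_res : ∀ s ∈ S, ∃ i, ∃ κ : cube.obj (Finset.univ.erase i) ⟶ G.obj (S.erase s),
    hom ≫ G.res (Finset.erase_subset s S) = cube.res (Finset.subset_univ _) ≫ κ
  inv_res : ∀ i, ∃ s ∈ S, ∃ κ : G.obj (S.erase s) ⟶ cube.obj (Finset.univ.erase i),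
    inv ≫ cube.res (Finset.subset_univ _) = G.res (Finset.erase_subset s S) ≫ κ
  ext_inv : ∀ s ∈ S, ∃ i, ∃ κ : G.obj (S.erase s) ⟶ cube.obj (Finset.univ.erase i),
    G.ext (Finset.erase_subset s S) ≫ inv = κ ≫ cube.ext (Finset.subset_univ _)

namespace FaceModel

variable {G : BiCube.{u} n} {S T : Finset (Fin n)} {a b : ℕ}

/-- The inclusion of the total homotopy fiber of a face. -/
def summand (H : FaceModel G S) : (tfib S.card).obj H.cube.resCube ⟶ G.obj Finset.univ :=
  H.cube.fiberι ≫ H.hom ≫ G.ext (Finset.subset_univ S)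

/-- The projection to the total homotopy cofiber of a face. -/
def factor (H : FaceModel G S) : G.obj Finset.univ ⟶ (tcofib S.card).obj H.cube.extCube :=
  G.res (Finset.subset_univ S) ≫ H.inv ≫ H.cube.cofiberπ

theorem map_res_map_fiberι_of_ne (H : FaceModel G S) (h : T ≤ S) (hne : T ≠ S)
    (x : ColimPi a b ((tfib S.card).obj H.cube.resCube)) :
    map (G.res h) (map H.hom (map H.cube.fiberι x)) = 0 := by
  obtain ⟨s, hs, hsT⟩ := Finset.exists_of_ssubset (h.lt_of_ne hne)
  obtain ⟨i, κ, hκ⟩ := H.hom_res s hs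
  rw [← G.res_res (Finset.subset_erase.2 ⟨h, hsT⟩) (Finset.erase_subset s S), map_comp,
    ← map_comp H.hom, hκ, map_comp]
  rw [map_res_map_fiberι, map_zero, map_zero]

theorem map_cofiberπ_map_ext_of_ne (H : FaceModel G S) (h : T ≤ S) (hne : T ≠ S)
    (x : ColimPi a b (G.obj T)) :
    map H.cube.cofiberπ (map H.inv (map (G.ext h) x)) = 0 := by
  obtain ⟨s, hs, hsT⟩ := Finset.exists_of_ssubset (h.lt_of_ne hne)
  obtain ⟨i, κ, hκ⟩ := H.ext_inv s hs
  rw [← G.ext_ext (Finset.subset_erase.2 ⟨h, hsT⟩) (Finset.erase_subset s S), map_comp,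
    ← map_comp _ H.inv, hκ, map_comp, map_cofiberπ_map_ext]

/-- Base change routes the composite through `S ∩ T`. If this is smaller than `S`, the restriction
kills the total fiber; otherwise `S` is a proper subset of `T` and the cofiber kills the extension.
-/
theorem map_summand_factor_of_ne (H : FaceModel G S) (H' : FaceModel G T) (hne : S ≠ T)
    (x : ColimPi a b ((tfib S.card).obj H.cube.resCube)) :
    map (H.summand ≫ H'.factor) x = 0 := by
  simp only [summand, factor, map_comp]
  rw [← map_comp (G.ext _), G.ext_res _ _ Finset.inter_subset_left Finset.inter_subset_right le_rfl,
    map_comp]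
  by_cases h : S ∩ T = S
  · refine H'.map_cofiberπ_map_ext_of_ne _ (fun h' => hne (h.symm.trans h')) _
  · rw [H.map_res_map_fiberι_of_ne _ h]
    simp only [ColimPi.map_zero]

theorem summand_factor (H : FaceModel G S) : H.summand ≫ H.factor = H.cube.comparison := by
  simp only [summand, factor, Category.assoc]
  rw [reassoc_of% (G.ext_res_self (Finset.subset_univ S)), reassoc_of% H.hom_inv,
    fiberι_cofiberπ]

theorem eq_zero_of_map_factor (H : ∀ S, FaceModel G S) (g : ColimPi a b (G.obj Finset.univ))
    (hg : ∀ S, map (H S).factor g = 0) : g = 0 := by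
  have key : ∀ S, map (G.res (Finset.subset_univ S)) g = 0 := by
    intro S
    induction S using Finset.strongInduction with
    | H S ih =>
      -- By induction the restrictions to all `S.erase s` vanish, so the restriction to `S` comes
      -- from a class `c` in the total fiber.
      obtain ⟨c, hc : map (H S).cube.fiberι c = _⟩ := (H S).cube.exists_map_tfibι
        (map (H S).inv (map (G.res (Finset.subset_univ S)) g)) fun i => by
          obtain ⟨s, hs, κ, hκ⟩ := (H S).inv_res i
          rw [← map_comp, hκ, map_comp, ← map_comp _ (G.res (Finset.erase_subset s S)),
            G.res_res, ih _ (Finset.erase_ssubset hs), ColimPi.map_zero]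
      -- Vanishing of the factor at `S` is vanishing of the comparison on `c`, and the comparison is
      -- injective.
      have hc0 : map (H S).cube.comparison c = 0 := by
        have h := hg S
        rwa [factor, map_comp, map_comp, ← hc, ← map_comp, fiberι_cofiberπ] at h
      have hc1 : c = 0 :=
        (H S).cube.map_comparison_bijective.1 (hc0.trans (ColimPi.map_zero _).symm)
      have hc2 : map (H S).hom (map (H S).inv (map (G.res (Finset.subset_univ S)) g)) = 0 := by
        rw [← hc, hc1, ColimPi.map_zero, ColimPi.map_zero]
      rwa [← map_comp (H S).inv, (H S).inv_hom, map_id] at hc2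
  have h := key Finset.univ
  rwa [G.res_self, map_id] at h

theorem isStableEquiv (H : ∀ S, FaceModel G S) :
    IsStableEquiv G.comparison ∧
    IsStableEquiv (productLift fun S => (H S).factor) ∧
    IsStableEquiv (productMap fun S => (H S).cube.comparison) ∧
    IsStableEquiv (wedgeToProd fun S => (tfib _).obj (H S).cube.resCube) ∧
    IsStableEquiv (wedgeDesc fun S => (H S).summand) := by
  simp only [isStableEquiv_iff]
  have h := fun q : ℤ => bijective_of_diagonal (a := q.toNat) (b := (-q).toNat)
    (s := fun S => (H S).summand) (p := fun S => (H S).factor)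
    (fun S => by
      rw [summand_factor]
      exact (H S).cube.map_comparison_bijective)
    (fun S T hne x => map_summand_factor_of_ne (H S) (H T) hne x)
    (eq_zero_of_map_factor H)
  exact ⟨fun q => G.map_comparison_bijective, fun q => (h q).1,
    fun q => bijective_productMap _ fun S => (H S).cube.map_comparison_bijective,
    fun q => bijective_wedgeToProd _, fun q => (h q).2⟩

end FaceModel

end BiCube

/-! ### Unions and collapse maps -/

section Unions

universe w

set_option linter.unusedSectionVars false

variable {C : Type w} [Category.{v} C] [HasZeroMorphisms C] [HasFiniteCoproducts C] {n : ℕ}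
  (X : Fin n → C)

/-- The inclusion of `⋃_{i ∈ S} X_i` into `⋃_{i ∈ T} X_i`. -/
noncomputable abbrev unionIncl {S T : Finset (Fin n)} (h : S ≤ T) : union X S ⟶ union X T :=
  (inclusionCube X).map (homOfLE h)

/-- The collapse of `⋃_{i ∈ T} X_i` onto `⋃_{i ∈ S} X_i`. -/
noncomputable abbrev unionCollapse {S T : Finset (Fin n)} (h : S ≤ T) : union X T ⟶ union X S :=
  (collapseCube X).map (homOfLE h).op

/-- The summand `X_i` of `⋃_{i ∈ S} X_i`. -/
noncomputable abbrev unionι {S : Finset (Fin n)} {i : Fin n} (hi : i ∈ S) : X i ⟶ union X S :=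
  Sigma.ι (fun i : {i // i ∈ S} => X i.1) ⟨i, hi⟩

variable {X}

theorem union_hom_ext {S : Finset (Fin n)} {Y : C} {f g : union X S ⟶ Y}
    (h : ∀ i (hi : i ∈ S), unionι X hi ≫ f = unionι X hi ≫ g) : f = g :=
  Sigma.hom_ext _ _ fun i => h i.1 i.2

theorem unionι_incl {S T : Finset (Fin n)} (h : S ≤ T) {i : Fin n} (hi : i ∈ S) :
    unionι X hi ≫ unionIncl X h = unionι X (h hi) := by
  simp [unionIncl, inclusionCube]

theorem unionι_incl_assoc {S T : Finset (Fin n)} (h : S ≤ T) {i : Fin n} (hi : i ∈ S)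
    {Z : C} (f : union X T ⟶ Z) :
    unionι X hi ≫ unionIncl X h ≫ f = unionι X (h hi) ≫ f := by
  rw [← Category.assoc, unionι_incl]

theorem unionι_collapse {S T : Finset (Fin n)} (h : S ≤ T) {i : Fin n} {hi' : i ∈ T}
    (hi : i ∈ S) : unionι X hi' ≫ unionCollapse X h = unionι X hi := by
  simp [unionCollapse, collapseCube, hi]

theorem unionι_collapse_assoc {S T : Finset (Fin n)} (h : S ≤ T) {i : Fin n} {hi' : i ∈ T}
    (hi : i ∈ S)
    {Z : C} (f : union X S ⟶ Z) :
    unionι X hi' ≫ unionCollapse X h ≫ f = unionι X hi ≫ f := by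
  rw [← Category.assoc, unionι_collapse h hi]

theorem unionι_collapse_of_notMem {S T : Finset (Fin n)} (h : S ≤ T) {i : Fin n} (hi : i ∈ T)
    (hi' : i ∉ S) : unionι X hi ≫ unionCollapse X h = 0 := by
  simp [unionCollapse, collapseCube, hi']

theorem unionι_collapse_of_notMem_assoc {S T : Finset (Fin n)} (h : S ≤ T) {i : Fin n}
    (hi : i ∈ T) (hi' : i ∉ S)
    {Z : C} (f : union X S ⟶ Z) :
    unionι X hi ≫ unionCollapse X h ≫ f = 0 := by
  rw [← Category.assoc, unionι_collapse_of_notMem h _ hi', zero_comp]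

theorem unionIncl_comp {S T U : Finset (Fin n)} (h : S ≤ T) (h' : T ≤ U) :
    unionIncl X h ≫ unionIncl X h' = unionIncl X (h.trans h') :=
  ((inclusionCube X).map_comp _ _).symm

theorem unionCollapse_comp {S T U : Finset (Fin n)} (h : S ≤ T) (h' : T ≤ U) :
    unionCollapse X h' ≫ unionCollapse X h = unionCollapse X (h.trans h') :=
  ((collapseCube X).map_comp _ _).symm

theorem unionIncl_self (S : Finset (Fin n)) : unionIncl X (le_refl S) = 𝟙 _ :=
  (inclusionCube X).map_id S

theorem unionCollapse_self (S : Finset (Fin n)) : unionCollapse X (le_refl S) = 𝟙 _ :=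
  (collapseCube X).map_id (op S)

/-- On a summand `X_i` with `i ∈ S` both sides are the inclusion if `i ∈ T`, since then `i ∈ V`, and
both are zero otherwise. -/
theorem unionIncl_collapse {S T U V : Finset (Fin n)} (hS : S ≤ U) (hT : T ≤ U) (hVS : V ≤ S)
    (hVT : V ≤ T) (hV : S ∩ T ≤ V) :
    unionIncl X hS ≫ unionCollapse X hT = unionCollapse X hVS ≫ unionIncl X hVT := by
  refine union_hom_ext fun i hi => ?_
  rw [unionι_incl_assoc]
  by_cases hiT : i ∈ T
  · have hiV : i ∈ V := hV (Finset.mem_inter.2 ⟨hi, hiT⟩)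
    rw [unionι_collapse hT hiT, unionι_collapse_assoc hVS hiV, unionι_incl]
  · rw [unionι_collapse_of_notMem _ _ hiT,
      unionι_collapse_of_notMem_assoc _ _ fun h => hiT (hVT h)]

variable (X)

/-- The indices of a subset, listed in increasing order. -/
def subIdx (S : Finset (Fin n)) (k : Fin S.card) : Fin n := S.orderEmbOfFin rfl k

theorem subIdx_mem (S : Finset (Fin n)) (k : Fin S.card) : subIdx S k ∈ S :=
  S.orderEmbOfFin_mem rfl k

theorem subIdx_injective (S : Finset (Fin n)) : Function.Injective (subIdx S) :=
  (S.orderEmbOfFin rfl).injective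

theorem exists_subIdx {S : Finset (Fin n)} {s : Fin n} (hs : s ∈ S) : ∃ k, subIdx S k = s :=
  (Set.ext_iff.1 (S.range_orderEmbOfFin rfl) s).2 hs

/-- The summand `X_s` of the union of a subfamily of `(X_s : s ∈ S)`. -/
noncomputable def subι {S : Finset (Fin n)} {P : Finset (Fin S.card)} {k : Fin S.card}
    (hk : k ∈ P) : X (subIdx S k) ⟶ union (sub X S) P :=
  unionι (sub X S) hk

variable {X}

theorem union_sub_hom_ext {S : Finset (Fin n)} {P : Finset (Fin S.card)} {Y : C}
    {f g : union (sub X S) P ⟶ Y}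
    (h : ∀ k (hk : k ∈ P), subι X hk ≫ f = subι X hk ≫ g) : f = g :=
  union_hom_ext h

theorem subι_incl {S : Finset (Fin n)} {P Q : Finset (Fin S.card)} (h : P ≤ Q) {k : Fin S.card}
    (hk : k ∈ P) : subι X hk ≫ unionIncl (sub X S) h = subι X (h hk) :=
  unionι_incl h hk

theorem subι_incl_assoc {S : Finset (Fin n)} {P Q : Finset (Fin S.card)} (h : P ≤ Q)
    {k : Fin S.card} (hk : k ∈ P)
    {Z : C} (f : union (sub X S) Q ⟶ Z) :
    subι X hk ≫ unionIncl (sub X S) h ≫ f = subι X (h hk) ≫ f := by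
  rw [← Category.assoc, subι_incl]

theorem subι_collapse {S : Finset (Fin n)} {P Q : Finset (Fin S.card)} (h : P ≤ Q)
    {k : Fin S.card} {hk' : k ∈ Q} (hk : k ∈ P) :
    subι X hk' ≫ unionCollapse (sub X S) h = subι X hk :=
  unionι_collapse h hk

theorem subι_collapse_assoc {S : Finset (Fin n)} {P Q : Finset (Fin S.card)} (h : P ≤ Q)
    {k : Fin S.card} {hk' : k ∈ Q} (hk : k ∈ P)
    {Z : C} (f : union (sub X S) P ⟶ Z) :
    subι X hk' ≫ unionCollapse (sub X S) h ≫ f = subι X hk ≫ f := by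
  rw [← Category.assoc, subι_collapse h hk]

theorem subι_collapse_of_notMem {S : Finset (Fin n)} {P Q : Finset (Fin S.card)} (h : P ≤ Q)
    {k : Fin S.card} (hk : k ∈ Q) (hk' : k ∉ P) :
    subι X hk ≫ unionCollapse (sub X S) h = 0 :=
  unionι_collapse_of_notMem h hk hk'

theorem subι_collapse_of_notMem_assoc {S : Finset (Fin n)} {P Q : Finset (Fin S.card)} (h : P ≤ Q)
    {k : Fin S.card} (hk : k ∈ Q) (hk' : k ∉ P)
    {Z : C} (f : union (sub X S) P ⟶ Z) :
    subι X hk ≫ unionCollapse (sub X S) h ≫ f = 0 := by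
  rw [← Category.assoc, subι_collapse_of_notMem h _ hk', zero_comp]

theorem subι_unionSubIso_hom {S : Finset (Fin n)} {k : Fin S.card}
    (hk : k ∈ (Finset.univ : Finset (Fin S.card))) :
    subι X hk ≫ (unionSubIso X S).hom = unionι X (subIdx_mem S k) :=
  (Sigma.ι_desc _ _).trans (Category.id_comp _)

theorem subι_unionSubIso_hom_assoc {S : Finset (Fin n)} {k : Fin S.card}
    (hk : k ∈ (Finset.univ : Finset (Fin S.card)))
    {Z : C} (f : union X S ⟶ Z) :
    subι X hk ≫ (unionSubIso X S).hom ≫ f = unionι X (subIdx_mem S k) ≫ f := by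
  rw [← Category.assoc, subι_unionSubIso_hom]

theorem unionι_unionSubIso_inv {S : Finset (Fin n)} (k : Fin S.card) :
    unionι X (subIdx_mem S k) ≫ (unionSubIso X S).inv = subι X (Finset.mem_univ k) := by
  rw [Iso.comp_inv_eq, subι_unionSubIso_hom]

theorem unionι_unionSubIso_inv_assoc {S : Finset (Fin n)} (k : Fin S.card)
    {Z : C} (f : union (sub X S) Finset.univ ⟶ Z) :
    unionι X (subIdx_mem S k) ≫ (unionSubIso X S).inv ≫ f = subι X (Finset.mem_univ k) ≫ f := by
  rw [← Category.assoc, unionι_unionSubIso_inv]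

variable (X)

theorem subIdx_mem_erase {S : Finset (Fin n)} {k l : Fin S.card} (h : l ∈ Finset.univ.erase k) :
    subIdx S l ∈ S.erase (subIdx S k) :=
  Finset.mem_erase.2 ⟨fun h' => Finset.ne_of_mem_erase h (subIdx_injective S h'), subIdx_mem S l⟩

theorem exists_subIdx_of_mem_erase {S : Finset (Fin n)} {k : Fin S.card} {i : Fin n}
    (hi : i ∈ S.erase (subIdx S k)) : ∃ l ∈ Finset.univ.erase k, subIdx S l = i := by
  obtain ⟨l, rfl⟩ := exists_subIdx (Finset.mem_of_mem_erase hi)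
  refine ⟨l, Finset.mem_erase.2 ⟨?_, Finset.mem_univ l⟩, rfl⟩
  rintro rfl
  exact Finset.notMem_erase _ _ hi

/-- The isomorphism `unionSubIso` restricted to the union of all but one of the spaces. -/
noncomputable def subErase (S : Finset (Fin n)) (k : Fin S.card) :
    union (sub X S) (Finset.univ.erase k) ⟶ union X (S.erase (subIdx S k)) :=
  unionIncl (sub X S) (Finset.subset_univ _) ≫ (unionSubIso X S).hom ≫
    unionCollapse X (Finset.erase_subset _ _)

/-- The inverse of `subErase`. -/
noncomputable def subEraseInv (S : Finset (Fin n)) (k : Fin S.card) :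
    union X (S.erase (subIdx S k)) ⟶ union (sub X S) (Finset.univ.erase k) :=
  unionIncl X (Finset.erase_subset _ _) ≫ (unionSubIso X S).inv ≫
    unionCollapse (sub X S) (Finset.subset_univ _)

theorem subι_subErase {S : Finset (Fin n)} {k l : Fin S.card} (h : l ∈ Finset.univ.erase k) :
    subι X h ≫ subErase X S k = unionι X (subIdx_mem_erase h) := by
  rw [subErase, subι_incl_assoc, subι_unionSubIso_hom_assoc,
    unionι_collapse _ (subIdx_mem_erase h)]

theorem subι_subErase_assoc {S : Finset (Fin n)} {k l : Fin S.card}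
    (h : l ∈ Finset.univ.erase k)
    {Z : C} (f : union X (S.erase (subIdx S k)) ⟶ Z) :
    subι X h ≫ subErase X S k ≫ f = unionι X (subIdx_mem_erase h) ≫ f := by
  rw [← Category.assoc, subι_subErase]

theorem unionι_subEraseInv {S : Finset (Fin n)} {k l : Fin S.card} (h : l ∈ Finset.univ.erase k) :
    unionι X (subIdx_mem_erase h) ≫ subEraseInv X S k = subι X h := by
  rw [subEraseInv, unionι_incl_assoc, unionι_unionSubIso_inv_assoc, subι_collapse _ h]

theorem unionι_subEraseInv_assoc {S : Finset (Fin n)} {k l : Fin S.card}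
    (h : l ∈ Finset.univ.erase k)
    {Z : C} (f : union (sub X S) (Finset.univ.erase k) ⟶ Z) :
    unionι X (subIdx_mem_erase h) ≫ subEraseInv X S k ≫ f = subι X h ≫ f := by
  rw [← Category.assoc, unionι_subEraseInv X h]

/-- This and the next three identities say that renumbering a subfamily commutes with adding or
collapsing one member. Applying `F` turns them into the factorizations in `FaceModel`. -/
theorem unionIncl_unionSubIso_inv (S : Finset (Fin n)) (k : Fin S.card) :
    unionIncl X (Finset.erase_subset (subIdx S k) S) ≫ (unionSubIso X S).inv =
      subEraseInv X S k ≫ unionIncl (sub X S) (Finset.subset_univ _) := by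
  refine union_hom_ext fun i hi => ?_
  obtain ⟨l, hl, rfl⟩ := exists_subIdx_of_mem_erase hi
  rw [unionι_incl_assoc, unionι_unionSubIso_inv, unionι_subEraseInv_assoc X hl, subι_incl]

theorem unionIncl_unionSubIso_hom (S : Finset (Fin n)) (k : Fin S.card) :
    unionIncl (sub X S) (Finset.subset_univ (Finset.univ.erase k)) ≫ (unionSubIso X S).hom =
      subErase X S k ≫ unionIncl X (Finset.erase_subset _ _) := by
  refine union_sub_hom_ext fun l hl => ?_
  rw [subι_incl_assoc, subι_unionSubIso_hom, subι_subErase_assoc, unionι_incl]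

theorem unionSubIso_hom_collapse (S : Finset (Fin n)) (k : Fin S.card) :
    (unionSubIso X S).hom ≫ unionCollapse X (Finset.erase_subset (subIdx S k) S) =
      unionCollapse (sub X S) (Finset.subset_univ _) ≫ subErase X S k := by
  refine union_sub_hom_ext fun l hl => ?_
  rw [subι_unionSubIso_hom_assoc]
  by_cases h : l = k
  · subst h
    rw [unionι_collapse_of_notMem _ _ (Finset.notMem_erase _ _),
      subι_collapse_of_notMem_assoc _ _ (Finset.notMem_erase _ _)]
  · have h' : l ∈ Finset.univ.erase k := Finset.mem_erase.2 ⟨h, hl⟩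
    rw [unionι_collapse _ (subIdx_mem_erase h'), subι_collapse_assoc _ h', subι_subErase]

theorem unionSubIso_inv_collapse (S : Finset (Fin n)) (k : Fin S.card) :
    (unionSubIso X S).inv ≫ unionCollapse (sub X S) (Finset.subset_univ (Finset.univ.erase k)) =
      unionCollapse X (Finset.erase_subset (subIdx S k) S) ≫ subEraseInv X S k := by
  rw [Iso.inv_comp_eq, ← Category.assoc, unionSubIso_hom_collapse]
  refine union_sub_hom_ext fun l hl => ?_
  by_cases h : l = k
  · subst h
    simp only [Category.assoc]
    rw [subι_collapse_of_notMem _ _ (Finset.notMem_erase _ _),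
      subι_collapse_of_notMem_assoc _ _ (Finset.notMem_erase _ _)]
  · have h' : l ∈ Finset.univ.erase k := Finset.mem_erase.2 ⟨h, hl⟩
    simp only [Category.assoc]
    rw [subι_collapse _ h', subι_collapse_assoc _ h', subι_subErase_assoc, unionι_subEraseInv]

/-! ### The splitting for contravariant functors. -/

section Contravariant

variable (F : Cᵒᵖ ⥤ Prespectrum.{u})

/-- The bicube of a contravariant functor, whose restriction maps are induced by the
inclusions and whose extension maps are induced by the collapse maps. -/
noncomputable def crossCube : BiCube.{u} n where
  obj S := F.obj (op (union X S))
  res h := F.map (unionIncl X h).op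
  ext h := F.map (unionCollapse X h).op
  res_self S := by rw [unionIncl_self, op_id, F.map_id]
  res_res h h' := by rw [← F.map_comp, ← op_comp, unionIncl_comp]
  ext_self S := by rw [unionCollapse_self, op_id, F.map_id]
  ext_ext h h' := by rw [← F.map_comp, ← op_comp, unionCollapse_comp]
  ext_res hS hT hVS hVT hV := by
    -- Contravariance reverses the composite, so base change for unions is applied with `S` and `T`
    -- exchanged.
    rw [← F.map_comp, ← op_comp, ← F.map_comp, ← op_comp,
      unionIncl_collapse hT hS hVT hVS (by rwa [Finset.inter_comm])]

/-- The faces of `crossCube X F` are given by the subfamilies of `X`. -/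
noncomputable def crossFace (S : Finset (Fin n)) : (crossCube X F).FaceModel S where
  cube := crossCube (sub X S) F
  hom := F.map (unionSubIso X S).inv.op
  inv := F.map (unionSubIso X S).hom.op
  hom_inv := by
    change F.map _ ≫ F.map _ = 𝟙 (F.obj _)
    rw [← F.map_comp, ← op_comp, Iso.hom_inv_id, op_id, F.map_id]
  inv_hom := by
    change F.map _ ≫ F.map _ = 𝟙 (F.obj _)
    rw [← F.map_comp, ← op_comp, Iso.inv_hom_id, op_id, F.map_id]
  hom_res s hs := by
    obtain ⟨k, rfl⟩ := exists_subIdx hs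
    refine ⟨k, F.map (subEraseInv X S k).op, ?_⟩
    change F.map _ ≫ F.map _ = F.map _ ≫ F.map _
    rw [← F.map_comp, ← op_comp, ← F.map_comp, ← op_comp, unionIncl_unionSubIso_inv]
  inv_res k := by
    refine ⟨_, subIdx_mem S k, F.map (subErase X S k).op, ?_⟩
    change F.map _ ≫ F.map _ = F.map _ ≫ F.map _
    rw [← F.map_comp, ← op_comp, ← F.map_comp, ← op_comp, unionIncl_unionSubIso_hom]
  ext_inv s hs := by
    obtain ⟨k, rfl⟩ := exists_subIdx hs
    refine ⟨k, F.map (subErase X S k).op, ?_⟩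
    change F.map _ ≫ F.map _ = F.map _ ≫ F.map _
    rw [← F.map_comp, ← op_comp, ← F.map_comp, ← op_comp, unionSubIso_hom_collapse]

/-- The splitting of a contravariant functor into cross effects. -/
theorem isStableEquiv_cross :
    IsStableEquiv (crossι X F ≫ cocrossπ X F) ∧
    IsStableEquiv (productLift fun S : Finset (Fin n) => cocrossFactor X F S) ∧
    IsStableEquiv (productMap fun S : Finset (Fin n) =>
      crossι (sub X S) F ≫ cocrossπ (sub X S) F) ∧
    IsStableEquiv (wedgeToProd fun S : Finset (Fin n) => cross (sub X S) F) ∧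
    IsStableEquiv (wedgeDesc fun S : Finset (Fin n) => crossSummand X F S) :=
  -- The two cubes of `crossCube` are by definition those in `cross` and `cocross`, so the general
  -- statement unfolds to this one.
  BiCube.FaceModel.isStableEquiv (crossFace X F)

end Contravariant

/-! ### The splitting for covariant functors. -/

section Covariant

variable (F : C ⥤ Prespectrum.{u})

/-- The bicube of a covariant functor, whose restriction maps are induced by the
collapse maps and whose extension maps are induced by the inclusions. -/
noncomputable def covCrossCube : BiCube.{u} n where
  obj S := F.obj (union X S)
  res h := F.map (unionCollapse X h)
  ext h := F.map (unionIncl X h)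
  res_self S := by rw [unionCollapse_self, F.map_id]
  res_res h h' := by rw [← F.map_comp, unionCollapse_comp]
  ext_self S := by rw [unionIncl_self, F.map_id]
  ext_ext h h' := by rw [← F.map_comp, unionIncl_comp]
  ext_res hS hT hVS hVT hV := by
    rw [← F.map_comp, ← F.map_comp, unionIncl_collapse hS hT hVS hVT hV]

/-- The faces of `covCrossCube X F` are given by the subfamilies of `X`. -/
noncomputable def covCrossFace (S : Finset (Fin n)) : (covCrossCube X F).FaceModel S where
  cube := covCrossCube (sub X S) F
  hom := F.map (unionSubIso X S).hom
  inv := F.map (unionSubIso X S).inv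
  hom_inv := by
    change F.map _ ≫ F.map _ = 𝟙 (F.obj _)
    rw [← F.map_comp, Iso.hom_inv_id, F.map_id]
  inv_hom := by
    change F.map _ ≫ F.map _ = 𝟙 (F.obj _)
    rw [← F.map_comp, Iso.inv_hom_id, F.map_id]
  hom_res s hs := by
    obtain ⟨k, rfl⟩ := exists_subIdx hs
    refine ⟨k, F.map (subErase X S k), ?_⟩
    change F.map _ ≫ F.map _ = F.map _ ≫ F.map _
    rw [← F.map_comp, ← F.map_comp, unionSubIso_hom_collapse]
  inv_res k := by
    refine ⟨_, subIdx_mem S k, F.map (subEraseInv X S k), ?_⟩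
    change F.map _ ≫ F.map _ = F.map _ ≫ F.map _
    rw [← F.map_comp, ← F.map_comp, unionSubIso_inv_collapse]
  ext_inv s hs := by
    obtain ⟨k, rfl⟩ := exists_subIdx hs
    refine ⟨k, F.map (subEraseInv X S k), ?_⟩
    change F.map _ ≫ F.map _ = F.map _ ≫ F.map _
    rw [← F.map_comp, ← F.map_comp, unionIncl_unionSubIso_inv]

/-- The splitting of a covariant functor into cross effects. -/
theorem isStableEquiv_covCross :
    IsStableEquiv (covCrossι X F ≫ covCocrossπ X F) ∧
    IsStableEquiv (productLift fun S : Finset (Fin n) => covCocrossFactor X F S) ∧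
    IsStableEquiv (productMap fun S : Finset (Fin n) =>
      covCrossι (sub X S) F ≫ covCocrossπ (sub X S) F) ∧
    IsStableEquiv (wedgeToProd fun S : Finset (Fin n) => covCross (sub X S) F) ∧
    IsStableEquiv (wedgeDesc fun S : Finset (Fin n) => covCrossSummand X F S) :=
  BiCube.FaceModel.isStableEquiv (covCrossFace X F)

end Covariant

end Unions

end CrossEffects

theorem mainTheorem6 (B : Type u) [TopologicalSpace B] [CompactlyGeneratedSpace B]
    [WeaklyHausdorffSpace B] :
    (∀ (F : (Retractive B)ᵒᵖ ⥤ Prespectrum.{v}) (n : ℕ) (X : Fin n → Retractive B),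
      Prespectrum.IsStableEquiv (crossι X F ≫ cocrossπ X F) ∧
      Prespectrum.IsStableEquiv (Prespectrum.productLift fun S : Finset (Fin n) => cocrossFactor X F S) ∧
      Prespectrum.IsStableEquiv (Prespectrum.productMap fun S : Finset (Fin n) =>
        crossι (sub X S) F ≫ cocrossπ (sub X S) F) ∧
      Prespectrum.IsStableEquiv
        (Prespectrum.wedgeToProd fun S : Finset (Fin n) => cross (sub X S) F) ∧
      Prespectrum.IsStableEquiv (Prespectrum.wedgeDesc fun S : Finset (Fin n) => crossSummand X F S)) ∧
    (∀ (F : (Retractive.FiniteCW B)ᵒᵖ ⥤ Prespectrum.{v}) (n : ℕ) (X : Fin n → Retractive.FiniteCW B),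
      Prespectrum.IsStableEquiv (crossι X F ≫ cocrossπ X F) ∧
      Prespectrum.IsStableEquiv (Prespectrum.productLift fun S : Finset (Fin n) => cocrossFactor X F S) ∧
      Prespectrum.IsStableEquiv (Prespectrum.productMap fun S : Finset (Fin n) =>
        crossι (sub X S) F ≫ cocrossπ (sub X S) F) ∧
      Prespectrum.IsStableEquiv
        (Prespectrum.wedgeToProd fun S : Finset (Fin n) => cross (sub X S) F) ∧
      Prespectrum.IsStableEquiv (Prespectrum.wedgeDesc fun S : Finset (Fin n) => crossSummand X F S)) ∧
    (∀ (F : Retractive B ⥤ Prespectrum.{v}) (n : ℕ) (X : Fin n → Retractive B),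
      Prespectrum.IsStableEquiv (covCrossι X F ≫ covCocrossπ X F) ∧
      Prespectrum.IsStableEquiv (Prespectrum.productLift fun S : Finset (Fin n) => covCocrossFactor X F S) ∧
      Prespectrum.IsStableEquiv (Prespectrum.productMap fun S : Finset (Fin n) =>
        covCrossι (sub X S) F ≫ covCocrossπ (sub X S) F) ∧
      Prespectrum.IsStableEquiv
        (Prespectrum.wedgeToProd fun S : Finset (Fin n) => covCross (sub X S) F) ∧
      Prespectrum.IsStableEquiv (Prespectrum.wedgeDesc fun S : Finset (Fin n) => covCrossSummand X F S)) ∧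
    (∀ (F : Retractive.FiniteCW B ⥤ Prespectrum.{v}) (n : ℕ) (X : Fin n → Retractive.FiniteCW B),
      Prespectrum.IsStableEquiv (covCrossι X F ≫ covCocrossπ X F) ∧
      Prespectrum.IsStableEquiv (Prespectrum.productLift fun S : Finset (Fin n) => covCocrossFactor X F S) ∧
      Prespectrum.IsStableEquiv (Prespectrum.productMap fun S : Finset (Fin n) =>
        covCrossι (sub X S) F ≫ covCocrossπ (sub X S) F) ∧
      Prespectrum.IsStableEquiv
        (Prespectrum.wedgeToProd fun S : Finset (Fin n) => covCross (sub X S) F) ∧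
      Prespectrum.IsStableEquiv (Prespectrum.wedgeDesc fun S : Finset (Fin n) => covCrossSummand X F S)) := by
  -- Only zero morphisms and finite coproducts are needed. Both categories have them, the coproduct
  -- being the pushout along `B`, which preserves finite relative CW complexes.
  exact ⟨fun F n X => isStableEquiv_cross X F, fun F n X => isStableEquiv_cross X F,
    fun F n X => isStableEquiv_covCross X F, fun F n X => isStableEquiv_covCross X F⟩
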